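/- Let $\mathcal{O}=\mathcal{O}_{\mathbb{C}^n,0}$, let $\mathrm{Der}$ be the module of germs at $0$ of holomorphic vector fields on $\mathbb{C}^n$, and let $(D,0)=(V(f),0)\subset(\mathbb{C}^n,0)$ be a germ of a reduced hypersurface that is a free divisor, i.e. $\mathrm{Der}(-\log D)=\{\delta\in\mathrm{Der} : \delta(f)\in(f)\}$ is a free $\mathcal{O}$-module. A deformation of $D$ over $S=\operatorname{Spec}A$ ($A$ a local Artinian $\mathbb{C}$-algebra with residue field $\mathbb{C}$ and maximal ideal $\mathfrak{m}_S$) is a germ $X\subset\mathbb{C}^n\times S$, flat over $S$, together with an isomorphism of $D$ with the central fibre. It is admissible if $\mathrm{Der}(-\log X/S)/\mathfrak{m}_S\mathrm{Der}(-\log X/S)=\mathrm{Der}(-\log D)$, where $\mathrm{Der}(-\log X/S)$ is the module of vector fields on $\mathbb{C}^n\times S$ over $S$ that preserve the ideal of $X$ and $D$ is identified with the central fibre. It is linearly admissible if moreover $\mathrm{Der}(-\log X/S)$ has a basis of vector fields whose coefficients are linear in $x_1,\dots,x_n$. Isomorphisms of deformations are isomorphisms over $S$ compatible with the embeddings of $D$.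 Let $\mathcal{FT}^1(D)$ and $\mathcal{LFT}^1(D)$ be the sets of isomorphism classes of admissible, respectively linearly admissible, deformations over $\operatorname{Spec}\mathbb{C}[\varepsilon]$, $\varepsilon^2=0$, with the vector space structure of the tangent space of a deformation functor: $r=as+bt$ if some (linearly) admissible deformation over $\mathbb{C}[\varepsilon_1,\varepsilon_2]/(\varepsilon_1,\varepsilon_2)^2$ restricts to $s$, $t$, $r$ along $(\varepsilon_1,\varepsilon_2)\mapsto(\varepsilon,0),(0,\varepsilon),(a\varepsilon,b\varepsilon)$ respectively. Let $\mathcal{H}^1(\mathcal{C}^\bullet)_0$ be the stalk at $0$ of the first cohomology of the complex $\mathcal{C}^p=\mathcal{H}om_{\mathcal{O}}(\bigwedge^p\mathrm{Der}(-\log D),\mathrm{Der}/\mathrm{Der}(-\log D))$ with the Lie algebroid differential; thus it is the space of $\mathcal{O}$-linear $\psi:\mathrm{Der}(-\log D)\to\mathrm{Der}/\mathrm{Der}(-\log D)$ with $\psi([\delta,\nu])-[\delta,\psi(\nu)]+[\nu,\psi(\delta)]=0$ for all $\delta,\nu\in\mathrm{Der}(-\log D)$, modulo the maps $\delta\mapsto[\delta,\sigma]$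 with $\sigma\in\mathrm{Der}/\mathrm{Der}(-\log D)$. **Theorem.** (1) Suppose that $(D,0)$ is defined by a weighted homogeneous polynomial, for positive integer weights $w_1,\dots,w_n$ of $x_1,\dots,x_n$. Let $(\mathcal{H}^1(\mathcal{C}^\bullet)_0)_0$ be the weight-zero part of $\mathcal{H}^1(\mathcal{C}^\bullet)_0$, i.e. the subspace of the classes of cocycles $\psi$ that preserve weights, where $\partial/\partial x_i$ has weight $-w_i$. Then there is an isomorphism of complex vector spaces $$(\mathcal{H}^1(\mathcal{C}^\bullet)_0)_0\;\cong\;\mathcal{FT}^1(D),$$ which maps the class of a weight-zero cocycle $\psi$ to the class of an admissible deformation $X$ with central fibre $D$ such that each $\delta\in\mathrm{Der}(-\log D)$ has a lift $\delta+\varepsilon\tilde\delta\in\mathrm{Der}(-\log X/\operatorname{Spec}\mathbb{C}[\varepsilon])$ in which $\tilde\delta$ represents $\psi(\delta)$. (2) Suppose that $(D,0)$ is a linear free divisor, i.e. $\mathrm{Der}(-\log D)$ has a basis of vector fields all of whose coefficients are linear forms. Then the natural map $\mathcal{LFT}^1(D)\to\mathcal{FT}^1(D)$ is an isomorphism of complex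 vector spaces. -/

import Mathlib

open scoped TensorProduct

noncomputable section

namespace FreeDiv

/-! ### The local ring of `ℂⁿ` at the origin -/

/-- The ring `ℂ{x₁, …, xₙ}` of convergent power series: those that converge absolutely on some
polydisc of positive radius around the origin. -/
def convergentSeries (n : ℕ) : Subalgebra ℂ (MvPowerSeries (Fin n) ℂ) where
  carrier := {φ | ∃ r : ℝ, 0 < r ∧
    Summable fun d : Fin n →₀ ℕ => ‖MvPowerSeries.coeff d φ‖ * r ^ d.degree}
  mul_mem' := by
    classical
    rintro φ ψ ⟨r, hr, hφ⟩ ⟨s, hs, hψ⟩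
    set t := min r s with ht
    have ht0 : 0 < t := lt_min hr hs
    have hφ' : Summable fun d : Fin n →₀ ℕ => ‖MvPowerSeries.coeff d φ‖ * t ^ d.degree :=
      Summable.of_nonneg_of_le (fun d => by positivity)
        (fun d => by gcongr; exact min_le_left _ _) hφ
    have hψ' : Summable fun d : Fin n →₀ ℕ => ‖MvPowerSeries.coeff d ψ‖ * t ^ d.degree :=
      Summable.of_nonneg_of_le (fun d => by positivity)
        (fun d => by gcongr; exact min_le_right _ _) hψ
    refine ⟨t, ht0, ?_⟩
    have h := summable_sum_mul_antidiagonal_of_summable_mul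
      (Summable.mul_of_nonneg hφ' hψ' (fun d => by positivity) (fun d => by positivity))
    refine Summable.of_nonneg_of_le (fun d => by positivity) (fun d => ?_) h
    rw [MvPowerSeries.coeff_mul]
    calc ‖∑ p ∈ Finset.HasAntidiagonal.antidiagonal d, MvPowerSeries.coeff p.1 φ * MvPowerSeries.coeff p.2 ψ‖
          * t ^ d.degree
        ≤ (∑ p ∈ Finset.HasAntidiagonal.antidiagonal d,
            ‖MvPowerSeries.coeff p.1 φ * MvPowerSeries.coeff p.2 ψ‖) * t ^ d.degree := by
          gcongr; exact norm_sum_le _ _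
      _ = _ := by
          rw [Finset.sum_mul]
          refine Finset.sum_congr rfl fun p hp => ?_
          rw [← Finset.HasAntidiagonal.mem_antidiagonal.mp hp, map_add, pow_add, norm_mul]
          ring
  add_mem' := by
    rintro φ ψ ⟨r, hr, hφ⟩ ⟨s, hs, hψ⟩
    refine ⟨min r s, lt_min hr hs, ?_⟩
    refine Summable.of_nonneg_of_le (fun d => by have := lt_min hr hs; positivity)
      (fun d => ?_) (hφ.add hψ)
    have h0 := lt_min hr hs
    rw [map_add]
    calc ‖MvPowerSeries.coeff d φ + MvPowerSeries.coeff d ψ‖ * min r s ^ d.degree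
        ≤ (‖MvPowerSeries.coeff d φ‖ + ‖MvPowerSeries.coeff d ψ‖) * min r s ^ d.degree := by
          gcongr; exact norm_add_le _ _
      _ = ‖MvPowerSeries.coeff d φ‖ * min r s ^ d.degree
          + ‖MvPowerSeries.coeff d ψ‖ * min r s ^ d.degree := by ring
      _ ≤ _ := by
          gcongr
          · exact min_le_left _ _
          · exact min_le_right _ _
  algebraMap_mem' := by
    classical
    intro c
    refine ⟨1, one_pos, summable_of_ne_finset_zero (s := {0}) fun d hd => ?_⟩
    have : d ≠ 0 := by simpa using hd
    simp [MvPowerSeries.algebraMap_apply, MvPowerSeries.coeff_C, this]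

/-- The local ring `𝒪_{ℂⁿ,0}`. -/
def O (n : ℕ) : Type := ↥(convergentSeries n)

instance (n : ℕ) : CommRing (O n) := inferInstanceAs (CommRing ↥(convergentSeries n))

instance (n : ℕ) : Algebra ℂ (O n) := inferInstanceAs (Algebra ℂ ↥(convergentSeries n))

/-- The power series expansion of a germ. -/
def toSeries (n : ℕ) : O n →ₐ[ℂ] MvPowerSeries (Fin n) ℂ := (convergentSeries n).val

/-- The germ at the origin of a polynomial function. -/
def polyGerm {n : ℕ} (p : MvPolynomial (Fin n) ℂ) : O n :=
  ⟨(p : MvPowerSeries (Fin n) ℂ), 1, one_pos,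
    summable_of_ne_finset_zero (s := p.support) fun d hd => by
      simp [MvPolynomial.notMem_support_iff.mp hd]⟩

/-- The coordinate functions. -/
def x {n : ℕ} (i : Fin n) : O n := polyGerm (MvPolynomial.X i)

/-! ### Logarithmic vector fields and free divisors -/

/-- The derivations of the `R`-algebra `B` that preserve the ideal `I`.
For `R = ℂ`, `B = 𝒪_{ℂⁿ,0}` and `I = (f)` this is `Der(-log D)_0`, `D = V(f)`;
for `R = 𝒪_S` and `B = 𝒪_{ℂⁿ × S}` it is `Der(-log X/S)`, `X = V(I)`. -/
def derLog (R : Type*) {B : Type*} [CommRing R] [CommRing B] [Algebra R B] (I : Ideal B) :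
    Submodule B (Derivation R B B) where
  carrier := {δ | ∀ h ∈ I, δ h ∈ I}
  zero_mem' := fun h _ => by simp
  add_mem' := fun {a b} ha hb h hh => by
    simpa using I.add_mem (ha h hh) (hb h hh)
  smul_mem' := fun c a ha h hh => by
    simpa using I.mul_mem_left c (ha h hh)

variable {n : ℕ}

/-- The germ at the origin of a hypersurface `D`, given by its ideal `J ⊆ 𝒪_{ℂⁿ,0}`,
is the germ of a (reduced) free divisor. -/
structure IsFreeDivisorGerm (J : Ideal (O n)) : Prop where
  /-- `D` is the zero locus of one non-zero equation which vanishes at the origin. -/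
  hypersurface : ∃ f : O n, f ≠ 0 ∧ MvPowerSeries.constantCoeff (toSeries n f) = 0
    ∧ J = Ideal.span {f}
  reduced : J.IsRadical
  free : Module.Free (O n) (derLog ℂ J)

/-- A free divisor germ is linear if `Der(-log D)` has a basis of vector fields all of whose
coefficients `δ(x_j)` are linear forms. -/
def IsLinear (J : Ideal (O n)) : Prop :=
  ∃ b : Module.Basis (Fin n) (O n) (derLog ℂ J),
    ∀ i j, (b i : Derivation ℂ (O n) (O n)) (x j) ∈ Submodule.span ℂ (Set.range (x (n := n)))

/-! ### The complex `𝒞^•` in degrees `0, 1, 2` and its first cohomology -/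

/-- `𝒞⁰ = Der / Der(-log D)`. -/
def NormalModule (J : Ideal (O n)) : Type :=
  Derivation ℂ (O n) (O n) ⧸ derLog ℂ J

instance (J : Ideal (O n)) : AddCommGroup (NormalModule J) :=
  inferInstanceAs (AddCommGroup (Derivation ℂ (O n) (O n) ⧸ derLog ℂ J))

instance (J : Ideal (O n)) : Module (O n) (NormalModule J) :=
  inferInstanceAs (Module (O n) (Derivation ℂ (O n) (O n) ⧸ derLog ℂ J))

instance (J : Ideal (O n)) : Module ℂ (NormalModule J) :=
  inferInstanceAs (Module ℂ (Derivation ℂ (O n) (O n) ⧸ derLog ℂ J))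

instance (J : Ideal (O n)) : IsScalarTower ℂ (O n) (NormalModule J) :=
  inferInstanceAs (IsScalarTower ℂ (O n) (Derivation ℂ (O n) (O n) ⧸ derLog ℂ J))

/-- The class of a vector field in `Der / Der(-log D)`. -/
def vfClass (J : Ideal (O n)) : Derivation ℂ (O n) (O n) →ₗ[O n] NormalModule J :=
  (derLog ℂ J).mkQ

theorem vfClass_surjective (J : Ideal (O n)) : Function.Surjective (vfClass J) :=
  (derLog ℂ J).mkQ_surjective

theorem vfClass_eq_zero {J : Ideal (O n)} {η : Derivation ℂ (O n) (O n)} :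
    vfClass J η = 0 ↔ η ∈ derLog ℂ J :=
  Submodule.Quotient.mk_eq_zero _

/-- `𝒞¹ = Hom_𝒪 (Der(-log D), Der / Der(-log D))`. -/
abbrev C1 (J : Ideal (O n)) : Type := derLog ℂ J →ₗ[O n] NormalModule J

theorem lie_mem_derLog {J : Ideal (O n)} {δ ν : Derivation ℂ (O n) (O n)}
    (hδ : δ ∈ derLog ℂ J) (hν : ν ∈ derLog ℂ J) : ⁅δ, ν⁆ ∈ derLog ℂ J := by
  intro h hh
  rw [Derivation.commutator_apply]
  exact J.sub_mem (hδ _ (hν _ hh)) (hν _ (hδ _ hh))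

/-- The Lie bracket on `Der(-log D)`. -/
def logBracket {J : Ideal (O n)} (δ ν : derLog ℂ J) : derLog ℂ J :=
  ⟨⁅(δ : Derivation ℂ (O n) (O n)), (ν : Derivation ℂ (O n) (O n))⁆,
    lie_mem_derLog δ.2 ν.2⟩

/-- The action `[η] ↦ [δ, η]` of `δ ∈ Der(-log D)` on `Der / Der(-log D)`. -/
def bracketQuot {J : Ideal (O n)} (δ : derLog ℂ J) : NormalModule J →ₗ[ℂ] NormalModule J :=
  let e := Submodule.Quotient.restrictScalarsEquiv ℂ (derLog ℂ J)
  e.toLinearMap ∘ₗ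
    (((derLog ℂ J).restrictScalars ℂ).mapQ ((derLog ℂ J).restrictScalars ℂ)
      (LieAlgebra.ad ℂ (Derivation ℂ (O n) (O n)) (δ : Derivation ℂ (O n) (O n)))
      (fun _ hη => lie_mem_derLog δ.2 hη)) ∘ₗ e.symm.toLinearMap

theorem bracketQuot_vfClass {J : Ideal (O n)} (δ : derLog ℂ J) (η : Derivation ℂ (O n) (O n)) :
    bracketQuot δ (vfClass J η) = vfClass J ⁅(δ : Derivation ℂ (O n) (O n)), η⁆ := rfl

/-- `d⁰(σ)(δ) = -[δ, σ]`. -/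
def d0 (J : Ideal (O n)) : NormalModule J →ₗ[ℂ] C1 J where
  toFun σ :=
    { toFun := fun δ => -bracketQuot δ σ
      map_add' := fun δ ν => by
        obtain ⟨η, rfl⟩ := vfClass_surjective J σ
        simp only [bracketQuot_vfClass, Submodule.coe_add, add_lie, map_add]
        abel
      map_smul' := fun h δ => by
        obtain ⟨η, rfl⟩ := vfClass_surjective J σ
        simp only [bracketQuot_vfClass, RingHom.id_apply, smul_neg, neg_inj]
        rw [← map_smul, ← sub_eq_zero, ← map_sub, vfClass_eq_zero]
        have : ⁅((h • δ : derLog ℂ J) : Derivation ℂ (O n) (O n)), η⁆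
            - h • ⁅(δ : Derivation ℂ (O n) (O n)), η⁆
            = -(η h) • (δ : Derivation ℂ (O n) (O n)) := by
          ext1 g
          simp only [Derivation.commutator_apply, Derivation.sub_apply, Derivation.smul_apply,
            Submodule.coe_smul, smul_eq_mul, Derivation.leibniz]
          ring
        rw [this]
        exact Submodule.smul_mem _ _ δ.2 }
  map_add' σ τ := by
    ext δ
    simp only [map_add, LinearMap.coe_mk, AddHom.coe_mk, LinearMap.add_apply, neg_add]
  map_smul' c σ := by
    ext δ
    simp only [map_smul, LinearMap.coe_mk, AddHom.coe_mk, LinearMap.smul_apply, RingHom.id_apply,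
      smul_neg]

/-- `d¹(ψ)(δ₁ ∧ δ₂) = -[δ₁, ψ(δ₂)] + [δ₂, ψ(δ₁)] + ψ([δ₁, δ₂])`, as a function of `δ₁, δ₂`. -/
def d1 (J : Ideal (O n)) : C1 J →ₗ[ℂ] (derLog ℂ J → derLog ℂ J → NormalModule J) where
  toFun ψ := fun δ₁ δ₂ =>
    -bracketQuot δ₁ (ψ δ₂) + bracketQuot δ₂ (ψ δ₁) + ψ (logBracket δ₁ δ₂)
  map_add' ψ φ := by
    funext δ₁ δ₂
    simp only [LinearMap.add_apply, map_add, Pi.add_apply]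
    abel
  map_smul' c ψ := by
    funext δ₁ δ₂
    simp only [LinearMap.smul_apply, map_smul, Pi.smul_apply, RingHom.id_apply, smul_add, smul_neg]

theorem d1_d0 (J : Ideal (O n)) (σ : NormalModule J) : d1 J (d0 J σ) = 0 := by
  obtain ⟨η, rfl⟩ := vfClass_surjective J σ
  funext δ ν
  change -bracketQuot δ (-bracketQuot ν (vfClass J η)) + bracketQuot ν (-bracketQuot δ (vfClass J η))
    + -bracketQuot (logBracket δ ν) (vfClass J η) = 0
  simp only [map_neg, bracketQuot_vfClass, logBracket]
  rw [leibniz_lie (δ : Derivation ℂ (O n) (O n)) (ν : Derivation ℂ (O n) (O n)) η, map_add]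
  abel

/-- The space of `1`-cocycles. -/
abbrev Z1 (J : Ideal (O n)) : Submodule ℂ (C1 J) := LinearMap.ker (d1 J)

/-- The stalk at the origin of the first cohomology sheaf: `ker d¹ / im d⁰`. -/
abbrev H1 (J : Ideal (O n)) : Type := Z1 J ⧸ (LinearMap.range (d0 J)).submoduleOf (Z1 J)

/-! ### Weights -/

/-- The vector field `δ = ∑ δ(x_i) ∂/∂x_i` is homogeneous of weight `p`, where `x_i` has weight
`w i` and `∂/∂x_i` has weight `-w i`. -/
def IsHomogeneousVF (w : Fin n → ℕ) (p : ℤ) (δ : Derivation ℂ (O n) (O n)) : Prop :=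
  ∀ (i : Fin n) (d : Fin n →₀ ℕ),
    MvPowerSeries.coeff d (toSeries n (δ (x i))) ≠ 0 →
      ((Finsupp.weight w d : ℕ) : ℤ) = p + w i

/-- The cocycles of weight zero, i.e. the cocycles which preserve weights. -/
def weightZeroCocycles (w : Fin n → ℕ) (J : Ideal (O n)) : Submodule ℂ (Z1 J) where
  carrier := {ψ | ∀ (p : ℤ) (δ : derLog ℂ J), IsHomogeneousVF w p δ →
    ∃ η : Derivation ℂ (O n) (O n), IsHomogeneousVF w p η ∧ (ψ : C1 J) δ = vfClass J η}
  zero_mem' := fun p δ _ => ⟨0, fun i d h => by simp at h, by simp⟩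
  add_mem' := fun {a b} ha hb p δ hδ => by
    obtain ⟨η, hη, e⟩ := ha p δ hδ
    obtain ⟨θ, hθ, e'⟩ := hb p δ hδ
    refine ⟨η + θ, fun i d h => ?_, by simp [e, e']⟩
    by_cases h1 : MvPowerSeries.coeff d (toSeries n (η (x i))) = 0
    · refine hθ i d fun h2 => h ?_
      simp [h1, h2]
    · exact hη i d h1
  smul_mem' := fun c a ha p δ hδ => by
    obtain ⟨η, hη, e⟩ := ha p δ hδ
    refine ⟨c • η, fun i d h => hη i d fun h1 => h ?_, ?_⟩
    · simp [h1]
    · rw [Submodule.coe_smul, LinearMap.smul_apply, e]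
      rfl

/-- The weight-zero part of `H¹`: the classes of the cocycles of weight zero. -/
def weightZeroH1 (w : Fin n → ℕ) (J : Ideal (O n)) : Submodule ℂ (H1 J) :=
  (weightZeroCocycles w J).map (Submodule.mkQ _)

/-- The class in the weight-zero part of `H¹` of a cocycle of weight zero. -/
def weightZeroClass (w : Fin n → ℕ) (J : Ideal (O n)) (ψ : weightZeroCocycles w J) :
    weightZeroH1 w J :=
  ⟨Submodule.mkQ _ (ψ : Z1 J), Submodule.mem_map_of_mem ψ.2⟩

/-! ### Admissible deformations

The base `S` is given by its local ring `A`, a local `ℂ`-algebra of finite dimension, with residue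
map `π : A → ℂ`; the local ring of `ℂⁿ × S` at the origin is `A ⊗ 𝒪_{ℂⁿ,0}`. -/

section Deformations

variable {A : Type} [CommRing A] [Algebra ℂ A]

/-- Restriction of functions from `ℂⁿ × S` to `ℂⁿ`. -/
def toFibre (π : A →ₐ[ℂ] ℂ) : A ⊗[ℂ] O n →ₐ[ℂ] O n :=
  Algebra.TensorProduct.productMap ((Algebra.ofId ℂ (O n)).comp π) (AlgHom.id ℂ (O n))

/-- The extension to `𝒪_{ℂⁿ × S}` of the maximal ideal `𝔪_S = ker π`. -/
def maxIdealExt (n : ℕ) (π : A →ₐ[ℂ] ℂ) : Ideal (A ⊗[ℂ] O n) :=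
  (RingHom.ker π).map (algebraMap A (A ⊗[ℂ] O n))

/-- A deformation of `D = V(J)` over `S`: a germ `X ⊆ ℂⁿ × S`, flat over `S`, with an isomorphism
of `D` with the central fibre `X_s`, given as a closed embedding `i : D → X` (a surjection of local
rings) with image `X_s = V(𝔪_S 𝒪_X)`. -/
structure Deformation (π : A →ₐ[ℂ] ℂ) (J : Ideal (O n)) where
  /-- the ideal of `X` -/
  ideal : Ideal (A ⊗[ℂ] O n)
  flat : Module.Flat A ((A ⊗[ℂ] O n) ⧸ ideal)
  /-- the embedding `i : D → X`, on functions -/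
  emb : ((A ⊗[ℂ] O n) ⧸ ideal) →ₐ[ℂ] (O n ⧸ J)
  emb_surjective : Function.Surjective emb
  emb_ker : RingHom.ker emb = (maxIdealExt n π).map (Ideal.Quotient.mk ideal)

variable {π : A →ₐ[ℂ] ℂ} {J : Ideal (O n)}

/-- The vector field `δ` on `ℂⁿ` is the restriction of the vector field `Δ` on `ℂⁿ × S` over `S`. -/
def RestrictsTo (π : A →ₐ[ℂ] ℂ) (Δ : Derivation A (A ⊗[ℂ] O n) (A ⊗[ℂ] O n))
    (δ : Derivation ℂ (O n) (O n)) : Prop :=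
  ∀ F, toFibre π (Δ F) = δ (toFibre π F)

/-- The deformation is admissible: `Der(-log X/S) / 𝔪_S Der(-log X/S) = Der(-log D)`, where `D` is
identified with the central fibre `X_s ⊆ ℂⁿ`. That is, restriction to `ℂⁿ` maps `Der(-log X/S)`
onto `Der(-log X_s)`, with kernel `𝔪_S Der(-log X/S)`. -/
def Deformation.IsAdmissible (X : Deformation π J) : Prop :=
  (∀ δ ∈ derLog ℂ (X.ideal.map (toFibre π)), ∃ Δ ∈ derLog A X.ideal, RestrictsTo π Δ δ) ∧
  (∀ Δ ∈ derLog A X.ideal, RestrictsTo π Δ 0 → Δ ∈ maxIdealExt n π • derLog A X.ideal)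

/-- The deformation is linearly admissible: it is admissible, and `Der(-log X/S)` has a basis of
vector fields all of whose coefficients are linear in `x₁, …, xₙ`. -/
def Deformation.IsLinearlyAdmissible (X : Deformation π J) : Prop :=
  X.IsAdmissible ∧
  ∃ b : Module.Basis (Fin n) (A ⊗[ℂ] O n) (derLog A X.ideal),
    ∀ i j, (b i : Derivation A (A ⊗[ℂ] O n) (A ⊗[ℂ] O n)) (1 ⊗ₜ x j) ∈
      Submodule.span A (Set.range fun l : Fin n => (1 : A) ⊗ₜ[ℂ] x l)

/-- Isomorphism of deformations over `S`: an isomorphism of the total spaces over `S` which is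
compatible with the embeddings of `D`. -/
def Deformation.Iso (X Y : Deformation π J) : Prop :=
  ∃ τ : ((A ⊗[ℂ] O n) ⧸ X.ideal) ≃ₐ[A] ((A ⊗[ℂ] O n) ⧸ Y.ideal), ∀ z, Y.emb (τ z) = X.emb z

theorem Deformation.iso_equivalence :
    Equivalence (Deformation.Iso : Deformation π J → Deformation π J → Prop) where
  refl _ := ⟨AlgEquiv.refl, fun _ => rfl⟩
  symm := fun {_ _} ⟨τ, h⟩ => ⟨τ.symm, fun z => by rw [← h, τ.apply_symm_apply]⟩
  trans := fun {_ _ _} ⟨τ, h⟩ ⟨σ, k⟩ => ⟨τ.trans σ, fun z => by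
    rw [AlgEquiv.trans_apply, k, h]⟩

/-- Isomorphism of admissible deformations. -/
def admissibleSetoid (π : A →ₐ[ℂ] ℂ) (J : Ideal (O n)) :
    Setoid {X : Deformation π J // X.IsAdmissible} where
  r X Y := X.1.Iso Y.1
  iseqv := Deformation.iso_equivalence.comap Subtype.val

/-- Isomorphism of linearly admissible deformations. -/
def linearlyAdmissibleSetoid (π : A →ₐ[ℂ] ℂ) (J : Ideal (O n)) :
    Setoid {X : Deformation π J // X.IsLinearlyAdmissible} where
  r X Y := X.1.Iso Y.1
  iseqv := Deformation.iso_equivalence.comap Subtype.val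

/-- `FD_D(A)`: isomorphism classes of admissible deformations of `D` over `Spec A`. -/
def FD (π : A →ₐ[ℂ] ℂ) (J : Ideal (O n)) : Type := Quotient (admissibleSetoid π J)

/-- `LFD_D(A)`: isomorphism classes of linearly admissible deformations of `D` over `Spec A`. -/
def LFD (π : A →ₐ[ℂ] ℂ) (J : Ideal (O n)) : Type := Quotient (linearlyAdmissibleSetoid π J)

/-- The isomorphism class of an admissible deformation. -/
def FD.mk (X : Deformation π J) (hX : X.IsAdmissible) : FD π J :=
  Quotient.mk (admissibleSetoid π J) ⟨X, hX⟩

/-- The isomorphism class of a linearly admissible deformation. -/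
def LFD.mk (X : Deformation π J) (hX : X.IsLinearlyAdmissible) : LFD π J :=
  Quotient.mk (linearlyAdmissibleSetoid π J) ⟨X, hX⟩

/-- The natural map `LFD_D(A) → FD_D(A)`. -/
def LFD.toFD : LFD π J → FD π J :=
  Quotient.lift (fun X => FD.mk X.1 X.2.1) fun X Y h =>
    Quotient.sound (s := admissibleSetoid π J) (a := ⟨X.1, X.2.1⟩) (b := ⟨Y.1, Y.2.1⟩) h

/-- `X'` is the pull-back of the deformation `X` along `Spec A' → Spec A`. -/
def IsBaseChange {A' : Type} [CommRing A'] [Algebra ℂ A'] {π' : A' →ₐ[ℂ] ℂ} (α : A →ₐ[ℂ] A')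
    (X : Deformation π J) (X' : Deformation π' J) : Prop :=
  X'.ideal = X.ideal.map (Algebra.TensorProduct.map α (AlgHom.id ℂ (O n))) ∧
  ∀ F : A ⊗[ℂ] O n,
    X'.emb (Ideal.Quotient.mk _ (Algebra.TensorProduct.map α (AlgHom.id ℂ (O n)) F)) =
      X.emb (Ideal.Quotient.mk _ F)

end Deformations

/-! ### First order deformations -/

/-- `ℂ[ε] = ℂ[t]/(t²)`. -/
def Eps : Type := DualNumber ℂ

instance : CommRing Eps := inferInstanceAs (CommRing (DualNumber ℂ))

instance : Algebra ℂ Eps := inferInstanceAs (Algebra ℂ (DualNumber ℂ))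

/-- The element `ε` of `ℂ[ε]`. -/
def eps : Eps := DualNumber.eps

/-- The residue map `ℂ[ε] → ℂ`. -/
def resEps : Eps →ₐ[ℂ] ℂ := TrivSqZeroExt.fstHom ℂ ℂ ℂ

/-- `ℂ[ε₁, ε₂] / (ε₁, ε₂)² = ℂ[ε] ×_ℂ ℂ[ε]`. -/
def Eps2 : Type := TrivSqZeroExt ℂ (ℂ × ℂ)

instance : CommRing Eps2 := inferInstanceAs (CommRing (TrivSqZeroExt ℂ (ℂ × ℂ)))

instance : Algebra ℂ Eps2 := inferInstanceAs (Algebra ℂ (TrivSqZeroExt ℂ (ℂ × ℂ)))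

/-- The residue map of `ℂ[ε₁, ε₂] / (ε₁, ε₂)²`. -/
def resEps2 : Eps2 →ₐ[ℂ] ℂ := TrivSqZeroExt.fstHom ℂ ℂ (ℂ × ℂ)

/-- The map `ℂ[ε₁, ε₂] / (ε₁, ε₂)² → ℂ[ε]` with `ε₁ ↦ a ε`, `ε₂ ↦ b ε`. -/
def epsMap (a b : ℂ) : Eps2 →ₐ[ℂ] Eps :=
  TrivSqZeroExt.map (a • LinearMap.fst ℂ ℂ ℂ + b • LinearMap.snd ℂ ℂ ℂ)

/-- `FT¹(D) = FD_D(ℂ[t]/(t²))`. -/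
abbrev FT1 (J : Ideal (O n)) : Type := FD resEps J

/-- `LFT¹(D) = LFD_D(ℂ[t]/(t²))`. -/
abbrev LFT1 (J : Ideal (O n)) : Type := LFD resEps J

/-- `r = a s + b t` in the tangent space `FT¹(D)` of the functor `FD_D`: there is a deformation over
`ℂ[ε₁, ε₂] / (ε₁, ε₂)²` whose restrictions along `(ε₁, ε₂) ↦ (ε, 0)`, `(0, ε)`, `(a ε, b ε)` are in
the classes `s`, `t`, `r`. -/
def FT1.IsLinComb {J : Ideal (O n)} (a b : ℂ) (s t r : FT1 J) : Prop :=
  ∃ (W : Deformation resEps2 J) (_ : W.IsAdmissible) (X Y Z : Deformation resEps J)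
    (hX : X.IsAdmissible) (hY : Y.IsAdmissible) (hZ : Z.IsAdmissible),
    IsBaseChange (epsMap 1 0) W X ∧ IsBaseChange (epsMap 0 1) W Y ∧ IsBaseChange (epsMap a b) W Z ∧
    FD.mk X hX = s ∧ FD.mk Y hY = t ∧ FD.mk Z hZ = r

/-- `r = a s + b t` in the tangent space `LFT¹(D)` of the functor `LFD_D`. -/
def LFT1.IsLinComb {J : Ideal (O n)} (a b : ℂ) (s t r : LFT1 J) : Prop :=
  ∃ (W : Deformation resEps2 J) (_ : W.IsLinearlyAdmissible) (X Y Z : Deformation resEps J)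
    (hX : X.IsLinearlyAdmissible) (hY : Y.IsLinearlyAdmissible) (hZ : Z.IsLinearlyAdmissible),
    IsBaseChange (epsMap 1 0) W X ∧ IsBaseChange (epsMap 0 1) W Y ∧ IsBaseChange (epsMap a b) W Z ∧
    LFD.mk X hX = s ∧ LFD.mk Y hY = t ∧ LFD.mk Z hZ = r

/-- The first order deformation `X` belongs to the cocycle `ψ`: its central fibre is `D` itself and
every `δ ∈ Der(-log D)` lifts to a field `δ + ε η ∈ Der(-log X/T_ε)` with `[η] = ψ(δ)`. -/
def BelongsTo {J : Ideal (O n)} (X : Deformation resEps J) (ψ : C1 J) : Prop :=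
  (∀ F, X.emb (Ideal.Quotient.mk _ F) = Ideal.Quotient.mk J (toFibre resEps F)) ∧
  ∀ δ : derLog ℂ J, ∃ η : Derivation ℂ (O n) (O n), vfClass J η = ψ δ ∧
    ∃ Δ ∈ derLog Eps X.ideal, ∀ h : O n,
      Δ (1 ⊗ₜ h) = 1 ⊗ₜ[ℂ] (δ : Derivation ℂ (O n) (O n)) h + eps ⊗ₜ[ℂ] η h

end FreeDiv

end

noncomputable section

namespace FreeDiv

open scoped ENNReal

variable {n : ℕ}

/-! Let `f` be a reduced equation of `D`. After a choice of parametrisation, a first order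
deformation of `D` is `f + ε g = 0`, and a change of parametrisation alters `g` by `η(f)` modulo
`f`. Deformations are thus classified by `g` modulo the Tyurina ideal `(f, ∂₁f, …, ∂ₙf)`. If `δ(f) =
α f`, then `δ + ε η` preserves `(f + ε g)` exactly when `η(f) ≡ α g - δ(g)` modulo `f`. Since `η ↦
η(f)` embeds `Der / Der(-log D)` into `𝒪 / (f)`, an admissible `g` determines `ψ(δ) = [η]`, and `ψ`
is a cocycle because brackets of lifts are lifts (`IsReducedEquation.Extends.exists_cocycle`). Such
a `g` is called a potential of `ψ`. It is unique modulo `f`, and `ψ` is a coboundary exactly when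
`g` lies in the Tyurina ideal. Hence `H¹` is the space of first order admissible deformations as
soon as every cocycle has a potential.

This existence (`IsReducedEquation.exists_isPotential`) is where freeness enters. By Saito's
criterion (`IsReducedEquation.exists_unit_det`) the coefficient matrix `A` of a basis `b` has
determinant `u f` with `u` a unit, so `u f ∂_j = ∑ adj(A)_{jk} b_k`. Differentiating `adj(A) A =
det(A)` in the direction of the matrix of the `ψ(b_k)` produces one function `g` with `ψ(f θ) = [g
θ]` for all `θ`. The cocycle identity for `δ` and `f ∂_j` then says that `g` is a potential, up to a
factor `∂_j f`, which can be cancelled because `f` is reduced.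

If `f` is weighted homogeneous of weight `k`, the lift of the Euler field `χ` gives `χ(g) - k g` in
the Tyurina ideal. Inverting `χ - k` on the weights other than `k` replaces `g` by its component of
weight `k` (`IsReducedEquation.Extends.exists_homogeneous`). So all of `H¹` has weight zero, which
gives (1). For a linear free divisor, Saito's determinant is a homogeneous equation of degree `n`. A
homogeneous `g` of the same degree lets the linear basis lift to linear fields, which gives (2).

A deformation carries only an abstract isomorphism of `D` with its central fibre, and its ring is a
quotient of `A ⊗ 𝒪`. To reach the form `f + ε g` one needs substitution of germs, and the fact that
homomorphisms and derivations into `𝒪 / (f)` are determined by the coordinates. The latter rests on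
`(f)` being `𝔪`-adically closed, which follows from division with remainder for convergent series.
Flatness enters as: `ε z = 0` forces `z` to vanish on `D`. -/

/-! ### Convergent power series -/

/-- The weighted `ℓ¹`-norm of a power series. -/
def seriesNorm (W : (Fin n →₀ ℕ) → ℝ≥0∞) (φ : MvPowerSeries (Fin n) ℂ) : ℝ≥0∞ :=
  ∑' d, ‖MvPowerSeries.coeff d φ‖ₑ * W d

/-- The weight of the `ℓ¹`-norm on the polydisc of radius `t`. -/
def polydisc (t : ℝ) (d : Fin n →₀ ℕ) : ℝ≥0∞ := ENNReal.ofReal t ^ d.degree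

/-- With values in `ℝ≥0∞` the norm is defined for every series and sums may be exchanged freely.
Convergence becomes the single condition of being finite. -/
theorem mem_convergentSeries_iff {φ : MvPowerSeries (Fin n) ℂ} :
    φ ∈ convergentSeries n ↔ ∃ t : ℝ, 0 < t ∧ seriesNorm (polydisc t) φ ≠ ⊤ := by
  change (∃ r : ℝ, 0 < r ∧ Summable fun d : Fin n →₀ ℕ =>
    ‖MvPowerSeries.coeff d φ‖ * r ^ d.degree) ↔ _
  refine exists_congr fun t => and_congr_right fun ht => ?_
  have key : ∀ d : Fin n →₀ ℕ, ‖MvPowerSeries.coeff d φ‖ₑ * polydisc t d =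
      ENNReal.ofReal (‖MvPowerSeries.coeff d φ‖ * t ^ d.degree) := fun d => by
    rw [ENNReal.ofReal_mul (norm_nonneg _), ENNReal.ofReal_pow ht.le, ofReal_norm, polydisc]
  simp only [seriesNorm, key]
  constructor
  · exact fun h => h.tsum_ofReal_ne_top
  · intro h
    have := ENNReal.summable_toReal h
    refine this.congr fun d => ?_
    rw [ENNReal.toReal_ofReal (by positivity)]

theorem seriesNorm_mono {W W' : (Fin n →₀ ℕ) → ℝ≥0∞} (h : ∀ d, W d ≤ W' d)
    (φ : MvPowerSeries (Fin n) ℂ) : seriesNorm W φ ≤ seriesNorm W' φ :=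
  ENNReal.tsum_le_tsum fun d => by gcongr; exact h d

theorem polydisc_mono {s t : ℝ} (h : s ≤ t) (d : Fin n →₀ ℕ) : polydisc s d ≤ polydisc t d := by
  unfold polydisc; gcongr

theorem polydisc_add (t : ℝ) (d e : Fin n →₀ ℕ) :
    polydisc t (d + e) = polydisc t d * polydisc t e := by
  simp [polydisc, pow_add]

theorem tsum_antidiagonal (F G : (Fin n →₀ ℕ) → ℝ≥0∞) :
    ∑' d, ∑ p ∈ Finset.HasAntidiagonal.antidiagonal d, F p.1 * G p.2 =
      (∑' d, F d) * ∑' d, G d := by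
  rw [← ENNReal.tsum_mul_right]
  simp_rw [← ENNReal.tsum_mul_left]
  rw [← ENNReal.tsum_prod, ← (Finset.HasAntidiagonal.sigmaAntidiagonalEquivProd
    (A := Fin n →₀ ℕ)).tsum_eq, ENNReal.tsum_sigma']
  refine tsum_congr fun d => ?_
  rw [tsum_fintype, ← Finset.sum_coe_sort]
  rfl

theorem seriesNorm_mul_le {W : (Fin n →₀ ℕ) → ℝ≥0∞} (hW : ∀ d e, W (d + e) = W d * W e)
    (φ ψ : MvPowerSeries (Fin n) ℂ) :
    seriesNorm W (φ * ψ) ≤ seriesNorm W φ * seriesNorm W ψ := by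
  classical
  unfold seriesNorm
  calc ∑' d, ‖MvPowerSeries.coeff d (φ * ψ)‖ₑ * W d
      ≤ ∑' d, ∑ p ∈ Finset.HasAntidiagonal.antidiagonal d, (‖MvPowerSeries.coeff p.1 φ‖ₑ * W p.1) *
          (‖MvPowerSeries.coeff p.2 ψ‖ₑ * W p.2) := by
        refine ENNReal.tsum_le_tsum fun d => ?_
        rw [MvPowerSeries.coeff_mul]
        refine (mul_le_mul_left (enorm_sum_le _ _) _).trans ?_
        rw [Finset.sum_mul]
        refine Finset.sum_le_sum fun p hp => ?_
        rw [← Finset.HasAntidiagonal.mem_antidiagonal.mp hp, hW, enorm_mul]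
        exact le_of_eq (by ring)
    _ = _ := tsum_antidiagonal (fun d => ‖MvPowerSeries.coeff d φ‖ₑ * W d)
        fun d => ‖MvPowerSeries.coeff d ψ‖ₑ * W d

/-- The coefficients of the power series expansion of a germ. -/
def germCoeff (d : Fin n →₀ ℕ) : O n →ₗ[ℂ] ℂ :=
  (MvPowerSeries.coeff d).comp (toSeries n).toLinearMap

theorem germCoeff_apply (d : Fin n →₀ ℕ) (h : O n) :
    germCoeff d h = MvPowerSeries.coeff d (toSeries n h) := rfl

theorem toSeries_injective : Function.Injective (toSeries n) := Subtype.val_injective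

theorem germ_ext {g h : O n} (H : ∀ d, germCoeff d g = germCoeff d h) : g = h :=
  toSeries_injective (MvPowerSeries.ext H)

theorem germCoeff_mul (d : Fin n →₀ ℕ) (g h : O n) :
    germCoeff d (g * h) =
      ∑ p ∈ Finset.HasAntidiagonal.antidiagonal d, germCoeff p.1 g * germCoeff p.2 h := by
  classical
  simp only [germCoeff_apply, map_mul, MvPowerSeries.coeff_mul]

instance : IsDomain (O n) :=
  have : IsDomain (MvPowerSeries (Fin n) ℂ) := NoZeroDivisors.to_isDomain _
  toSeries_injective.isDomain (toSeries n).toRingHom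

instance : Nontrivial (O n) := inferInstance

theorem toSeries_x (i : Fin n) : toSeries n (x i) = MvPowerSeries.X i := by
  change ((MvPolynomial.X i : MvPolynomial (Fin n) ℂ) : MvPowerSeries (Fin n) ℂ) = _
  simp

theorem germCoeff_one (d : Fin n →₀ ℕ) :
    germCoeff d (1 : O n) = if d = 0 then 1 else 0 := by
  rw [germCoeff_apply, map_one, MvPowerSeries.coeff_one]

theorem germCoeff_x (d : Fin n →₀ ℕ) (i : Fin n) :
    germCoeff d (x i) = if d = Finsupp.single i 1 then 1 else 0 := by
  rw [germCoeff_apply, toSeries_x, MvPowerSeries.coeff_X]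

theorem exists_polydisc (h : O n) :
    ∃ t : ℝ, 0 < t ∧ seriesNorm (polydisc t) (toSeries n h) ≠ ⊤ :=
  mem_convergentSeries_iff.mp h.2

/-- The germ with a given convergent expansion. -/
def mkGerm (φ : MvPowerSeries (Fin n) ℂ) (h : φ ∈ convergentSeries n) : O n := ⟨φ, h⟩

/-! ### Partial derivatives -/

/-- Halving the radius pays for the factor `d i + 1 ≤ 2 ^ d.degree` that differentiation introduces.
-/
theorem pderiv_mem_convergentSeries (i : Fin n) {φ : MvPowerSeries (Fin n) ℂ}
    (h : φ ∈ convergentSeries n) : MvPowerSeries.pderiv ℂ i φ ∈ convergentSeries n := by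
  obtain ⟨t, ht, hφ⟩ := mem_convergentSeries_iff.mp h
  refine mem_convergentSeries_iff.mpr ⟨t / 2, by positivity, ?_⟩
  have h0 : ENNReal.ofReal t ≠ 0 := by simpa using ht
  have key : seriesNorm (polydisc (t / 2)) (MvPowerSeries.pderiv ℂ i φ) * ENNReal.ofReal t ≤
      seriesNorm (polydisc t) φ := by
    unfold seriesNorm
    rw [← ENNReal.tsum_mul_right]
    refine (ENNReal.tsum_le_tsum fun d => ?_).trans
      (ENNReal.tsum_comp_le_tsum_of_injective
        (add_left_injective (Finsupp.single i 1)) (fun d : Fin n →₀ ℕ =>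
          ‖MvPowerSeries.coeff d φ‖ₑ * polydisc t d))
    rw [MvPowerSeries.coeff_pderiv, enorm_mul, mul_assoc, mul_assoc]
    gcongr
    rw [polydisc_add, ← mul_assoc]
    have e1 : polydisc t (Finsupp.single i 1) = ENNReal.ofReal t := by simp [polydisc]
    rw [e1]
    gcongr
    have e2 : ‖((d i : ℂ) + 1)‖ₑ = ((d i + 1 : ℕ) : ℝ≥0∞) := by
      rw [← ofReal_norm]
      have : ((d i : ℂ) + 1) = ((d i + 1 : ℕ) : ℂ) := by push_cast; rfl
      rw [this, Complex.norm_natCast, ENNReal.ofReal_natCast]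
    rw [e2, polydisc, polydisc, ENNReal.ofReal_div_of_pos two_pos]
    have h2 : d i + 1 ≤ 2 ^ d.degree := by
      refine Nat.succ_le_of_lt ((Finsupp.le_degree i d).trans_lt Nat.lt_two_pow_self)
    have h3 : ((d i + 1 : ℕ) : ℝ≥0∞) ≤ 2 ^ d.degree := by exact_mod_cast h2
    refine (mul_le_mul_left h3 _).trans (le_of_eq ?_)
    rw [← mul_pow]
    congr 1
    have : ENNReal.ofReal 2 = 2 := by simp
    rw [this]
    exact ENNReal.mul_div_cancel (by simp) (by simp)
  intro htop
  rw [htop, ENNReal.top_mul h0] at key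
  exact hφ (top_le_iff.mp key)

/-- The partial derivative `∂/∂x_i`. -/
def partialD (i : Fin n) : Derivation ℂ (O n) (O n) :=
  Derivation.mk'
    { toFun := fun h => mkGerm (MvPowerSeries.pderiv ℂ i (toSeries n h))
        (pderiv_mem_convergentSeries i h.2)
      map_add' := fun g h => toSeries_injective (by
        change MvPowerSeries.pderiv ℂ i (toSeries n (g + h)) =
          MvPowerSeries.pderiv ℂ i (toSeries n g) + MvPowerSeries.pderiv ℂ i (toSeries n h)
        rw [map_add, map_add])
      map_smul' := fun c h => toSeries_injective (by
        change MvPowerSeries.pderiv ℂ i (toSeries n (c • h)) =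
          c • MvPowerSeries.pderiv ℂ i (toSeries n h)
        rw [map_smul, Derivation.map_smul]) }
    fun g h => toSeries_injective (by
      change MvPowerSeries.pderiv ℂ i (toSeries n (g * h)) =
        toSeries n g * MvPowerSeries.pderiv ℂ i (toSeries n h) +
        toSeries n h * MvPowerSeries.pderiv ℂ i (toSeries n g)
      rw [map_mul, Derivation.leibniz, smul_eq_mul, smul_eq_mul])

theorem germCoeff_partialD (i : Fin n) (h : O n) (d : Fin n →₀ ℕ) :
    germCoeff d (partialD i h) = germCoeff (d + Finsupp.single i 1) h * (d i + 1) :=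
  MvPowerSeries.coeff_pderiv _ _

theorem partialD_x (i j : Fin n) : partialD i (x j) = if i = j then 1 else 0 := by
  apply toSeries_injective
  change MvPowerSeries.pderiv ℂ i (toSeries n (x j)) = _
  rw [toSeries_x]
  split_ifs with h
  · subst h; simp
  · rw [map_zero]; exact MvPowerSeries.pderiv_X_of_ne (Ne.symm h)

/-- A non-zero germ does not lie in a proper ideal that is stable under differentiation and
contains all germs which do not vanish at the origin. -/
theorem eq_top_of_partialD_stable {K : Ideal (O n)} (hunit : ∀ h ∈ K, germCoeff 0 h ≠ 0 → K = ⊤)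
    (hK : ∀ i, ∀ h ∈ K, partialD i h ∈ K) {f : O n} (hf : f ≠ 0) (hfK : f ∈ K) : K = ⊤ := by
  obtain ⟨d, hd⟩ : ∃ d, germCoeff d f ≠ 0 := by
    by_contra! H
    exact hf (germ_ext fun d => by rw [H, map_zero])
  -- A monomial occurring in `f` is differentiated away one variable at a time. In characteristic
  -- zero its coefficient survives, until an element of `K` with non-zero constant term is reached.
  induction hN : d.degree generalizing d f with
  | zero =>
    rw [Finsupp.degree_eq_zero_iff] at hN
    subst hN
    exact hunit f hfK hd
  | succ N ih =>
    have hd0 : d ≠ 0 := by rintro rfl; simp at hN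
    obtain ⟨i, hi⟩ := Finsupp.ne_iff.mp hd0
    have hle : Finsupp.single i 1 ≤ d := by
      rw [Finsupp.single_le_iff]; exact Nat.one_le_iff_ne_zero.mpr hi
    obtain ⟨e, rfl⟩ := exists_add_of_le hle
    have hc : germCoeff e (partialD i f) ≠ 0 := by
      rw [germCoeff_partialD, add_comm e]
      exact mul_ne_zero hd (by norm_cast)
    refine ih (f := partialD i f) ?_ (hK i f hfK) e hc ?_
    · intro h0; rw [h0, map_zero] at hc; exact hc rfl
    · rw [map_add, Finsupp.degree_single] at hN; omega

/-! ### Hadamard's lemma -/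

/-- Each non-constant monomial is assigned to one variable dividing it. The terms of `h` are thereby
distributed among the `q i` without cancellation, so the `q i` converge on the same polydisc as `h`.
-/
theorem exists_eq_sum_x_mul (h : O n) (h0 : germCoeff 0 h = 0) :
    ∃ q : Fin n → O n, h = ∑ i, x i * q i := by
  classical
  have hidx : ∀ d : Fin n →₀ ℕ, d ≠ 0 → ∃ i, d i ≠ 0 := fun d hd => by
    simpa using Finsupp.ne_iff.mp hd
  let idx : (Fin n →₀ ℕ) → Option (Fin n) := fun d =>
    if hd : d ≠ 0 then some (hidx d hd).choose else none
  have idx_spec : ∀ d i, idx d = some i → d i ≠ 0 := by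
    intro d i hi
    by_cases hd : d ≠ 0
    · simp only [idx, dif_pos hd, Option.some.injEq] at hi
      exact hi ▸ (hidx d hd).choose_spec
    · simp [idx, hd] at hi
  obtain ⟨t, ht, hφ⟩ := exists_polydisc h
  let Q : Fin n → MvPowerSeries (Fin n) ℂ := fun i e =>
    if idx (e + Finsupp.single i 1) = some i then germCoeff (e + Finsupp.single i 1) h else 0
  have hQ : ∀ i e, MvPowerSeries.coeff e (Q i) =
    if idx (e + Finsupp.single i 1) = some i then germCoeff (e + Finsupp.single i 1) h else 0 :=
    fun i e => rfl
  have hmem : ∀ i, Q i ∈ convergentSeries n := fun i => by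
    refine mem_convergentSeries_iff.mpr ⟨t, ht, fun htop => ?_⟩
    have key : seriesNorm (polydisc t) (Q i) * ENNReal.ofReal t ≤
        seriesNorm (polydisc t) (toSeries n h) := by
      unfold seriesNorm
      rw [← ENNReal.tsum_mul_right]
      refine (ENNReal.tsum_le_tsum fun d => ?_).trans
        (ENNReal.tsum_comp_le_tsum_of_injective
          (add_left_injective (Finsupp.single i 1)) (fun d : Fin n →₀ ℕ =>
            ‖MvPowerSeries.coeff d (toSeries n h)‖ₑ * polydisc t d))
      rw [mul_assoc, polydisc_add]
      have e1 : polydisc t (Finsupp.single i 1) = ENNReal.ofReal t := by simp [polydisc]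
      rw [e1, hQ]
      gcongr
      split_ifs
      · exact le_rfl
      · simp
    rw [htop, ENNReal.top_mul (by simpa using ht)] at key
    exact hφ (top_le_iff.mp key)
  refine ⟨fun i => mkGerm (Q i) (hmem i), germ_ext fun d => ?_⟩
  have hterm : ∀ i, germCoeff d (x i * mkGerm (Q i) (hmem i)) =
      if idx d = some i then germCoeff d h else 0 := by
    intro i
    rw [germCoeff_apply, map_mul, toSeries_x, MvPowerSeries.X, MvPowerSeries.coeff_monomial_mul]
    split_ifs with h1 h2 h2
    · rw [one_mul]
      change MvPowerSeries.coeff _ (Q i) = _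
      rw [hQ, tsub_add_cancel_of_le h1, if_pos h2]
    · rw [one_mul]
      change MvPowerSeries.coeff _ (Q i) = _
      rw [hQ, tsub_add_cancel_of_le h1, if_neg h2]
    · refine absurd ?_ h1
      rw [Finsupp.single_le_iff]
      exact Nat.one_le_iff_ne_zero.mpr (idx_spec d i h2)
    · rfl
  rw [map_sum, Finset.sum_congr rfl fun i _ => hterm i]
  by_cases hd : d = 0
  · subst hd
    simp [idx, h0]
  · obtain ⟨j, hj⟩ : ∃ j, idx d = some j := ⟨_, dif_pos hd⟩
    simp [hj]

/-! ### Coefficientwise multipliers -/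

theorem mul_coeff_mem_convergentSeries {μ : (Fin n →₀ ℕ) → ℂ} (hμ : ∀ d, ‖μ d‖ ≤ 1) (h : O n) :
    (fun d => μ d * germCoeff d h : MvPowerSeries (Fin n) ℂ) ∈ convergentSeries n := by
  obtain ⟨t, ht, hφ⟩ := exists_polydisc h
  refine mem_convergentSeries_iff.mpr ⟨t, ht, ne_top_of_le_ne_top hφ ?_⟩
  refine ENNReal.tsum_le_tsum fun d => ?_
  gcongr
  change ‖μ d * germCoeff d h‖ₑ ≤ ‖germCoeff d h‖ₑ
  rw [enorm_mul]
  refine mul_le_of_le_one_left' ?_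
  rw [← ofReal_norm, ENNReal.ofReal_le_one]
  exact hμ d

/-- Multiplication of the coefficients of a germ by bounded factors. -/
def coeffMul (μ : (Fin n →₀ ℕ) → ℂ) (hμ : ∀ d, ‖μ d‖ ≤ 1) : O n →ₗ[ℂ] O n where
  toFun h := mkGerm _ (mul_coeff_mem_convergentSeries hμ h)
  map_add' g h := germ_ext fun d => by
    change μ d * germCoeff d (g + h) = μ d * germCoeff d g + μ d * germCoeff d h
    rw [map_add, mul_add]
  map_smul' c h := germ_ext fun d => by
    change μ d * germCoeff d (c • h) = c * (μ d * germCoeff d h)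
    rw [map_smul, smul_eq_mul]; ring

/-! ### A well-ordering of the monomials -/

/-- The positive integer `∏ pᵢ ^ dᵢ`, where `pᵢ` is the `i`-th prime. -/
def primeCode (d : Fin n →₀ ℕ) : ℕ := ∏ i : Fin n, Nat.nth Nat.Prime i ^ d i

theorem primeCode_pos (d : Fin n →₀ ℕ) : 0 < primeCode d :=
  Finset.prod_pos fun i _ => pow_pos (Nat.prime_nth_prime i).pos _

theorem primeCode_add (d e : Fin n →₀ ℕ) : primeCode (d + e) = primeCode d * primeCode e := by
  simp [primeCode, pow_add, Finset.prod_mul_distrib]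

theorem primeCode_zero : primeCode (0 : Fin n →₀ ℕ) = 1 := by simp [primeCode]

theorem factorization_primeCode (d : Fin n →₀ ℕ) (j : Fin n) :
    (primeCode d).factorization (Nat.nth Nat.Prime j) = d j := by
  rw [primeCode, Nat.factorization_prod (g := fun i : Fin n => Nat.nth Nat.Prime i ^ d i)
    fun i _ => (pow_pos (Nat.prime_nth_prime i).pos _).ne', Finsupp.finsetSum_apply,
    Finset.sum_eq_single j]
  · rw [(Nat.prime_nth_prime j).factorization_pow, Finsupp.single_eq_same]
  · intro i _ hij
    rw [(Nat.prime_nth_prime i).factorization_pow, Finsupp.single_eq_of_ne]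
    intro h
    exact hij (Fin.ext (Nat.nth_injective Nat.infinite_setOfPred_prime h.symm))
  · simp

/-- Unique factorisation. With `primeCode_add`, comparing codes is a total monomial order in which
each exponent has finitely many predecessors. The same integers also give the radii `pᵢ⁻ˢ`, so order
and norms fit together. -/
theorem primeCode_injective : Function.Injective (primeCode (n := n)) := fun d e h =>
  Finsupp.ext fun j => by rw [← factorization_primeCode d, ← factorization_primeCode e, h]

theorem two_pow_degree_le_primeCode (d : Fin n →₀ ℕ) : 2 ^ d.degree ≤ primeCode d := by
  rw [Finsupp.degree_eq_sum, ← Finset.prod_pow_eq_pow_sum]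
  exact Finset.prod_le_prod' fun i _ => Nat.pow_le_pow_left (Nat.prime_nth_prime i).two_le _

theorem degree_lt_primeCode (d : Fin n →₀ ℕ) : d.degree < primeCode d :=
  Nat.lt_two_pow_self.trans_le (two_pow_degree_le_primeCode d)

theorem primeCode_le_pow_degree (d : Fin n →₀ ℕ) :
    primeCode d ≤ (∏ i : Fin n, Nat.nth Nat.Prime i) ^ d.degree := by
  rw [Finsupp.degree_eq_sum, ← Finset.prod_pow_eq_pow_sum]
  refine Finset.prod_le_prod' fun i _ => Nat.pow_le_pow_left ?_ _
  exact Nat.le_of_dvd (Finset.prod_pos fun i _ => (Nat.prime_nth_prime i).pos)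
    (Finset.dvd_prod_of_mem _ (Finset.mem_univ i))

/-- The weight of the `ℓ¹`-norm on the polydisc with radii `pᵢ⁻ˢ`. -/
def primeWeight (s : ℕ) (d : Fin n →₀ ℕ) : ℝ≥0∞ := ((primeCode d : ℝ≥0∞)⁻¹) ^ s

theorem primeWeight_add (s : ℕ) (d e : Fin n →₀ ℕ) :
    primeWeight s (d + e) = primeWeight s d * primeWeight s e := by
  rw [primeWeight, primeCode_add, Nat.cast_mul,
    ENNReal.mul_inv (Or.inr (ENNReal.natCast_ne_top _)) (Or.inl (ENNReal.natCast_ne_top _)),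
    mul_pow]
  rfl

theorem primeWeight_ne_zero (s : ℕ) (d : Fin n →₀ ℕ) : primeWeight s d ≠ 0 :=
  pow_ne_zero _ (ENNReal.inv_ne_zero.mpr (ENNReal.natCast_ne_top _))

theorem primeWeight_ne_top (s : ℕ) (d : Fin n →₀ ℕ) : primeWeight s d ≠ ⊤ :=
  ENNReal.pow_ne_top (ENNReal.inv_ne_top.mpr (by exact_mod_cast (primeCode_pos d).ne'))

theorem primeWeight_anti {s s' : ℕ} (h : s ≤ s') (d : Fin n →₀ ℕ) :
    primeWeight s' d ≤ primeWeight s d :=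
  pow_le_pow_right_of_le_one' (ENNReal.inv_le_one.mpr (by exact_mod_cast primeCode_pos d)) h

theorem exists_primeWeight (h : O n) :
    ∃ s : ℕ, ∀ s' ≥ s, seriesNorm (primeWeight s') (toSeries n h) ≠ ⊤ := by
  obtain ⟨t, ht, hh⟩ := exists_polydisc h
  obtain ⟨s, hs⟩ := ((ENNReal.tendsto_pow_atTop_nhds_zero_of_lt_one (r := (2 : ℝ≥0∞)⁻¹)
    (by simp)).eventually_lt_const (show (0 : ℝ≥0∞) < ENNReal.ofReal t by simpa using ht)).exists
  refine ⟨s, fun s' hs' => ne_top_of_le_ne_top hh (seriesNorm_mono (fun d => ?_) _)⟩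
  refine (primeWeight_anti hs' d).trans ?_
  unfold primeWeight polydisc
  calc ((primeCode d : ℝ≥0∞)⁻¹) ^ s ≤ (((2 : ℝ≥0∞) ^ d.degree)⁻¹) ^ s := by
        gcongr
        exact_mod_cast two_pow_degree_le_primeCode d
    _ = (((2 : ℝ≥0∞)⁻¹) ^ s) ^ d.degree := by
        rw [ENNReal.inv_pow, ← pow_mul, ← pow_mul, mul_comm]
    _ ≤ _ := by gcongr

theorem mem_convergentSeries_of_primeWeight {φ : MvPowerSeries (Fin n) ℂ} {s : ℕ}
    (h : seriesNorm (primeWeight s) φ ≠ ⊤) : φ ∈ convergentSeries n := by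
  set P : ℕ := ∏ i : Fin n, Nat.nth Nat.Prime i with hP
  have hP0 : 0 < P := Finset.prod_pos fun i _ => (Nat.prime_nth_prime i).pos
  refine mem_convergentSeries_iff.mpr ⟨((P : ℝ)⁻¹) ^ s, by positivity,
    ne_top_of_le_ne_top h (seriesNorm_mono (fun d => ?_) _)⟩
  unfold primeWeight polydisc
  rw [ENNReal.ofReal_pow (by positivity), ENNReal.ofReal_inv_of_pos (by exact_mod_cast hP0),
    ENNReal.ofReal_natCast, ← pow_mul, mul_comm, pow_mul]
  gcongr
  rw [← ENNReal.inv_pow]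
  gcongr
  exact_mod_cast primeCode_le_pow_degree d

/-! ### Division -/

/-- `a` is the smallest exponent of `f`. -/
def IsLeading (f : O n) (a : Fin n →₀ ℕ) : Prop :=
  germCoeff a f ≠ 0 ∧ ∀ d, germCoeff d f ≠ 0 → primeCode a ≤ primeCode d

theorem exists_isLeading {f : O n} (hf : f ≠ 0) : ∃ a, IsLeading f a := by
  have hne : {d | germCoeff d f ≠ 0}.Nonempty := by
    by_contra! H
    refine hf (germ_ext fun d => ?_)
    have : d ∉ {d | germCoeff d f ≠ 0} := by rw [H]; simp
    simpa using this
  refine ⟨Function.argminOn primeCode _ hne, Function.argminOn_mem primeCode _ hne,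
    fun d hd => Function.argminOn_le primeCode _ hd⟩

theorem IsLeading.lt {f : O n} {a d : Fin n →₀ ℕ} (h : IsLeading f a) (hd : germCoeff d f ≠ 0)
    (hda : d ≠ a) : primeCode a < primeCode d :=
  lt_of_le_of_ne (h.2 d hd) fun e => hda (primeCode_injective e).symm

theorem IsLeading.mul {f g : O n} {a b : Fin n →₀ ℕ} (hf : IsLeading f a) (hg : IsLeading g b) :
    IsLeading (f * g) (a + b) := by
  constructor
  · rw [germCoeff_mul, Finset.sum_eq_single (a, b)]
    · exact mul_ne_zero hf.1 hg.1
    · rintro ⟨d, e⟩ hde hne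
      by_contra H
      obtain ⟨h1, h2⟩ := ne_zero_and_ne_zero_of_mul H
      have hsum : d + e = a + b := Finset.HasAntidiagonal.mem_antidiagonal.mp hde
      have hda : d ≠ a := by
        rintro rfl
        exact hne (by rw [add_left_cancel hsum])
      have := hf.lt h1 hda
      have h3 := hg.2 e h2
      have h4 := congrArg primeCode hsum
      rw [primeCode_add, primeCode_add] at h4
      have := Nat.mul_lt_mul_of_lt_of_le this h3 (primeCode_pos e)
      exact absurd h4 this.ne'
    · intro h
      exact (h (by rw [Finset.HasAntidiagonal.mem_antidiagonal])).elim
  · intro d hd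
    rw [germCoeff_mul] at hd
    obtain ⟨⟨u, v⟩, huv, hne⟩ := Finset.exists_ne_zero_of_sum_ne_zero hd
    obtain ⟨h1, h2⟩ := ne_zero_and_ne_zero_of_mul hne
    rw [← Finset.HasAntidiagonal.mem_antidiagonal.mp huv, primeCode_add, primeCode_add]
    exact Nat.mul_le_mul (hf.2 u h1) (hg.2 v h2)

/-- The coefficients of the quotient in the division by `∑ F d x ^ d` with leading exponent `a`. -/
def divCoeff (F H : (Fin n →₀ ℕ) → ℂ) (a : Fin n →₀ ℕ) (e : Fin n →₀ ℕ) : ℂ :=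
  -- This solves the coefficient of exponent `a + e` in `f * q = h` for the coefficient of `q` at
  -- `e`. The guard makes the recursion well-founded. When `a` is leading, the terms it drops
  -- vanish, except the one of `(a, e)`, which is being solved for.
  (H (a + e) - ∑ p ∈ Finset.HasAntidiagonal.antidiagonal (a + e),
    if _h : primeCode p.2 < primeCode e then F p.1 * divCoeff F H a p.2 else 0) / F a
termination_by primeCode e

/-- Codes are integers, so every other exponent of `f` has code at least `primeCode a + 1`. Raising
`s` by `k` shrinks the tail by `(N / (N + 1)) ^ k` relative to the leading term, where `N =
primeCode a`. -/
theorem exists_tail_le {f : O n} {a : Fin n →₀ ℕ} (ha : IsLeading f a) (s₁ : ℕ) :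
    ∃ s ≥ s₁, (∑' d, if d = a then 0 else ‖germCoeff d f‖ₑ * primeWeight s d) ≤
      ‖germCoeff a f‖ₑ * primeWeight s a / 2 := by
  obtain ⟨s₀, hs₀⟩ := exists_primeWeight f
  set S := max s₀ s₁
  have hS := hs₀ S (le_max_left _ _)
  set Na : ℝ≥0∞ := (primeCode a : ℝ≥0∞) with hNa
  have hNa0 : Na ≠ 0 := by simp [hNa, (primeCode_pos a).ne']
  have hNat : Na ≠ ⊤ := ENNReal.natCast_ne_top _
  have hlt : Na / (Na + 1) < 1 := by
    rw [ENNReal.div_lt_iff (Or.inl (by simp)) (Or.inl (by simp [hNat])), one_mul]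
    exact ENNReal.lt_add_right hNat one_ne_zero
  have hlim := ENNReal.Tendsto.const_mul (a := seriesNorm (primeWeight S) (toSeries n f))
    (ENNReal.tendsto_pow_atTop_nhds_zero_of_lt_one hlt) (Or.inr hS)
  rw [mul_zero] at hlim
  have hpos : 0 < ‖germCoeff a f‖ₑ * primeWeight S a / 2 := by
    refine ENNReal.div_pos (mul_ne_zero (by simpa using ha.1) (primeWeight_ne_zero _ _)) (by simp)
  obtain ⟨k, hk⟩ := (hlim.eventually_le_const hpos).exists
  refine ⟨S + k, by omega, ?_⟩
  have hsplit : ∀ d : Fin n →₀ ℕ, primeWeight (S + k) d =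
      primeWeight S d * ((primeCode d : ℝ≥0∞)⁻¹) ^ k := fun d => by
    rw [primeWeight, pow_add, primeWeight]
  calc (∑' d, if d = a then 0 else ‖germCoeff d f‖ₑ * primeWeight (S + k) d)
      ≤ ∑' d, ‖germCoeff d f‖ₑ * primeWeight S d * ((Na + 1)⁻¹) ^ k := by
        refine ENNReal.tsum_le_tsum fun d => ?_
        split_ifs with hd
        · simp
        · by_cases h0 : germCoeff d f = 0
          · simp [h0]
          · rw [hsplit, mul_assoc]
            gcongr
            have h1 : primeCode a + 1 ≤ primeCode d := ha.lt h0 hd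
            rw [hNa]
            exact_mod_cast h1
    _ = seriesNorm (primeWeight S) (toSeries n f) * ((Na + 1)⁻¹) ^ k := by
        rw [ENNReal.tsum_mul_right]; rfl
    _ = seriesNorm (primeWeight S) (toSeries n f) * (Na / (Na + 1)) ^ k * (Na⁻¹) ^ k := by
        rw [mul_assoc, ← mul_pow, div_eq_mul_inv, mul_comm Na, mul_assoc,
          ENNReal.mul_inv_cancel hNa0 hNat, mul_one]
    _ ≤ ‖germCoeff a f‖ₑ * primeWeight S a / 2 * (Na⁻¹) ^ k := by gcongr
    _ = _ := by
        rw [hsplit, div_eq_mul_inv, div_eq_mul_inv]; ring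

/-- The recursive estimate is summed over the finite set of exponents of code at most `M`, on which
it closes up. With `T` the sum of `u` there, it reads `K T ≤ H + (K / 2) T`. As `T` is finite the
last term can be absorbed, and the bound does not depend on `M`. -/
theorem tsum_le_of_bootstrap {u v : (Fin n →₀ ℕ) → ℝ≥0∞} {K H : ℝ≥0∞} (hK : K ≠ 0) (hKt : K ≠ ⊤)
    (a : Fin n →₀ ℕ) (hu : ∀ e, u e ≠ ⊤) (w : (Fin n →₀ ℕ) → ℝ≥0∞) (hw : ∑' d, w d ≤ H)
    (hv : ∑' d, v d ≤ K / 2)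
    (h : ∀ e, K * u e ≤ w (a + e) + ∑ p ∈ Finset.HasAntidiagonal.antidiagonal (a + e),
      if primeCode p.2 < primeCode e then v p.1 * u p.2 else 0) :
    ∑' e, u e ≤ H / (K / 2) := by
  have hK2 : K / 2 ≠ 0 := (ENNReal.div_pos hK (by simp)).ne'
  have hK2t : K / 2 ≠ ⊤ := ENNReal.div_ne_top hKt (by simp)
  have fin_le : ∀ M : ℕ, {e : Fin n →₀ ℕ | primeCode e ≤ M}.Finite := fun M =>
    (Set.finite_Iic M).preimage primeCode_injective.injOn
  have bound : ∀ M : ℕ, ∑ e ∈ (fin_le M).toFinset, u e ≤ H / (K / 2) := by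
    intro M
    set F := (fin_le M).toFinset with hF
    have memF : ∀ e, e ∈ F ↔ primeCode e ≤ M := fun e => by simp [hF]
    have hSt : ∑ e ∈ F, u e ≠ ⊤ := ENNReal.sum_ne_top.mpr fun e _ => hu e
    have hsumv : (∑' e, if e ∈ F then u e else 0) = ∑ e ∈ F, u e := by
      rw [tsum_eq_sum (s := F) (fun e he => if_neg he)]
      exact Finset.sum_congr rfl fun e he => if_pos he
    have h1 : K * ∑ e ∈ F, u e ≤ H + K / 2 * ∑ e ∈ F, u e := by
      calc K * ∑ e ∈ F, u e = ∑ e ∈ F, K * u e := Finset.mul_sum _ _ _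
        _ ≤ ∑ e ∈ F, (w (a + e) + ∑ p ∈ Finset.HasAntidiagonal.antidiagonal (a + e),
              v p.1 * if p.2 ∈ F then u p.2 else 0) := by
            refine Finset.sum_le_sum fun e he => (h e).trans ?_
            gcongr with p hp
            split_ifs with h1 h2 h2
            · exact le_rfl
            · exact absurd ((memF _).mpr (h1.le.trans ((memF e).mp he))) h2
            · exact zero_le
            · exact zero_le
        _ = ∑ e ∈ F, w (a + e) + ∑ e ∈ F, ∑ p ∈ Finset.HasAntidiagonal.antidiagonal (a + e),
              v p.1 * (if p.2 ∈ F then u p.2 else 0) := Finset.sum_add_distrib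
        _ ≤ ∑' d, w d + ∑' d, ∑ p ∈ Finset.HasAntidiagonal.antidiagonal d,
              v p.1 * (if p.2 ∈ F then u p.2 else 0) := by
            gcongr
            · exact (ENNReal.sum_le_tsum F).trans
                (ENNReal.tsum_comp_le_tsum_of_injective (add_right_injective a) w)
            · exact (ENNReal.sum_le_tsum F).trans
                (ENNReal.tsum_comp_le_tsum_of_injective (add_right_injective a)
                  (fun d => ∑ p ∈ Finset.HasAntidiagonal.antidiagonal d,
                    v p.1 * (if p.2 ∈ F then u p.2 else 0)))
        _ ≤ H + K / 2 * ∑ e ∈ F, u e := by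
            rw [tsum_antidiagonal v fun e => if e ∈ F then u e else 0, hsumv]
            gcongr
    have h2 : K * ∑ e ∈ F, u e = K / 2 * ∑ e ∈ F, u e + K / 2 * ∑ e ∈ F, u e := by
      rw [← add_mul, ENNReal.add_halves]
    rw [h2] at h1
    have h3 := (ENNReal.add_le_add_iff_right (ENNReal.mul_ne_top hK2t hSt)).mp h1
    rw [ENNReal.le_div_iff_mul_le (Or.inl hK2) (Or.inl hK2t), mul_comm]
    exact h3
  rw [ENNReal.tsum_eq_iSup_sum]
  refine iSup_le fun F => ?_
  refine (Finset.sum_le_sum_of_subset ?_).trans (bound (F.sup primeCode))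
  intro e he
  simpa using Finset.le_sup (f := primeCode) he

/-- Division with remainder by a convergent power series. -/
theorem exists_division {f : O n} {a : Fin n →₀ ℕ} (ha : IsLeading f a) (h : O n) :
    ∃ q : O n, ∀ e, germCoeff (a + e) (h - f * q) = 0 := by
  set F : (Fin n →₀ ℕ) → ℂ := fun d => germCoeff d f with hF
  set H : (Fin n →₀ ℕ) → ℂ := fun d => germCoeff d h with hH
  set q : MvPowerSeries (Fin n) ℂ := fun e => divCoeff F H a e with hq
  have hrec : ∀ e, F a * divCoeff F H a e = H (a + e) -
      ∑ p ∈ Finset.HasAntidiagonal.antidiagonal (a + e),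
        if primeCode p.2 < primeCode e then F p.1 * divCoeff F H a p.2 else 0 := by
    intro e
    rw [divCoeff, mul_div_cancel₀ _ ha.1]
    simp
  have hmem : q ∈ convergentSeries n := by
    obtain ⟨s₁, hs₁⟩ := exists_primeWeight h
    obtain ⟨s, hs, htail⟩ := exists_tail_le ha s₁
    refine mem_convergentSeries_of_primeWeight (s := s) ?_
    have hK : ‖F a‖ₑ * primeWeight s a ≠ 0 :=
      mul_ne_zero (by simpa using ha.1) (primeWeight_ne_zero _ _)
    have hKt : ‖F a‖ₑ * primeWeight s a ≠ ⊤ :=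
      ENNReal.mul_ne_top enorm_ne_top (primeWeight_ne_top _ _)
    refine ne_top_of_le_ne_top ?_ (tsum_le_of_bootstrap
      (u := fun e => ‖divCoeff F H a e‖ₑ * primeWeight s e)
      (v := fun d => if d = a then 0 else ‖F d‖ₑ * primeWeight s d)
      hK hKt a (fun e => ENNReal.mul_ne_top enorm_ne_top (primeWeight_ne_top _ _))
      (fun d => ‖H d‖ₑ * primeWeight s d) (H := seriesNorm (primeWeight s) (toSeries n h)) le_rfl
      htail ?_)
    · exact ENNReal.div_ne_top (hs₁ s hs) (ENNReal.div_pos hK (by simp)).ne'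
    · intro e
      have e1 : ‖F a‖ₑ * primeWeight s a * (‖divCoeff F H a e‖ₑ * primeWeight s e) =
          ‖F a * divCoeff F H a e‖ₑ * primeWeight s (a + e) := by
        rw [enorm_mul, primeWeight_add]; ring
      rw [e1, hrec]
      refine (mul_le_mul_left enorm_sub_le _).trans ?_
      rw [add_mul]
      gcongr
      refine (mul_le_mul_left (enorm_sum_le _ _) _).trans ?_
      rw [Finset.sum_mul]
      refine Finset.sum_le_sum fun p hp => ?_
      have hp' := Finset.HasAntidiagonal.mem_antidiagonal.mp hp
      -- A pair with `p.1 = a` has `p.2 = e`, which the guard excludes. This is why the leading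
      -- coefficient may be left out of `v`.
      split_ifs with h1 h2
      · exfalso
        rw [h2] at hp'
        rw [add_left_cancel hp'] at h1
        exact lt_irrefl _ h1
      · rw [← hp', primeWeight_add, enorm_mul]
        exact le_of_eq (by ring)
      · simp
  refine ⟨mkGerm q hmem, fun e => ?_⟩
  rw [map_sub, germCoeff_mul, sub_eq_zero]
  have hstep : ∑ p ∈ Finset.HasAntidiagonal.antidiagonal (a + e),
      germCoeff p.1 f * germCoeff p.2 (mkGerm q hmem) =
      ∑ p ∈ Finset.HasAntidiagonal.antidiagonal (a + e),
        ((if p = (a, e) then F a * divCoeff F H a e else 0) +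
        if primeCode p.2 < primeCode e then F p.1 * divCoeff F H a p.2 else 0) := by
    refine Finset.sum_congr rfl fun p hp => ?_
    have hp' := Finset.HasAntidiagonal.mem_antidiagonal.mp hp
    change F p.1 * divCoeff F H a p.2 = _
    by_cases h1 : p = (a, e)
    · subst h1; simp
    · rw [if_neg h1, zero_add]
      split_ifs with h2
      · rfl
      -- If `F p.1 ≠ 0` and `p.1 ≠ a`, then `p.1` has a larger code than `a`. As the codes of `p.1`
      -- and `p.2` multiply to that of `a + e`, the code of `p.2` is below that of `e` and the guard
      -- holds.
      · by_contra hne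
        have h3 := (ne_zero_and_ne_zero_of_mul hne).1
        have h4 : p.1 ≠ a := by
          intro h5
          rw [h5] at hp'
          exact h1 (Prod.ext h5 (add_left_cancel hp'))
        have h5 := ha.lt h3 h4
        have h6 := congrArg primeCode hp'
        rw [primeCode_add, primeCode_add] at h6
        have := Nat.mul_lt_mul_of_lt_of_le h5 (not_lt.mp h2) (primeCode_pos p.2)
        omega
  rw [hstep, Finset.sum_add_distrib, Finset.sum_ite_eq', if_pos, hrec]
  · simp [hH]
  · exact Finset.HasAntidiagonal.mem_antidiagonal.mpr rfl

/-- The leading exponent is `0`, so dividing `1` by `f` leaves no room for a remainder. -/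
theorem isUnit_of_germCoeff_zero_ne {f : O n} (h : germCoeff 0 f ≠ 0) : IsUnit f := by
  have ha : IsLeading f 0 := ⟨h, fun d _ => by rw [primeCode_zero]; exact primeCode_pos d⟩
  obtain ⟨q, hq⟩ := exists_division ha 1
  refine IsUnit.of_mul_eq_one q (sub_eq_zero.mp (germ_ext fun d => ?_)).symm
  rw [map_zero, ← hq d, zero_add]

/-- The maximal ideal of `𝒪`. -/
def maxId (n : ℕ) : Ideal (O n) := Ideal.span (Set.range x)

theorem mem_maxId {h : O n} (h0 : germCoeff 0 h = 0) : h ∈ maxId n := by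
  obtain ⟨q, rfl⟩ := exists_eq_sum_x_mul h h0
  exact Ideal.sum_mem _ fun i _ => Ideal.mul_mem_right _ _ (Ideal.subset_span ⟨i, rfl⟩)

theorem germCoeff_eq_zero_of_mem_pow {M : ℕ} {h : O n} (hh : h ∈ maxId n ^ M)
    {d : Fin n →₀ ℕ} (hd : d.degree < M) : germCoeff d h = 0 := by
  induction M generalizing h d with
  | zero => omega
  | succ M ih =>
    rw [pow_succ'] at hh
    induction hh using Submodule.mul_induction_on' with
    | add g _ h _ hg hh => rw [map_add, hg, hh, add_zero]
    | mem_mul_mem g hg h hh =>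
      obtain ⟨c, rfl⟩ := (Submodule.mem_span_range_iff_exists_fun _).mp hg
      rw [Finset.sum_mul, map_sum]
      refine Finset.sum_eq_zero fun i _ => ?_
      rw [smul_eq_mul, mul_assoc, mul_left_comm, germCoeff_apply, map_mul, toSeries_x,
        MvPowerSeries.X, MvPowerSeries.coeff_monomial_mul]
      split_ifs with h1
      · rw [one_mul]
        refine ih (Ideal.mul_mem_left _ _ hh) ?_
        have h2 := congrArg Finsupp.degree (tsub_add_cancel_of_le h1)
        rw [map_add, Finsupp.degree_single] at h2
        omega
      · rfl

theorem maxId_ne_top : maxId n ≠ ⊤ := by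
  intro h
  have h1 : (1 : O n) ∈ maxId n ^ 1 := by rw [pow_one, h]; trivial
  have := germCoeff_eq_zero_of_mem_pow h1 (d := 0) (by simp)
  rw [germCoeff_one, if_pos rfl] at this
  exact one_ne_zero this

theorem germCoeff_zero_eq_zero_of_mem {h : O n} (hh : h ∈ maxId n) : germCoeff 0 h = 0 :=
  germCoeff_eq_zero_of_mem_pow (M := 1) (by rwa [pow_one]) (by simp)

theorem eq_zero_of_forall_mem_pow {h : O n} (hh : ∀ M, h ∈ maxId n ^ M) : h = 0 :=
  germ_ext fun d => by
    rw [map_zero]; exact germCoeff_eq_zero_of_mem_pow (hh (d.degree + 1)) (Nat.lt_succ_self _)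

/-- Principal ideals of `𝒪` are closed. -/
theorem mem_span_of_forall_mem_sup_pow {f h : O n}
    (hh : ∀ M, h ∈ Ideal.span {f} ⊔ maxId n ^ M) : h ∈ Ideal.span {f} := by
  by_cases hf : f = 0
  · have : h = 0 := eq_zero_of_forall_mem_pow fun M => by simpa [hf] using hh M
    rw [this]; exact zero_mem _
  obtain ⟨a, ha⟩ := exists_isLeading hf
  obtain ⟨q, hq⟩ := exists_division ha h
  rw [Ideal.mem_span_singleton]
  suffices h - f * q = 0 from ⟨q, sub_eq_zero.mp this⟩
  by_contra hr
  obtain ⟨b, hb⟩ := exists_isLeading hr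
  -- The degree of an exponent is smaller than its code. Hence an element of this power of the
  -- maximal ideal has no coefficient of code up to `primeCode b`.
  obtain ⟨g, hg, t, ht, hgt⟩ := Submodule.mem_sup.mp (hh (primeCode b))
  obtain ⟨u, rfl⟩ := Ideal.mem_span_singleton.mp hg
  have hrt : h - f * q = f * (u - q) + t := by rw [← hgt]; ring
  have ht0 : ∀ d : Fin n →₀ ℕ, primeCode d ≤ primeCode b → germCoeff d t = 0 := fun d hd =>
    germCoeff_eq_zero_of_mem_pow ht ((degree_lt_primeCode d).trans_le hd)
  have hcoef : ∀ d : Fin n →₀ ℕ, primeCode d ≤ primeCode b →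
      germCoeff d (h - f * q) = germCoeff d (f * (u - q)) := fun d hd => by
    rw [hrt, map_add, ht0 d hd, add_zero]
  -- Up to the code of `b` the remainder agrees with `f * (u - q)`. If that product is non-zero, its
  -- leading exponent lies in `a + ℕⁿ`, where the remainder has no coefficients.
  by_cases hs : u - q = 0
  · have := hcoef b le_rfl
    rw [hs, mul_zero, map_zero] at this
    exact hb.1 this
  · obtain ⟨c, hc⟩ := exists_isLeading hs
    have hfc := ha.mul hc
    have h1 : primeCode (a + c) ≤ primeCode b := hfc.2 b (by rw [← hcoef b le_rfl]; exact hb.1)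
    exact hfc.1 (by rw [← hcoef _ h1, hq])

/-! ### Substitution -/

theorem seriesNorm_polydisc_one_le (t : ℝ) :
    seriesNorm (polydisc t) (1 : MvPowerSeries (Fin n) ℂ) ≤ 1 := by
  unfold seriesNorm
  rw [tsum_eq_single 0]
  · simp [polydisc]
  · intro d hd
    simp [MvPowerSeries.coeff_one, hd]

theorem seriesNorm_polydisc_prod_pow_le (t : ℝ) (a : Fin n → MvPowerSeries (Fin n) ℂ)
    (d : Fin n →₀ ℕ) {C : ℝ≥0∞} (hC : ∀ i, seriesNorm (polydisc t) (a i) ≤ C) :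
    seriesNorm (polydisc t) (d.prod fun i k => a i ^ k) ≤ C ^ d.degree := by
  have hpow : ∀ i k, seriesNorm (polydisc t) (a i ^ k) ≤ C ^ k := by
    intro i k
    induction k with
    | zero => simpa using seriesNorm_polydisc_one_le t
    | succ k ih =>
      rw [pow_succ, pow_succ]
      exact (seriesNorm_mul_le (polydisc_add t) _ _).trans (mul_le_mul' ih (hC i))
  rw [Finsupp.prod_fintype _ _ (by simp), Finsupp.degree_eq_sum, ← Finset.prod_pow_eq_pow_sum]
  refine Finset.induction_on (Finset.univ : Finset (Fin n)) ?_ fun i s hi ih => ?_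
  · simpa using seriesNorm_polydisc_one_le t
  · rw [Finset.prod_insert hi, Finset.prod_insert hi]
    exact (seriesNorm_mul_le (polydisc_add t) _ _).trans (mul_le_mul' (hpow _ _) ih)

/-- Without a constant term, shrinking the radius by a factor `k ≤ 1` shrinks the norm at least by
`k`. -/
theorem exists_seriesNorm_polydisc_le {h : O n} (h0 : germCoeff 0 h = 0) {r : ℝ} (hr : 0 < r) :
    ∃ s : ℝ, 0 < s ∧ seriesNorm (polydisc s) (toSeries n h) ≤ ENNReal.ofReal r := by
  obtain ⟨t, ht, hh⟩ := exists_polydisc h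
  set S := seriesNorm (polydisc t) (toSeries n h)
  have hr' : ENNReal.ofReal r ≠ 0 := by simpa using hr
  obtain ⟨k, hk0, hk⟩ : ∃ k : ℝ, 0 < k ∧ k ≤ 1 ∧ ENNReal.ofReal k * S ≤ ENNReal.ofReal r := by
    refine ⟨min 1 (r / (S.toReal + 1)), by positivity, min_le_left _ _, ?_⟩
    have hS := ENNReal.toReal_nonneg (a := S)
    rw [show S = ENNReal.ofReal S.toReal from (ENNReal.ofReal_toReal hh).symm,
      ← ENNReal.ofReal_mul (by positivity), ENNReal.toReal_ofReal hS]
    refine ENNReal.ofReal_le_ofReal ?_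
    calc min 1 (r / (S.toReal + 1)) * S.toReal ≤ r / (S.toReal + 1) * S.toReal := by
          gcongr; exact min_le_right _ _
      _ ≤ r := by
          rw [div_mul_eq_mul_div, div_le_iff₀ (by positivity)]
          nlinarith
  refine ⟨k * t, by positivity, le_trans ?_ hk.2⟩
  change _ ≤ ENNReal.ofReal k * ∑' d, _
  rw [seriesNorm, ← ENNReal.tsum_mul_left]
  refine ENNReal.tsum_le_tsum fun d => ?_
  by_cases hd : d = 0
  · subst hd
    have : MvPowerSeries.coeff 0 (toSeries n h) = 0 := h0
    rw [this]; simp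
  · rw [mul_left_comm]
    gcongr
    rw [polydisc, ENNReal.ofReal_mul hk0.le, mul_pow, polydisc]
    gcongr
    refine pow_le_of_le_one zero_le (by simpa using hk.1) ?_
    rwa [Ne, Finsupp.degree_eq_zero_iff]

/-- The triangle inequality and an exchange of sums reduce this to monomials, where
submultiplicativity of the norm applies. -/
theorem seriesNorm_subst_le {a : Fin n → MvPowerSeries (Fin n) ℂ} (ha : MvPowerSeries.HasSubst a)
    {s r : ℝ} (hs : ∀ i, seriesNorm (polydisc s) (a i) ≤ ENNReal.ofReal r)
    (φ : MvPowerSeries (Fin n) ℂ) :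
    seriesNorm (polydisc s) (MvPowerSeries.subst a φ) ≤ seriesNorm (polydisc r) φ := by
  calc seriesNorm (polydisc s) (MvPowerSeries.subst a φ)
      ≤ ∑' e, ∑' d, ‖MvPowerSeries.coeff d φ‖ₑ *
          (‖MvPowerSeries.coeff e (d.prod fun i k => a i ^ k)‖ₑ * polydisc s e) := by
        refine ENNReal.tsum_le_tsum fun e => ?_
        rw [MvPowerSeries.coeff_subst ha,
          finsum_eq_sum _ (MvPowerSeries.coeff_subst_finite ha φ e)]
        refine (mul_le_mul_left (enorm_sum_le _ _) _).trans ?_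
        rw [Finset.sum_mul]
        refine (Finset.sum_le_sum fun d _ => ?_).trans (ENNReal.sum_le_tsum _)
        rw [smul_eq_mul, enorm_mul, mul_assoc]
    _ = ∑' d, ‖MvPowerSeries.coeff d φ‖ₑ *
          seriesNorm (polydisc s) (d.prod fun i k => a i ^ k) := by
        rw [ENNReal.tsum_comm]
        exact tsum_congr fun d => ENNReal.tsum_mul_left
    _ ≤ _ := by
        refine ENNReal.tsum_le_tsum fun d => ?_
        gcongr
        exact seriesNorm_polydisc_prod_pow_le s a d hs

/-- Substitution of germs vanishing at the origin. -/
theorem exists_substitution (ρ : Fin n → O n) (hρ : ∀ i, germCoeff 0 (ρ i) = 0) :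
    ∃ σ : O n →ₐ[ℂ] O n, ∀ i, σ (x i) = ρ i := by
  have ha : MvPowerSeries.HasSubst fun i => toSeries n (ρ i) :=
    MvPowerSeries.hasSubst_of_constantCoeff_zero fun i => hρ i
  have hmem : ∀ h : O n, (MvPowerSeries.substAlgHom (R := ℂ) ha) (toSeries n h) ∈
      convergentSeries n := by
    intro h
    obtain ⟨r, hr, hh⟩ := exists_polydisc h
    choose s hs0 hs using fun i => exists_seriesNorm_polydisc_le (hρ i) hr
    obtain ⟨t, ht0, ht⟩ : ∃ t : ℝ, 0 < t ∧ ∀ i, t ≤ s i := by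
      rcases isEmpty_or_nonempty (Fin n) with h | h
      · exact ⟨1, one_pos, fun i => h.elim i⟩
      · obtain ⟨i, hi⟩ := Finite.exists_min s
        exact ⟨s i, hs0 i, hi⟩
    refine mem_convergentSeries_iff.mpr ⟨t, ht0, ne_top_of_le_ne_top hh ?_⟩
    rw [MvPowerSeries.substAlgHom_apply]
    exact seriesNorm_subst_le ha (fun i => (seriesNorm_mono (polydisc_mono (ht i)) _).trans (hs i)) _
  let σ : O n →ₐ[ℂ] O n := ((MvPowerSeries.substAlgHom (R := ℂ) ha).comp (toSeries n)).codRestrict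
    (convergentSeries n) hmem
  refine ⟨σ, fun i => toSeries_injective ?_⟩
  change (MvPowerSeries.substAlgHom (R := ℂ) ha) (toSeries n (x i)) = _
  rw [toSeries_x, MvPowerSeries.substAlgHom_X]

/-! ### Uniqueness of homomorphisms and derivations -/

/-- A map that satisfies a twisted Leibniz rule is determined by its values on the coordinates. -/
theorem eq_zero_of_twisted_leibniz {Q : Type*} [CommRing Q] [Algebra ℂ Q] (𝔪 : Ideal Q)
    (h𝔪 : ∀ q, (∀ M, q ∈ 𝔪 ^ M) → q = 0) (φ ψ : O n → Q) (hφ : ∀ i, φ (x i) ∈ 𝔪)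
    (E : O n →ₗ[ℂ] Q) (hE : ∀ a b, E (a * b) = φ a * E b + E a * ψ b) (h1 : E 1 = 0)
    (hx : ∀ i, E (x i) = 0) : E = 0 := by
  suffices ∀ M h, E h ∈ 𝔪 ^ M from LinearMap.ext fun h => h𝔪 _ fun M => this M h
  intro M
  induction M with
  | zero => simp
  | succ M ih =>
    intro h
    -- Writing `h = c + ∑ x i * q i` gives `E h = ∑ φ (x i) * E (q i)`, so each round gains one
    -- power of `𝔪`. The twisted rule covers both derivations and differences of two homomorphisms.
    obtain ⟨q, hq⟩ := exists_eq_sum_x_mul (h - germCoeff 0 h • 1) (by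
      rw [map_sub, map_smul, germCoeff_one, if_pos rfl, smul_eq_mul, mul_one, sub_self])
    rw [sub_eq_iff_eq_add.mp hq, map_add, map_smul, h1, smul_zero, add_zero, map_sum, pow_succ']
    refine Ideal.sum_mem _ fun i _ => ?_
    rw [hE, hx, zero_mul, add_zero]
    exact Ideal.mul_mem_mul (hφ i) (ih _)

/-- Derivations of `𝒪` are determined by their values on the coordinates. -/
theorem derivation_ext_x {δ η : Derivation ℂ (O n) (O n)} (h : ∀ i, δ (x i) = η (x i)) :
    δ = η := by
  rw [← sub_eq_zero]
  have := eq_zero_of_twisted_leibniz (maxId n) (fun q hq => eq_zero_of_forall_mem_pow hq) id id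
    (fun i => Ideal.subset_span ⟨i, rfl⟩) (δ - η : Derivation ℂ (O n) (O n)).toLinearMap
    (fun a b => by
      change (δ - η) (a * b) = a * (δ - η) b + (δ - η) a * b
      rw [Derivation.leibniz, smul_eq_mul, smul_eq_mul, mul_comm b])
    (Derivation.map_one_eq_zero _) (fun i => by
      change (δ - η) (x i) = 0
      rw [Derivation.sub_apply, h, sub_self])
  exact Derivation.ext fun a => LinearMap.congr_fun this a

theorem derivation_sum_apply {R B ι : Type*} [CommRing R] [CommRing B] [Algebra R B]
    (s : Finset ι) (δ : ι → Derivation R B B) (h : B) : (∑ i ∈ s, δ i) h = ∑ i ∈ s, δ i h :=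
  map_sum ({ toFun := fun δ => δ h, map_zero' := rfl, map_add' := fun _ _ => rfl } :
    Derivation R B B →+ B) δ s

theorem derivation_eq_sum (δ : Derivation ℂ (O n) (O n)) : δ = ∑ i, δ (x i) • partialD i := by
  refine derivation_ext_x fun j => ?_
  rw [derivation_sum_apply]
  simp [partialD_x]

theorem derivation_apply_eq_sum (δ : Derivation ℂ (O n) (O n)) (h : O n) :
    δ h = ∑ i, δ (x i) * partialD i h := by
  conv_lhs => rw [derivation_eq_sum δ]
  rw [derivation_sum_apply]
  rfl

/-- The derivation with prescribed values on the coordinates. -/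
def vectorField (c : Fin n → O n) : Derivation ℂ (O n) (O n) := ∑ i, c i • partialD i

theorem vectorField_apply (c : Fin n → O n) (h : O n) :
    vectorField c h = ∑ i, c i * partialD i h := by
  rw [vectorField, derivation_sum_apply]
  rfl

theorem vectorField_x (c : Fin n → O n) (j : Fin n) : vectorField c (x j) = c j := by
  rw [vectorField_apply]
  simp [partialD_x]

/-! ### Reduced hypersurfaces -/

/-- `f` is a reduced equation of the hypersurface with ideal `J`. -/
structure IsReducedEquation (f : O n) (J : Ideal (O n)) : Prop where
  ne_zero : f ≠ 0
  eq_span : J = Ideal.span {f}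
  ne_top : J ≠ ⊤
  isRadical : J.IsRadical

variable {f : O n} {J : Ideal (O n)}

theorem IsReducedEquation.mem (hJ : IsReducedEquation f J) : f ∈ J :=
  hJ.eq_span ▸ Ideal.mem_span_singleton_self f

theorem IsReducedEquation.mem_iff (hJ : IsReducedEquation f J) {h : O n} :
    h ∈ J ↔ ∃ c, h = f * c := by
  rw [hJ.eq_span, Ideal.mem_span_singleton]; rfl

/-- The partial derivatives of a reduced equation have no common zero divisor modulo it. -/
theorem IsReducedEquation.mem_of_mul_partialD_mem (hJ : IsReducedEquation f J) {u : O n}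
    (hu : ∀ j, u * partialD j f ∈ J) : u ∈ J := by
  have hsq : ∀ v, v * v ∈ J → v ∈ J := fun v hv => hJ.isRadical ⟨2, by rwa [pow_two]⟩
  -- `K` is the ideal quotient `(J : u)`. It contains `f ≠ 0`, so stability under differentiation
  -- forces it to be everything.
  let K : Ideal (O n) := Submodule.comap (LinearMap.mulLeft (O n) u) J
  have hK : ∀ v, v ∈ K ↔ u * v ∈ J := fun v => Iff.rfl
  have htop : K = ⊤ := by
    refine eq_top_of_partialD_stable (fun h hh h0 =>
      Ideal.eq_top_of_isUnit_mem _ hh (isUnit_of_germCoeff_zero_ne h0)) ?_ hJ.ne_zero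
      ((hK f).mpr (J.mul_mem_left u hJ.mem))
    intro i v hv
    rw [hK] at hv ⊢
    obtain ⟨a, ha⟩ := hJ.mem_iff.mp hv
    have h1 := congrArg (partialD i) ha
    rw [Derivation.leibniz, Derivation.leibniz] at h1
    simp only [smul_eq_mul] at h1
    refine hsq _ ?_
    -- Differentiating `u v = f a` and multiplying by `u ∂ᵢv` puts the square of `u ∂ᵢv` into `J`,
    -- and `J` is radical.
    have h2 : u * partialD i v * (u * partialD i v) =
        (f * (u * partialD i a) + a * (u * partialD i f) - u * v * partialD i u) *
          partialD i v := by
      linear_combination (u * partialD i v) * h1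
    rw [h2]
    exact J.mul_mem_right _ (J.sub_mem (J.add_mem (J.mul_mem_right _ hJ.mem)
      (J.mul_mem_left _ (hu i))) (J.mul_mem_right _ hv))
  have h1 : (1 : O n) ∈ K := by rw [htop]; trivial
  simpa using (hK 1).mp h1

theorem IsReducedEquation.mem_of_mul_partialD_pow_mem (hJ : IsReducedEquation f J) {u : O n}
    (m : ℕ) (hu : ∀ j, u * partialD j f ^ m ∈ J) : u ∈ J := by
  refine hJ.mem_of_mul_partialD_mem fun j => hJ.isRadical ⟨m + 1, ?_⟩
  have : (u * partialD j f) ^ (m + 1) = u * partialD j f ^ m * (u ^ m * partialD j f) := by ring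
  rw [this]
  exact J.mul_mem_right _ (hu j)

/-! ### Logarithmic vector fields -/

theorem IsReducedEquation.mem_derLog_iff (hJ : IsReducedEquation f J)
    {δ : Derivation ℂ (O n) (O n)} : δ ∈ derLog ℂ J ↔ δ f ∈ J := by
  refine ⟨fun h => h f hJ.mem, fun h g hg => ?_⟩
  obtain ⟨c, rfl⟩ := hJ.mem_iff.mp hg
  rw [Derivation.leibniz]
  exact J.add_mem (J.mul_mem_right _ hJ.mem) (J.mul_mem_left _ h)

theorem IsReducedEquation.exists_factor (hJ : IsReducedEquation f J)
    {δ : Derivation ℂ (O n) (O n)} (hδ : δ ∈ derLog ℂ J) : ∃ α, δ f = α * f := by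
  obtain ⟨c, hc⟩ := hJ.mem_iff.mp (hδ f hJ.mem)
  exact ⟨c, by rw [hc, mul_comm]⟩

theorem IsReducedEquation.smul_mem (hJ : IsReducedEquation f J) (δ : Derivation ℂ (O n) (O n)) :
    f • δ ∈ derLog ℂ J :=
  hJ.mem_derLog_iff.mpr (J.mul_mem_right _ hJ.mem)

/-- The field `f δ` as a logarithmic field. -/
def IsReducedEquation.logSmul (hJ : IsReducedEquation f J) (δ : Derivation ℂ (O n) (O n)) :
    derLog ℂ J := ⟨f • δ, hJ.smul_mem δ⟩

/-! ### Saito's criterion -/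

/-- The coordinate vector fields form a basis of `Der`. -/
def derBasis (n : ℕ) : Module.Basis (Fin n) (O n) (Derivation ℂ (O n) (O n)) :=
  Module.Basis.ofEquivFun
    { toFun := fun δ i => δ (x i)
      map_add' := fun _ _ => rfl
      map_smul' := fun _ _ => rfl
      invFun := vectorField
      left_inv := fun _ => derivation_ext_x fun i => vectorField_x _ i
      right_inv := fun c => funext fun i => vectorField_x c i }

/-- The rank is squeezed: `Der(-log D)` lies in `Der`, of rank `n`, and contains the independent
fields `f ∂_j`. -/
theorem IsReducedEquation.nonempty_basis (hJ : IsReducedEquation f J)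
    [Module.Free (O n) (derLog ℂ J)] : Nonempty (Module.Basis (Fin n) (O n) (derLog ℂ J)) := by
  have h1 : Module.rank (O n) (derLog ℂ J) ≤ n := by
    refine (Submodule.rank_le _).trans ?_
    rw [rank_eq_card_basis (derBasis n), Fintype.card_fin]
  have h2 : (n : Cardinal) ≤ Module.rank (O n) (derLog ℂ J) := by
    have hli : LinearIndependent (O n) fun j : Fin n => hJ.logSmul (partialD j) := by
      rw [Fintype.linearIndependent_iff]
      intro c hc j
      have h3 := congrArg (fun δ : derLog ℂ J => (δ : Derivation ℂ (O n) (O n)) (x j)) hc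
      simp only [Submodule.coe_sum, Submodule.coe_smul, IsReducedEquation.logSmul,
        derivation_sum_apply, Derivation.smul_apply, partialD_x, smul_eq_mul] at h3
      simpa [hJ.ne_zero] using h3
    simpa using hli.cardinal_le_rank
  have h3 := le_antisymm h1 h2
  let b := Module.Free.chooseBasis (O n) (derLog ℂ J)
  rw [Module.Free.rank_eq_card_chooseBasisIndex, ← Cardinal.mk_fin, Cardinal.eq] at h3
  exact h3.map fun e => b.reindex e

/-- The matrix of coefficients of a family of vector fields. -/
def coeffMatrix {ι : Type*} (v : ι → Derivation ℂ (O n) (O n)) : Matrix ι (Fin n) (O n) :=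
  Matrix.of fun i j => v i (x j)

theorem det_basis_dvd (b : Module.Basis (Fin n) (O n) (derLog ℂ J)) (v : Fin n → derLog ℂ J) :
    (coeffMatrix fun i => (b i : Derivation ℂ (O n) (O n))).det ∣
      (coeffMatrix fun i => (v i : Derivation ℂ (O n) (O n))).det := by
  have : (coeffMatrix fun i => (v i : Derivation ℂ (O n) (O n))) =
      (Matrix.of fun i k => b.repr (v i) k) *
        coeffMatrix fun i => (b i : Derivation ℂ (O n) (O n)) := by
    ext i j : 1
    have h := congrArg (fun δ : derLog ℂ J => (δ : Derivation ℂ (O n) (O n)) (x j))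
      (b.sum_repr (v i)).symm
    simp only [Submodule.coe_sum, Submodule.coe_smul, derivation_sum_apply,
      Derivation.smul_apply, smul_eq_mul] at h
    simpa [Matrix.mul_apply, coeffMatrix] using h
  rw [this, Matrix.det_mul]
  exact dvd_mul_left _ _

/-- Saito's criterion: the determinant of the coefficients of a basis of `Der(-log D)` is an
equation of `D`. -/
theorem IsReducedEquation.exists_unit_det (hJ : IsReducedEquation f J)
    (b : Module.Basis (Fin n) (O n) (derLog ℂ J)) :
    ∃ u : (O n)ˣ, (coeffMatrix fun i => (b i : Derivation ℂ (O n) (O n))).det = u * f := by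
  set A := coeffMatrix fun i => (b i : Derivation ℂ (O n) (O n)) with hA
  have hmem : A.det ∈ J := by
    refine hJ.mem_of_mul_partialD_mem fun j => ?_
    -- Cramer's rule: `det A · ∂_j f` is a combination of the `b i (f)`, which lie in `J`.
    have h1 : A.adjugate.mulVec (A.mulVec fun l => partialD l f) j = A.det * partialD j f := by
      rw [Matrix.mulVec_mulVec, Matrix.adjugate_mul, Matrix.smul_mulVec, Matrix.one_mulVec]
      rfl
    rw [← h1, Matrix.mulVec, dotProduct]
    refine J.sum_mem fun i _ => J.mul_mem_left _ ?_
    have h2 : A.mulVec (fun l => partialD l f) i = (b i : Derivation ℂ (O n) (O n)) f := by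
      rw [derivation_apply_eq_sum]; rfl
    rw [h2]
    exact (b i).2 f hJ.mem
  obtain ⟨c, hc⟩ := hJ.mem_iff.mp hmem
  have hpow : A.det ∣ f ^ n := by
    refine (det_basis_dvd b fun j => hJ.logSmul (partialD j)).trans (dvd_of_eq ?_)
    have : (coeffMatrix fun i => ((hJ.logSmul (partialD i) : derLog ℂ J) :
        Derivation ℂ (O n) (O n))) = Matrix.diagonal fun _ => f := by
      ext i j : 1
      simp [coeffMatrix, IsReducedEquation.logSmul, partialD_x, Matrix.diagonal_apply]
    rw [this, Matrix.det_diagonal]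
    simp
  -- Besides the `f ∂_j`, whose determinant is `f ^ n`, the fields `∂_j f ∂_i - ∂_i f ∂_j`
  -- annihilate `f` and are logarithmic. Together with `f ∂_j` they have the determinant shown.
  have hder : ∀ j, A.det ∣ f * partialD j f ^ (n - 1) := by
    intro j
    let v : Fin n → derLog ℂ J := fun i => if hi : i = j then hJ.logSmul (partialD j) else
      ⟨partialD j f • partialD i - partialD i f • partialD j, hJ.mem_derLog_iff.mpr (by
        rw [Derivation.sub_apply, Derivation.smul_apply, Derivation.smul_apply, smul_eq_mul,
          smul_eq_mul, mul_comm, sub_self]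
        exact J.zero_mem)⟩
    refine (det_basis_dvd b v).trans (dvd_of_eq ?_)
    set B := coeffMatrix fun i => (v i : Derivation ℂ (O n) (O n)) with hB
    have hvj : ∀ l, B j l = if l = j then f else 0 := fun l => by
      simp [hB, coeffMatrix, v, IsReducedEquation.logSmul, partialD_x, eq_comm]
    have hvi : ∀ i l, i ≠ j → l ≠ j → B i l = if i = l then partialD j f else 0 := by
      intro i l hi hl
      have hl' : j ≠ l := Ne.symm hl
      simp [hB, coeffMatrix, v, hi, hl', partialD_x]
    -- Row `j` of `B` has only its diagonal entry, and away from row and column `j` the matrix is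
    -- diagonal. Hence only the identity permutation contributes.
    have h2 : B.det = ∏ i, B i i := by
      rw [← Matrix.det_transpose]
      rw [Matrix.det_apply, Finset.sum_eq_single 1]
      · simp
      · intro σ _ hσ
        obtain ⟨i, hi⟩ : ∃ i, i ≠ j ∧ σ i ≠ i ∨ σ j ≠ j ∧ i = j := by
          by_contra! H
          refine hσ (Equiv.ext fun i => ?_)
          by_cases hij : i = j
          · subst hij
            by_contra h
            exact (H i).2 h rfl
          · exact (H i).1 hij
        rcases hi with ⟨hi, hσi⟩ | ⟨hσj, -⟩
        · by_cases hσj : σ j = j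
          · have : σ i ≠ j := fun h => hi (σ.injective (h.trans hσj.symm))
            rw [Finset.prod_eq_zero (Finset.mem_univ i), smul_zero]
            rw [Matrix.transpose_apply, hvi _ _ hi this, if_neg (Ne.symm hσi)]
          · rw [Finset.prod_eq_zero (Finset.mem_univ j), smul_zero]
            rw [Matrix.transpose_apply, hvj, if_neg hσj]
        · rw [Finset.prod_eq_zero (Finset.mem_univ j), smul_zero]
          rw [Matrix.transpose_apply, hvj, if_neg hσj]
      · simp
    rw [h2, ← Finset.mul_prod_erase _ _ (Finset.mem_univ j), hvj, if_pos rfl]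
    congr 1
    rw [Finset.prod_congr rfl fun i hi => (by
      have hi' := Finset.ne_of_mem_erase hi
      rw [hvi i i hi' hi', if_pos rfl] : _ = partialD j f), Finset.prod_const,
      Finset.card_erase_of_mem (Finset.mem_univ j), Finset.card_univ, Fintype.card_fin]
  have hc1 : ∀ j, c ∣ partialD j f ^ (n - 1) := fun j => by
    have := hder j
    rw [hc] at this
    exact (mul_dvd_mul_iff_left hJ.ne_zero).mp this
  have hcu : IsUnit c := by
    have hcn : c ∣ f ^ n := (Dvd.intro_left f hc.symm).trans hpow
    clear hpow hc
    -- Descent on `m`: if `c e = f ^ (m + 1)`, then `e (∂_j f) ^ (n - 1)` lies in `J` for all `j`,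
    -- because `c` divides `(∂_j f) ^ (n - 1)`. So `f` divides `e`, and one factor `f` cancels.
    have : ∀ m, c ∣ f ^ m → IsUnit c := by
      intro m
      induction m with
      | zero => intro h; rw [pow_zero] at h; exact isUnit_of_dvd_one h
      | succ m ih =>
        rintro ⟨e, he⟩
        refine ih ?_
        have heJ : e ∈ J := by
          refine hJ.mem_of_mul_partialD_pow_mem (n - 1) fun j => ?_
          obtain ⟨k, hk⟩ := hc1 j
          rw [hk, ← mul_assoc, mul_comm e c, ← he, pow_succ]
          exact J.mul_mem_right _ (J.mul_mem_left _ hJ.mem)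
        obtain ⟨e', rfl⟩ := hJ.mem_iff.mp heJ
        refine ⟨e', mul_left_cancel₀ hJ.ne_zero ?_⟩
        rw [← pow_succ', he]; ring
    exact this n hcn
  obtain ⟨u, rfl⟩ := hcu
  exact ⟨u, by rw [hc, mul_comm]⟩

/-! ### Evaluation of normal fields on the equation -/

/-- Evaluation of vector fields on a function. -/
def derEval (f : O n) : Derivation ℂ (O n) (O n) →ₗ[O n] O n where
  toFun δ := δ f
  map_add' _ _ := rfl
  map_smul' _ _ := rfl

theorem IsReducedEquation.derLog_le_ker (hJ : IsReducedEquation f J) :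
    derLog ℂ J ≤ LinearMap.ker ((Submodule.mkQ J).comp (derEval f)) := by
  intro δ hδ
  rw [LinearMap.mem_ker, LinearMap.comp_apply, Submodule.mkQ_apply, Submodule.Quotient.mk_eq_zero]
  exact hδ f hJ.mem

/-- The injection `Der / Der(-log D) → 𝒪 / J`, `[η] ↦ η(f)`. -/
def IsReducedEquation.eval (hJ : IsReducedEquation f J) : NormalModule J →ₗ[O n] O n ⧸ J :=
  Submodule.liftQ (derLog ℂ J) ((Submodule.mkQ J).comp (derEval f)) hJ.derLog_le_ker

theorem IsReducedEquation.eval_vfClass (hJ : IsReducedEquation f J)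
    (η : Derivation ℂ (O n) (O n)) :
    hJ.eval (vfClass J η) = Ideal.Quotient.mk J (η f) := rfl

theorem IsReducedEquation.eval_injective (hJ : IsReducedEquation f J) :
    Function.Injective hJ.eval := by
  rw [injective_iff_map_eq_zero]
  intro v hv
  obtain ⟨η, rfl⟩ := vfClass_surjective J v
  rw [hJ.eval_vfClass, Ideal.Quotient.eq_zero_iff_mem] at hv
  exact vfClass_eq_zero.mpr (hJ.mem_derLog_iff.mpr hv)

/-- `g` is a potential of the cochain `ψ`: the fields `δ + ε ψ(δ)` preserve the ideal
of `f + ε g`. -/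
def IsReducedEquation.IsPotential (hJ : IsReducedEquation f J) (ψ : C1 J) (g : O n) : Prop :=
  ∀ (δ : derLog ℂ J) (α : O n), (δ : Derivation ℂ (O n) (O n)) f = α * f →
    hJ.eval (ψ δ) = Ideal.Quotient.mk J (α * g - (δ : Derivation ℂ (O n) (O n)) g)

theorem IsReducedEquation.IsPotential.unique {hJ : IsReducedEquation f J} {ψ φ : C1 J} {g : O n}
    (h : hJ.IsPotential ψ g) (h' : hJ.IsPotential φ g) : ψ = φ := by
  ext δ
  obtain ⟨α, hα⟩ := hJ.exists_factor δ.2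
  exact hJ.eval_injective (by rw [h δ α hα, h' δ α hα])

theorem IsReducedEquation.IsPotential.lin {hJ : IsReducedEquation f J} {ψ φ : C1 J} {g h : O n}
    (hψ : hJ.IsPotential ψ g) (hφ : hJ.IsPotential φ h) (a b : ℂ) :
    hJ.IsPotential (a • ψ + b • φ) (a • g + b • h) := by
  intro δ α hα
  have hs : ∀ (c : ℂ) (v : NormalModule J), hJ.eval (c • v) = c • hJ.eval v := fun c v => by
    rw [← algebraMap_smul (O n) c v, map_smul, algebraMap_smul]
  rw [LinearMap.add_apply, LinearMap.smul_apply, LinearMap.smul_apply, map_add, hs, hs,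
    hψ δ α hα, hφ δ α hα]
  have hm : ∀ (c : ℂ) (u : O n), c • Ideal.Quotient.mk J u = Ideal.Quotient.mk J (c • u) :=
    fun c u => rfl
  rw [hm, hm, ← map_add]
  congr 1
  simp only [map_add, Derivation.map_smul, mul_add, mul_smul_comm, smul_sub]
  abel

/-- Coboundaries are the trivial deformations: the infinitesimal change of coordinates by `η` turns
`f` into `f + ε η(f)`. -/
theorem IsReducedEquation.isPotential_d0 (hJ : IsReducedEquation f J)
    (η : Derivation ℂ (O n) (O n)) : hJ.IsPotential (d0 J (vfClass J η)) (η f) := by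
  intro δ α hα
  change hJ.eval (-bracketQuot δ (vfClass J η)) = _
  rw [bracketQuot_vfClass, map_neg, hJ.eval_vfClass, ← map_neg, Ideal.Quotient.mk_eq_mk_iff_sub_mem,
    Derivation.commutator_apply, hα, Derivation.leibniz, smul_eq_mul, smul_eq_mul]
  have : -((δ : Derivation ℂ (O n) (O n)) (η f) - (α * η f + f * η α)) -
    (α * η f - (δ : Derivation ℂ (O n) (O n)) (η f)) = f * η α := by ring
  rw [this]
  exact J.mul_mem_right _ hJ.mem

theorem IsReducedEquation.isPotential_zero (hJ : IsReducedEquation f J) {g : O n} (hg : g ∈ J) :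
    hJ.IsPotential 0 g := by
  intro δ α _
  rw [LinearMap.zero_apply, map_zero, eq_comm, Ideal.Quotient.eq_zero_iff_mem]
  exact J.sub_mem (J.mul_mem_left _ hg) (δ.2 g hg)

/-- Testing on the logarithmic fields `f ∂_j`, whose factor is `∂_j f`, gives `∂_j f (g - g') ∈ J`
for every `j`. As `f` is reduced, the partial derivatives cancel. -/
theorem IsReducedEquation.IsPotential.sub_mem {hJ : IsReducedEquation f J} {ψ : C1 J} {g g' : O n}
    (h : hJ.IsPotential ψ g) (h' : hJ.IsPotential ψ g') : g - g' ∈ J := by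
  refine hJ.mem_of_mul_partialD_mem fun j => ?_
  have hα : ((hJ.logSmul (partialD j) : derLog ℂ J) : Derivation ℂ (O n) (O n)) f =
      partialD j f * f := mul_comm _ _
  have h1 := (h _ _ hα).symm.trans (h' _ _ hα)
  rw [Ideal.Quotient.mk_eq_mk_iff_sub_mem] at h1
  have h2 := J.add_mem h1 (J.mul_mem_right (partialD j g - partialD j g') hJ.mem)
  convert h2 using 1
  change _ = partialD j f * g - f * partialD j g - (partialD j f * g' - f * partialD j g') + _
  ring

/-- A cocycle with potential `g` is a coboundary if and only if `g` lies in the Tyurina ideal. -/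
theorem IsReducedEquation.IsPotential.mem_range_d0_iff {hJ : IsReducedEquation f J} {ψ : C1 J}
    {g : O n} (h : hJ.IsPotential ψ g) :
    ψ ∈ LinearMap.range (d0 J) ↔ ∃ η : Derivation ℂ (O n) (O n), g - η f ∈ J := by
  constructor
  · rintro ⟨σ, rfl⟩
    obtain ⟨η, rfl⟩ := vfClass_surjective J σ
    exact ⟨η, h.sub_mem (hJ.isPotential_d0 η)⟩
  · rintro ⟨η, hη⟩
    refine ⟨vfClass J η, ?_⟩
    have h1 := (hJ.isPotential_d0 η).lin (hJ.isPotential_zero hη) 1 1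
    simp only [one_smul, add_zero, add_sub_cancel] at h1
    exact h1.unique h

/-- The germs `g` such that all logarithmic fields of `f` lift to fields preserving `f + ε g`. -/
def IsReducedEquation.Extends (_ : IsReducedEquation f J) (g : O n) : Prop :=
  ∀ (δ : derLog ℂ J) (α : O n), (δ : Derivation ℂ (O n) (O n)) f = α * f →
    ∃ η : Derivation ℂ (O n) (O n), η f - (α * g - (δ : Derivation ℂ (O n) (O n)) g) ∈ J

theorem IsReducedEquation.IsPotential.extends {hJ : IsReducedEquation f J} {ψ : C1 J} {g : O n}
    (h : hJ.IsPotential ψ g) : hJ.Extends g := by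
  intro δ α hα
  obtain ⟨η, hη⟩ := vfClass_surjective J (ψ δ)
  refine ⟨η, ?_⟩
  rw [← Ideal.Quotient.mk_eq_mk_iff_sub_mem, ← h δ α hα, ← hη, hJ.eval_vfClass]

/-- A class in `Der / Der(-log D)` is known from its value on `f`, so the lifts give a well-defined
linear map. The cocycle identity expresses that the bracket of two lifts again preserves `f + ε g`;
it is checked on `f`. -/
theorem IsReducedEquation.Extends.exists_cocycle {hJ : IsReducedEquation f J} {g : O n}
    (h : hJ.Extends g) : ∃ ψ : Z1 J, hJ.IsPotential (ψ : C1 J) g := by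
  choose fac hfac using fun δ : derLog ℂ J => hJ.exists_factor δ.2
  choose lift hlift using fun δ : derLog ℂ J => h δ (fac δ) (hfac δ)
  have hval : ∀ (δ : derLog ℂ J) (α : O n), (δ : Derivation ℂ (O n) (O n)) f = α * f →
      hJ.eval (vfClass J (lift δ)) =
        Ideal.Quotient.mk J (α * g - (δ : Derivation ℂ (O n) (O n)) g) := by
    intro δ α hα
    have : α = fac δ := mul_right_cancel₀ hJ.ne_zero (hα.symm.trans (hfac δ))
    rw [hJ.eval_vfClass, Ideal.Quotient.mk_eq_mk_iff_sub_mem, this]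
    exact hlift δ
  let ψ : C1 J :=
    { toFun := fun δ => vfClass J (lift δ)
      map_add' := fun δ ν => hJ.eval_injective (by
        rw [map_add, hval δ _ (hfac δ), hval ν _ (hfac ν), hval (δ + ν) (fac δ + fac ν),
          ← map_add]
        · congr 1
          rw [Submodule.coe_add, Derivation.add_apply]; ring
        · rw [Submodule.coe_add, Derivation.add_apply, hfac, hfac]; ring)
      map_smul' := fun c δ => hJ.eval_injective (by
        rw [map_smul, hval δ _ (hfac δ), hval (c • δ) (c * fac δ)]
        · rw [RingHom.id_apply, Algebra.smul_def, Ideal.Quotient.algebraMap_eq, ← map_mul]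
          congr 1
          rw [Submodule.coe_smul, Derivation.smul_apply, smul_eq_mul]; ring
        · rw [Submodule.coe_smul, Derivation.smul_apply, smul_eq_mul, hfac]; ring) }
  have hψ : hJ.IsPotential ψ g := hval
  refine ⟨⟨ψ, ?_⟩, hψ⟩
  rw [LinearMap.mem_ker]
  funext δ ν
  apply hJ.eval_injective
  change hJ.eval (-bracketQuot δ (vfClass J (lift ν)) + bracketQuot ν (vfClass J (lift δ)) +
    ψ (logBracket δ ν)) = hJ.eval 0
  have hbr : ((logBracket δ ν : derLog ℂ J) : Derivation ℂ (O n) (O n)) f =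
      ((δ : Derivation ℂ (O n) (O n)) (fac ν) - (ν : Derivation ℂ (O n) (O n)) (fac δ)) * f := by
    change ⁅(δ : Derivation ℂ (O n) (O n)), (ν : Derivation ℂ (O n) (O n))⁆ f = _
    rw [Derivation.commutator_apply, hfac, hfac, Derivation.leibniz, Derivation.leibniz,
      hfac, hfac]
    simp only [smul_eq_mul]; ring
  rw [map_add, map_add, map_neg, map_zero, bracketQuot_vfClass, bracketQuot_vfClass,
    hJ.eval_vfClass, hJ.eval_vfClass, hψ _ _ hbr, ← map_neg, ← map_add, ← map_add,
    Ideal.Quotient.eq_zero_iff_mem]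
  change -(⁅(δ : Derivation ℂ (O n) (O n)), lift ν⁆ f) +
    ⁅(ν : Derivation ℂ (O n) (O n)), lift δ⁆ f + (_ * g -
    ⁅(δ : Derivation ℂ (O n) (O n)), (ν : Derivation ℂ (O n) (O n))⁆ g) ∈ J
  have h1 := δ.2 _ (hlift ν)
  have h2 := ν.2 _ (hlift δ)
  have h3 := J.mul_mem_left (fac δ) (hlift ν)
  have h4 := J.mul_mem_left (fac ν) (hlift δ)
  have h5 := J.mul_mem_right (lift ν (fac δ)) hJ.mem
  have h6 := J.mul_mem_right (lift δ (fac ν)) hJ.mem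
  have key := J.add_mem (J.sub_mem (J.sub_mem (J.add_mem (J.sub_mem h2 h1) h3) h4) h6) h5
  convert key using 1
  simp only [Derivation.commutator_apply, hfac, Derivation.leibniz, map_sub, smul_eq_mul]
  ring

/-! ### Potentials of cocycles -/

/-- The derivative of the adjugate: if `A` is perturbed to `A + ε B`, then `adj(A) A = det(A)`
is perturbed to an identity of the same kind. -/
theorem exists_adjugate_derivative {R ι : Type*} [CommRing R] [Fintype ι] [DecidableEq ι]
    (A B : Matrix ι ι R) :
    ∃ (d : R) (P : Matrix ι ι R), A.adjugate * B + P * A = d • 1 := by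
  -- `M = A + ε B`. The claim is the `ε`-part of `adj(M) M = det(M)`.
  let M : Matrix ι ι (DualNumber R) := Matrix.of fun i j => (A i j, B i j)
  have hM : M.map (TrivSqZeroExt.fstHom R R R) = A := by ext i j; rfl
  have hadj : ∀ i j, (M.adjugate i j).fst = A.adjugate i j := fun i j => by
    have := congrFun (congrFun (RingHom.map_adjugate
      (TrivSqZeroExt.fstHom R R R : DualNumber R →+* R) M) i) j
    exact this.trans (by rw [← hM]; rfl)
  refine ⟨M.det.snd, M.adjugate.map TrivSqZeroExt.snd, ?_⟩
  ext i j
  have h := congrArg (TrivSqZeroExt.snd) (congrFun (congrFun (Matrix.adjugate_mul M) i) j)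
  rw [Matrix.mul_apply, TrivSqZeroExt.snd_sum] at h
  rw [Matrix.add_apply, Matrix.mul_apply, Matrix.mul_apply, ← Finset.sum_add_distrib]
  refine (Finset.sum_congr rfl fun k _ => ?_).trans (h.trans ?_)
  · rw [TrivSqZeroExt.snd_mul, hadj, Matrix.map_apply, smul_eq_mul, op_smul_eq_mul]
    rfl
  · rw [Matrix.smul_apply, Matrix.smul_apply, Matrix.one_apply, Matrix.one_apply]
    split_ifs <;> simp

/-- On fields divisible by `f`, every cochain is multiplication by a function. -/
theorem IsReducedEquation.exists_multiplier (hJ : IsReducedEquation f J)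
    (b : Module.Basis (Fin n) (O n) (derLog ℂ J)) (ψ : C1 J) :
    ∃ g : O n, ∀ θ, ψ (hJ.logSmul θ) = vfClass J (g • θ) := by
  obtain ⟨u, hu⟩ := hJ.exists_unit_det b
  choose η hη using fun k => vfClass_surjective J (ψ (b k))
  set A := coeffMatrix fun i => (b i : Derivation ℂ (O n) (O n)) with hA
  -- The term `P * A` consists of combinations of the `b k`, which are zero in the normal module.
  -- Hence `ψ` sends `∑ adj(A)_{jk} b_k = u f ∂_j` to the class of `d ∂_j`.
  obtain ⟨d, P, hP⟩ := exists_adjugate_derivative A (coeffMatrix η)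
  have hfield : ∀ j, (u : O n) • hJ.logSmul (partialD j) = ∑ k, A.adjugate j k • b k := by
    intro j
    apply Subtype.ext
    refine derivation_ext_x fun l => ?_
    simp only [Submodule.coe_sum, Submodule.coe_smul, derivation_sum_apply,
      Derivation.smul_apply, IsReducedEquation.logSmul, partialD_x, smul_eq_mul]
    have := congrFun (congrFun (Matrix.adjugate_mul A) j) l
    rw [Matrix.mul_apply, hu, Matrix.smul_apply, Matrix.one_apply, smul_eq_mul] at this
    rw [← mul_assoc]
    exact this.symm
  have hval : ∀ j, (u : O n) • ψ (hJ.logSmul (partialD j)) = vfClass J (d • partialD j) := by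
    intro j
    rw [← map_smul, hfield, map_sum]
    simp only [map_smul, ← hη]
    simp only [← map_smul]
    rw [← map_sum, ← sub_eq_zero, ← map_sub, vfClass_eq_zero]
    have : (∑ k, A.adjugate j k • η k) - d • partialD j =
        -((∑ k, P j k • b k : derLog ℂ J) : Derivation ℂ (O n) (O n)) := by
      refine derivation_ext_x fun l => ?_
      simp only [Submodule.coe_sum, Submodule.coe_smul, derivation_sum_apply,
        Derivation.smul_apply, Derivation.sub_apply, Derivation.neg_apply, partialD_x, smul_eq_mul]
      have := congrFun (congrFun hP j) l
      rw [Matrix.add_apply, Matrix.mul_apply, Matrix.mul_apply, Matrix.smul_apply,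
        Matrix.one_apply, smul_eq_mul] at this
      rw [sub_eq_iff_eq_add, ← this, neg_add_eq_sub, eq_sub_iff_add_eq]
      rfl
    rw [this]
    exact Submodule.neg_mem _ (Submodule.coe_mem _)
  have hval' : ∀ j, ψ (hJ.logSmul (partialD j)) =
      vfClass J (((↑u⁻¹ : O n) * d) • partialD j) := fun j => by
    rw [mul_smul, map_smul, ← hval, smul_smul, Units.inv_mul, one_smul]
  refine ⟨↑u⁻¹ * d, fun θ => ?_⟩
  have hθ : hJ.logSmul θ = ∑ j, θ (x j) • hJ.logSmul (partialD j) := by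
    apply Subtype.ext
    simp only [Submodule.coe_sum, Submodule.coe_smul, IsReducedEquation.logSmul]
    conv_lhs => rw [derivation_eq_sum θ, Finset.smul_sum]
    simp only [smul_smul, mul_comm]
  rw [hθ, map_sum]
  conv_rhs => rw [derivation_eq_sum θ, Finset.smul_sum, map_sum]
  refine Finset.sum_congr rfl fun j _ => ?_
  rw [map_smul, hval', ← map_smul, smul_smul, smul_smul, mul_comm]

/-- The multiplier `g` with `ψ(f θ) = [g θ]` is the potential. Since `[δ, f ∂_j] = f (α ∂_j + [δ,
∂_j])`, evaluating the cocycle identity for `δ` and `f ∂_j` on `f` leaves `∂_j f (η(f) - (α g -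
δ(g))) ∈ J`, where `[η] = ψ(δ)`. Cancelling the `∂_j f` gives the claim. -/
theorem IsReducedEquation.exists_isPotential (hJ : IsReducedEquation f J)
    (b : Module.Basis (Fin n) (O n) (derLog ℂ J)) (ψ : Z1 J) :
    ∃ g : O n, hJ.IsPotential (ψ : C1 J) g := by
  obtain ⟨g, hg⟩ := hJ.exists_multiplier b (ψ : C1 J)
  refine ⟨g, fun δ α hα => ?_⟩
  obtain ⟨η, hη⟩ := vfClass_surjective J ((ψ : C1 J) δ)
  rw [← hη, hJ.eval_vfClass, Ideal.Quotient.mk_eq_mk_iff_sub_mem]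
  refine hJ.mem_of_mul_partialD_mem fun j => ?_
  have hc : -bracketQuot δ ((ψ : C1 J) (hJ.logSmul (partialD j))) +
      bracketQuot (hJ.logSmul (partialD j)) ((ψ : C1 J) δ) +
      (ψ : C1 J) (logBracket δ (hJ.logSmul (partialD j))) = 0 :=
    congrFun (congrFun (LinearMap.mem_ker.mp ψ.2) δ) (hJ.logSmul (partialD j))
  have hbr : logBracket δ (hJ.logSmul (partialD j)) =
      hJ.logSmul (α • partialD j + ⁅(δ : Derivation ℂ (O n) (O n)), partialD j⁆) := by
    apply Subtype.ext
    ext h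
    change ⁅(δ : Derivation ℂ (O n) (O n)), f • partialD j⁆ h =
      f * (α * partialD j h + ⁅(δ : Derivation ℂ (O n) (O n)), partialD j⁆ h)
    simp only [Derivation.commutator_apply, Derivation.smul_apply, Derivation.leibniz, smul_eq_mul,
      hα]
    ring
  rw [hbr, hg, hg, ← hη, bracketQuot_vfClass, bracketQuot_vfClass, ← map_neg, ← map_add,
    ← map_add, vfClass_eq_zero, hJ.mem_derLog_iff] at hc
  have h1 := J.neg_mem hc
  have h2 := J.mul_mem_right (partialD j (η f) - η (partialD j f)) hJ.mem
  convert J.add_mem h1 h2 using 1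
  simp only [IsReducedEquation.logSmul, Derivation.commutator_apply, Derivation.smul_apply,
    Derivation.leibniz, smul_eq_mul, hα, Derivation.add_apply, Derivation.neg_apply]
  ring

/-! ### Bases of square zero -/

/-- A basis of the maximal ideal of a local algebra whose maximal ideal has square zero. -/
structure SquareZeroBasis {A : Type} [CommRing A] [Algebra ℂ A] (π : A →ₐ[ℂ] ℂ) (ι : Type)
    [Fintype ι] [DecidableEq ι] where
  /-- the basis vectors -/
  e : ι → A
  /-- the coordinates -/
  co : ι → A →ₗ[ℂ] ℂ
  eq_sum : ∀ a, a = π a • 1 + ∑ i, co i a • e i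
  co_one : ∀ i, co i 1 = 0
  co_e : ∀ i j, co i (e j) = if i = j then 1 else 0
  res_e : ∀ i, π (e i) = 0
  mul_e : ∀ i j, e i * e j = 0

namespace SquareZeroBasis

variable {A : Type} [CommRing A] [Algebra ℂ A] {π : A →ₐ[ℂ] ℂ} {ι : Type} [Fintype ι]
  [DecidableEq ι] (S : SquareZeroBasis π ι)

theorem co_mul (i : ι) (a b : A) : S.co i (a * b) = π a * S.co i b + S.co i a * π b := by
  have h : a * b = (π a * π b) • 1 + ∑ j, (π a * S.co j b + S.co j a * π b) • S.e j := by
    conv_lhs => rw [S.eq_sum a, S.eq_sum b]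
    have hz : (∑ j, S.co j a • S.e j) * ∑ j, S.co j b • S.e j = 0 := by
      rw [Finset.sum_mul_sum]
      refine Finset.sum_eq_zero fun j _ => Finset.sum_eq_zero fun k _ => ?_
      rw [smul_mul_smul_comm, S.mul_e, smul_zero]
    rw [add_mul, mul_add, mul_add, hz, add_zero, smul_mul_smul_comm, one_mul, smul_one_mul,
      mul_smul_one]
    simp only [add_smul, Finset.sum_add_distrib, Finset.smul_sum, smul_smul, mul_comm]
    abel
  rw [h, map_add, map_smul, S.co_one, smul_zero, zero_add, map_sum]
  simp [S.co_e]

theorem exists_eq_add_sum {V : Type} [AddCommGroup V] [Module ℂ V] (z : A ⊗[ℂ] V) :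
    ∃ (v : V) (u : ι → V), z = 1 ⊗ₜ v + ∑ i, S.e i ⊗ₜ[ℂ] u i := by
  induction z with
  | zero => exact ⟨0, 0, by simp⟩
  | tmul a v =>
    refine ⟨π a • v, fun i => S.co i a • v, ?_⟩
    conv_lhs => rw [S.eq_sum a]
    simp only [TensorProduct.add_tmul, TensorProduct.sum_tmul, TensorProduct.smul_tmul]
  | add y z hy hz =>
    obtain ⟨v, u, rfl⟩ := hy
    obtain ⟨v', u', rfl⟩ := hz
    refine ⟨v + v', u + u', ?_⟩
    simp only [TensorProduct.tmul_add, Pi.add_apply, Finset.sum_add_distrib]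
    abel

theorem toFibre_tmul (π : A →ₐ[ℂ] ℂ) (a : A) (h : O n) : toFibre π (a ⊗ₜ h) = π a • h := by
  rw [toFibre, Algebra.TensorProduct.productMap_apply_tmul, Algebra.smul_def]
  rfl

/-- The components of a function on `ℂⁿ × S`. -/
def comp (i : ι) : A ⊗[ℂ] O n →ₗ[ℂ] O n :=
  (TensorProduct.lid ℂ (O n)).toLinearMap.comp ((S.co i).rTensor (O n))

theorem comp_tmul (i : ι) (a : A) (h : O n) : S.comp i (a ⊗ₜ h) = S.co i a • h := by
  simp [comp]

/-- The function with given components. -/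
def pack (h : O n) (u : ι → O n) : A ⊗[ℂ] O n := 1 ⊗ₜ h + ∑ i, S.e i ⊗ₜ u i

theorem toFibre_pack (h : O n) (u : ι → O n) : toFibre π (S.pack h u) = h := by
  simp [pack, toFibre_tmul, S.res_e]

theorem comp_pack (h : O n) (u : ι → O n) (i : ι) : S.comp i (S.pack h u) = u i := by
  simp [pack, comp_tmul, S.co_one, S.co_e]

theorem pack_eta (F : A ⊗[ℂ] O n) : F = S.pack (toFibre π F) fun i => S.comp i F := by
  obtain ⟨h, u, hF⟩ := S.exists_eq_add_sum F
  change F = S.pack h u at hF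
  subst hF
  simp only [toFibre_pack, comp_pack]

theorem ext {F G : A ⊗[ℂ] O n} (h0 : toFibre π F = toFibre π G)
    (h1 : ∀ i, S.comp i F = S.comp i G) : F = G := by
  rw [S.pack_eta F, S.pack_eta G, h0]
  simp only [h1]

theorem comp_mul (i : ι) (F G : A ⊗[ℂ] O n) :
    S.comp i (F * G) = toFibre π F * S.comp i G + S.comp i F * toFibre π G := by
  induction F with
  | zero => simp
  | add F F' hF hF' => simp only [add_mul, map_add, hF, hF']; ring
  | tmul a g =>
    induction G with
    | zero => simp
    | add G G' hG hG' => simp only [mul_add, map_add, hG, hG']; ring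
    | tmul b h =>
      simp only [Algebra.TensorProduct.tmul_mul_tmul, comp_tmul, toFibre_tmul, S.co_mul, add_smul,
        smul_mul_smul_comm]

theorem toFibre_one_tmul (h : O n) : toFibre π (1 ⊗ₜ h) = h := by
  rw [toFibre_tmul, map_one, one_smul]

theorem comp_one_tmul (i : ι) (h : O n) : S.comp i (1 ⊗ₜ h) = 0 := by
  rw [comp_tmul, S.co_one, zero_smul]

theorem toFibre_e_tmul (i : ι) (h : O n) : toFibre π (S.e i ⊗ₜ h) = 0 := by
  rw [toFibre_tmul, S.res_e, zero_smul]

theorem comp_e_tmul (i j : ι) (h : O n) : S.comp i (S.e j ⊗ₜ h) = if i = j then h else 0 := by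
  rw [comp_tmul, S.co_e]; split_ifs <;> simp

/-! ### Relative vector fields -/

/-- The extension of a vector field on `ℂⁿ` to `ℂⁿ × S`. -/
def _root_.FreeDiv.extendVF (A : Type) [CommRing A] [Algebra ℂ A] (δ : Derivation ℂ (O n) (O n)) :
    Derivation A (A ⊗[ℂ] O n) (A ⊗[ℂ] O n) :=
  Derivation.mk' ((δ : O n →ₗ[ℂ] O n).baseChange A) fun F G => by
    induction F with
    | zero => simp
    | add F F' hF hF' => simp only [add_mul, map_add, hF, hF', smul_eq_mul]; ring
    | tmul a g =>
      induction G with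
      | zero => simp
      | add G G' hG hG' => simp only [mul_add, map_add, hG, hG', smul_eq_mul]; ring
      | tmul b h =>
        simp only [Algebra.TensorProduct.tmul_mul_tmul, LinearMap.baseChange_tmul, smul_eq_mul,
          Derivation.coeFn_coe, Derivation.leibniz, TensorProduct.tmul_add]
        rw [mul_comm b a]

theorem extendVF_tmul (δ : Derivation ℂ (O n) (O n)) (a : A) (h : O n) :
    extendVF A δ (a ⊗ₜ h) = a ⊗ₜ δ h := rfl

theorem toFibre_extendVF (π : A →ₐ[ℂ] ℂ) (δ : Derivation ℂ (O n) (O n)) (F : A ⊗[ℂ] O n) :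
    toFibre π (extendVF A δ F) = δ (toFibre π F) := by
  induction F with
  | zero => simp
  | add F G hF hG => simp only [map_add, hF, hG]
  | tmul a h => rw [extendVF_tmul, toFibre_tmul, toFibre_tmul, Derivation.map_smul]

theorem comp_extendVF (i : ι) (δ : Derivation ℂ (O n) (O n)) (F : A ⊗[ℂ] O n) :
    S.comp i (extendVF A δ F) = δ (S.comp i F) := by
  induction F with
  | zero => simp
  | add F G hF hG => simp only [map_add, hF, hG]
  | tmul a h => rw [extendVF_tmul, comp_tmul, comp_tmul, Derivation.map_smul]

/-- Relative vector fields are determined by their values on functions on `ℂⁿ`. -/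
theorem _root_.FreeDiv.relative_derivation_ext {Δ Δ' : Derivation A (A ⊗[ℂ] O n) (A ⊗[ℂ] O n)}
    (h : ∀ g : O n, Δ (1 ⊗ₜ g) = Δ' (1 ⊗ₜ g)) : Δ = Δ' := by
  ext F
  induction F with
  | zero => simp
  | add F G hF hG => simp only [map_add, hF, hG]
  | tmul a g =>
    have : a ⊗ₜ[ℂ] g = a • (1 : A) ⊗ₜ[ℂ] g := by
      rw [TensorProduct.smul_tmul', smul_eq_mul, mul_one]
    rw [this, Derivation.map_smul, Derivation.map_smul, h]

/-- The relative vector field `δ + ∑ εᵢ ηᵢ`. -/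
def packVF (δ : Derivation ℂ (O n) (O n)) (η : ι → Derivation ℂ (O n) (O n)) :
    Derivation A (A ⊗[ℂ] O n) (A ⊗[ℂ] O n) :=
  extendVF A δ + ∑ i, (S.e i ⊗ₜ[ℂ] (1 : O n)) • extendVF A (η i)

theorem toFibre_packVF (δ : Derivation ℂ (O n) (O n)) (η : ι → Derivation ℂ (O n) (O n))
    (F : A ⊗[ℂ] O n) : toFibre π (S.packVF δ η F) = δ (toFibre π F) := by
  simp [packVF, derivation_sum_apply, toFibre_extendVF, toFibre_e_tmul]

theorem comp_packVF (δ : Derivation ℂ (O n) (O n)) (η : ι → Derivation ℂ (O n) (O n))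
    (F : A ⊗[ℂ] O n) (i : ι) :
    S.comp i (S.packVF δ η F) = δ (S.comp i F) + η i (toFibre π F) := by
  simp [packVF, derivation_sum_apply, comp_extendVF, toFibre_extendVF, comp_mul, toFibre_e_tmul,
    comp_e_tmul]

theorem packVF_one_tmul (δ : Derivation ℂ (O n) (O n)) (η : ι → Derivation ℂ (O n) (O n))
    (h : O n) : S.packVF δ η (1 ⊗ₜ h) = S.pack (δ h) fun i => η i h :=
  S.ext (by rw [toFibre_packVF, toFibre_pack, toFibre_one_tmul]) fun i => by
    rw [comp_packVF, comp_pack, comp_one_tmul, toFibre_one_tmul, map_zero, zero_add]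

/-- `δ` is the restriction of `Δ` to the fibre. On functions from `ℂⁿ` the difference of `Δ` and `δ`
vanishes along the fibre, so its components obey the ordinary Leibniz rule. -/
theorem exists_packVF (Δ : Derivation A (A ⊗[ℂ] O n) (A ⊗[ℂ] O n)) :
    ∃ (δ : Derivation ℂ (O n) (O n)) (η : ι → Derivation ℂ (O n) (O n)), Δ = S.packVF δ η := by
  have hl : ∀ (Δ : Derivation A (A ⊗[ℂ] O n) (A ⊗[ℂ] O n)) (c : ℂ) (h : O n),
      Δ (1 ⊗ₜ (c • h)) = c • Δ (1 ⊗ₜ h) := fun Δ c h => by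
    rw [TensorProduct.tmul_smul, ← algebraMap_smul A c ((1 : A) ⊗ₜ[ℂ] h), Derivation.map_smul,
      algebraMap_smul]
  have hm : ∀ (Δ : Derivation A (A ⊗[ℂ] O n) (A ⊗[ℂ] O n)) (g h : O n), Δ (1 ⊗ₜ (g * h)) =
      (1 ⊗ₜ g) * Δ (1 ⊗ₜ h) + (1 ⊗ₜ h) * Δ (1 ⊗ₜ g) := fun Δ g h => by
    have : (1 : A) ⊗ₜ[ℂ] (g * h) = (1 ⊗ₜ g) * (1 ⊗ₜ h) := by
      rw [Algebra.TensorProduct.tmul_mul_tmul, one_mul]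
    rw [this, Derivation.leibniz, smul_eq_mul, smul_eq_mul]
  let δ : Derivation ℂ (O n) (O n) := Derivation.mk'
    { toFun := fun h => toFibre π (Δ (1 ⊗ₜ h))
      map_add' := fun g h => by rw [TensorProduct.tmul_add, map_add, map_add]
      map_smul' := fun c h => by rw [hl, map_smul]; rfl }
    fun g h => by
      change toFibre π (Δ (1 ⊗ₜ (g * h))) = g * toFibre π (Δ (1 ⊗ₜ h)) +
        h * toFibre π (Δ (1 ⊗ₜ g))
      rw [hm, map_add, map_mul, map_mul, toFibre_one_tmul, toFibre_one_tmul]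
  have h0 : ∀ h, toFibre π ((Δ - extendVF A δ) (1 ⊗ₜ h)) = 0 := fun h => by
    rw [Derivation.sub_apply, map_sub, toFibre_extendVF, toFibre_one_tmul, sub_eq_zero]
    rfl
  let η : ι → Derivation ℂ (O n) (O n) := fun i => Derivation.mk'
    { toFun := fun h => S.comp i ((Δ - extendVF A δ) (1 ⊗ₜ h))
      map_add' := fun g h => by rw [TensorProduct.tmul_add, map_add, map_add]
      map_smul' := fun c h => by rw [hl, map_smul]; rfl }
    fun g h => by
      change S.comp i ((Δ - extendVF A δ) (1 ⊗ₜ (g * h))) =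
        g * S.comp i ((Δ - extendVF A δ) (1 ⊗ₜ h)) + h * S.comp i ((Δ - extendVF A δ) (1 ⊗ₜ g))
      rw [hm, map_add, comp_mul, comp_mul, toFibre_one_tmul, toFibre_one_tmul, h0, h0, mul_zero,
        mul_zero, add_zero, add_zero]
  refine ⟨δ, η, relative_derivation_ext fun h => ?_⟩
  rw [packVF_one_tmul]
  refine S.ext ?_ fun i => ?_
  · rw [toFibre_pack]; rfl
  · rw [comp_pack]
    change _ = S.comp i ((Δ - extendVF A δ) (1 ⊗ₜ h))
    rw [Derivation.sub_apply, map_sub, comp_extendVF, comp_one_tmul, map_zero, sub_zero]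

theorem restrictsTo_packVF {δ δ' : Derivation ℂ (O n) (O n)}
    {η : ι → Derivation ℂ (O n) (O n)} :
    RestrictsTo π (S.packVF δ η) δ' ↔ δ = δ' := by
  constructor
  · intro h
    ext g
    have := h (1 ⊗ₜ g)
    rwa [toFibre_packVF, toFibre_one_tmul] at this
  · rintro rfl F
    exact S.toFibre_packVF _ _ F

/-! ### Standard deformations -/

/-- The ideal of the hypersurface `f + ∑ εᵢ gᵢ = 0`. -/
def stdIdeal (f : O n) (g : ι → O n) : Ideal (A ⊗[ℂ] O n) := Ideal.span {S.pack f g}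

/-- Compare components in `F = (f + ∑ εᵢ gᵢ)(a + ∑ εᵢ bᵢ)`; the `bᵢ` enter only through `f bᵢ`. This
turns questions about the total space into congruences modulo `J`. -/
theorem mem_stdIdeal (hJ : IsReducedEquation f J) {g : ι → O n} {F : A ⊗[ℂ] O n} :
    F ∈ S.stdIdeal f g ↔ ∃ a, toFibre π F = f * a ∧ ∀ i, S.comp i F - a * g i ∈ J := by
  rw [stdIdeal, Ideal.mem_span_singleton]
  constructor
  · rintro ⟨G, rfl⟩
    refine ⟨toFibre π G, by rw [map_mul, toFibre_pack], fun i => ?_⟩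
    rw [comp_mul, toFibre_pack, comp_pack, mul_comm (g i), add_sub_cancel_right]
    exact J.mul_mem_right _ hJ.mem
  · rintro ⟨a, ha, hb⟩
    choose b hb using fun i => hJ.mem_iff.mp (hb i)
    refine ⟨S.pack a b, S.ext ?_ fun i => ?_⟩
    · rw [map_mul, toFibre_pack, toFibre_pack, ha]
    · rw [comp_mul, toFibre_pack, toFibre_pack, comp_pack, comp_pack, ← hb]; ring

theorem pack_mem_stdIdeal (f : O n) (g : ι → O n) : S.pack f g ∈ S.stdIdeal f g :=
  Ideal.mem_span_singleton_self _

theorem packVF_mem_derLog_iff (hJ : IsReducedEquation f J) {g : ι → O n}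
    {δ : Derivation ℂ (O n) (O n)} {η : ι → Derivation ℂ (O n) (O n)} :
    S.packVF δ η ∈ derLog A (S.stdIdeal f g) ↔
      ∃ α, δ f = α * f ∧ ∀ i, η i f - (α * g i - δ (g i)) ∈ J := by
  have h1 : S.packVF δ η ∈ derLog A (S.stdIdeal f g) ↔
      S.packVF δ η (S.pack f g) ∈ S.stdIdeal f g := by
    refine ⟨fun h => h _ (S.pack_mem_stdIdeal f g), fun h F hF => ?_⟩
    obtain ⟨G, rfl⟩ := Ideal.mem_span_singleton.mp hF
    rw [Derivation.leibniz]
    exact Ideal.add_mem _ (Ideal.mul_mem_right _ _ (S.pack_mem_stdIdeal f g))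
      (Ideal.mul_mem_left _ _ h)
  rw [h1, S.mem_stdIdeal hJ]
  refine exists_congr fun α => ?_
  simp only [toFibre_packVF, comp_packVF, toFibre_pack, comp_pack]
  rw [mul_comm α]
  refine and_congr_right fun _ => forall_congr' fun i => ?_
  rw [show δ (g i) + η i f - α * g i = η i f - (α * g i - δ (g i)) by ring]

/-- A `ℂ`-linear section of `𝒪 → 𝒪 / J` identifies the quotient, as an `A`-module, with `A ⊗ (𝒪 /
J)`. -/
theorem stdIdeal_flat (hJ : IsReducedEquation f J) (g : ι → O n) :
    Module.Flat A ((A ⊗[ℂ] O n) ⧸ S.stdIdeal f g) := by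
  obtain ⟨σ, hσ⟩ := (Ideal.Quotient.mkₐ ℂ J).toLinearMap.exists_rightInverse_of_surjective
    (LinearMap.range_eq_top.mpr (Ideal.Quotient.mkₐ_surjective ℂ J))
  have hσ' : ∀ v, Ideal.Quotient.mk J (σ v) = v := fun v => LinearMap.congr_fun hσ v
  let Θ : A ⊗[ℂ] (O n ⧸ J) →ₗ[A] (A ⊗[ℂ] O n) ⧸ S.stdIdeal f g :=
    (Ideal.Quotient.mkₐ A (S.stdIdeal f g)).toLinearMap.comp (σ.baseChange A)
  have hΘ : ∀ v (u : ι → O n ⧸ J), Θ (1 ⊗ₜ v + ∑ i, S.e i ⊗ₜ u i) =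
      Ideal.Quotient.mk _ (S.pack (σ v) fun i => σ (u i)) := fun v u => by
    change Ideal.Quotient.mk _ (σ.baseChange A _) = _
    simp only [map_add, map_sum, LinearMap.baseChange_tmul, pack]
  have hbij : Function.Bijective Θ := by
    constructor
    · rw [injective_iff_map_eq_zero]
      intro z hz
      obtain ⟨v, u, rfl⟩ := S.exists_eq_add_sum z
      rw [hΘ, Ideal.Quotient.eq_zero_iff_mem, S.mem_stdIdeal hJ] at hz
      obtain ⟨a, ha, hb⟩ := hz
      rw [toFibre_pack] at ha
      have hv : v = 0 := by
        rw [← hσ' v, Ideal.Quotient.eq_zero_iff_mem]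
        exact hJ.mem_iff.mpr ⟨a, ha⟩
      rw [hv, map_zero, eq_comm, mul_eq_zero, or_iff_right hJ.ne_zero] at ha
      subst ha
      have hu : ∀ i, u i = 0 := fun i => by
        rw [← hσ' (u i), Ideal.Quotient.eq_zero_iff_mem]
        simpa [comp_pack] using hb i
      simp [hv, hu]
    · intro z
      obtain ⟨F, rfl⟩ := Ideal.Quotient.mk_surjective z
      set v := Ideal.Quotient.mk J (toFibre π F)
      obtain ⟨a, ha⟩ := hJ.mem_iff.mp (Ideal.Quotient.mk_eq_mk_iff_sub_mem _ _ |>.mp (hσ' v))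
      refine ⟨1 ⊗ₜ v + ∑ i, S.e i ⊗ₜ Ideal.Quotient.mk J (S.comp i F + a * g i), ?_⟩
      rw [hΘ, Ideal.Quotient.mk_eq_mk_iff_sub_mem, S.mem_stdIdeal hJ]
      refine ⟨a, by rw [map_sub, toFibre_pack, ha], fun i => ?_⟩
      rw [map_sub, comp_pack, sub_sub]
      exact (Ideal.Quotient.mk_eq_mk_iff_sub_mem _ _).mp (hσ' _)
  exact Module.Flat.of_linearEquiv (LinearEquiv.ofBijective Θ hbij).symm

theorem e_tmul_mem_maxIdealExt (i : ι) (h : O n) : S.e i ⊗ₜ h ∈ maxIdealExt n π := by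
  have : S.e i ⊗ₜ[ℂ] h = algebraMap A (A ⊗[ℂ] O n) (S.e i) * (1 ⊗ₜ h) := by
    rw [Algebra.TensorProduct.algebraMap_apply, Algebra.TensorProduct.tmul_mul_tmul, one_mul,
      mul_one]
    rfl
  rw [this]
  exact Ideal.mul_mem_right _ _ (Ideal.mem_map_of_mem _ (S.res_e i))

theorem _root_.FreeDiv.maxIdealExt_le_ker (π : A →ₐ[ℂ] ℂ) :
    maxIdealExt n π ≤ RingHom.ker (toFibre (n := n) π) := by
  refine Ideal.map_le_iff_le_comap.mpr fun a ha => ?_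
  rw [Ideal.mem_comap, RingHom.mem_ker, Algebra.TensorProduct.algebraMap_apply, toFibre_tmul]
  rw [RingHom.mem_ker] at ha
  change π a • _ = _
  rw [ha, zero_smul]

/-- The deformation `f + ∑ εᵢ gᵢ = 0` of `f = 0`. -/
def stdDeformation (hJ : IsReducedEquation f J) (g : ι → O n) : Deformation π J where
  ideal := S.stdIdeal f g
  flat := S.stdIdeal_flat hJ g
  emb := Ideal.Quotient.liftₐ (S.stdIdeal f g) ((Ideal.Quotient.mkₐ ℂ J).comp (toFibre π))
    fun F hF => by
      obtain ⟨a, ha, -⟩ := (S.mem_stdIdeal hJ).mp hF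
      change Ideal.Quotient.mk J (toFibre π F) = 0
      rw [Ideal.Quotient.eq_zero_iff_mem]
      exact hJ.mem_iff.mpr ⟨a, ha⟩
  emb_surjective := fun z => by
    obtain ⟨h, rfl⟩ := Ideal.Quotient.mk_surjective z
    refine ⟨Ideal.Quotient.mk _ (1 ⊗ₜ h), ?_⟩
    change Ideal.Quotient.mk J (toFibre π (1 ⊗ₜ h)) = _
    rw [toFibre_one_tmul]
  emb_ker := by
    ext z
    obtain ⟨F, rfl⟩ := Ideal.Quotient.mk_surjective z
    rw [RingHom.mem_ker]
    change Ideal.Quotient.mk J (toFibre π F) = 0 ↔ _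
    rw [Ideal.Quotient.eq_zero_iff_mem, Ideal.mem_map_iff_of_surjective _
      Ideal.Quotient.mk_surjective]
    constructor
    · intro h
      obtain ⟨a, ha⟩ := hJ.mem_iff.mp h
      -- Subtracting `a` times the equation from `F` removes its restriction to the fibre and leaves
      -- this element.
      refine ⟨∑ i, S.e i ⊗ₜ (S.comp i F - a * g i), ?_, ?_⟩
      · exact Ideal.sum_mem _ fun i _ => S.e_tmul_mem_maxIdealExt i _
      · rw [Ideal.Quotient.mk_eq_mk_iff_sub_mem, S.mem_stdIdeal hJ]
        refine ⟨-a, ?_, fun i => ?_⟩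
        · simp [toFibre_e_tmul, ha]
        · simp [comp_e_tmul]
    · rintro ⟨G, hG, hGF⟩
      have hG0 : toFibre π G = 0 := maxIdealExt_le_ker π hG
      rw [Ideal.Quotient.mk_eq_mk_iff_sub_mem, S.mem_stdIdeal hJ] at hGF
      obtain ⟨a, ha, -⟩ := hGF
      rw [map_sub, hG0, zero_sub] at ha
      exact hJ.mem_iff.mpr ⟨-a, by rw [mul_neg, ← ha, neg_neg]⟩

theorem stdDeformation_emb (hJ : IsReducedEquation f J) (g : ι → O n) (F : A ⊗[ℂ] O n) :
    (S.stdDeformation hJ g).emb (Ideal.Quotient.mk _ F) = Ideal.Quotient.mk J (toFibre π F) := rfl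

theorem packVF_zero_eq_sum (η : ι → Derivation ℂ (O n) (O n))
    (θ : ι → ι → Derivation ℂ (O n) (O n)) :
    S.packVF 0 η = ∑ i, (S.e i ⊗ₜ[ℂ] (1 : O n)) • S.packVF (η i) (θ i) := by
  refine relative_derivation_ext fun h => S.ext ?_ fun i => ?_
  · simp [toFibre_packVF, derivation_sum_apply, toFibre_e_tmul]
  · simp [comp_packVF, toFibre_packVF, derivation_sum_apply, toFibre_e_tmul, comp_mul,
      comp_e_tmul, toFibre_one_tmul]

/-- Lifts exist by hypothesis. If a field restricts to zero, its factor satisfies `α f = 0`, so `α =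
0` and its components `ηᵢ` are logarithmic. Lifting these writes it as `∑ εᵢ` times logarithmic
fields, because `εᵢ εⱼ = 0`. -/
theorem stdDeformation_isAdmissible (hJ : IsReducedEquation f J) {g : ι → O n}
    (hg : ∀ i, hJ.Extends (g i)) : (S.stdDeformation hJ g).IsAdmissible := by
  have hlift : ∀ δ ∈ derLog ℂ J, ∃ η, S.packVF δ η ∈ derLog A (S.stdIdeal f g) := by
    intro δ hδ
    obtain ⟨α, hα⟩ := hJ.exists_factor hδ
    choose η hη using fun i => hg i ⟨δ, hδ⟩ α hα
    exact ⟨η, (S.packVF_mem_derLog_iff hJ).mpr ⟨α, hα, hη⟩⟩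
  constructor
  · intro δ hδ
    have : (S.stdDeformation hJ g).ideal.map (toFibre π) = J := by
      change (Ideal.span {S.pack f g}).map (toFibre π) = J
      rw [Ideal.map_span, Set.image_singleton, toFibre_pack, hJ.eq_span]
    rw [this] at hδ
    obtain ⟨η, hη⟩ := hlift δ hδ
    exact ⟨_, hη, S.restrictsTo_packVF.mpr rfl⟩
  · intro Δ hΔ h0
    obtain ⟨δ, η, rfl⟩ := S.exists_packVF Δ
    obtain rfl := S.restrictsTo_packVF.mp h0
    obtain ⟨α, hα, hη⟩ := (S.packVF_mem_derLog_iff hJ).mp hΔ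
    rw [Derivation.zero_apply, eq_comm, mul_eq_zero, or_iff_left hJ.ne_zero] at hα
    subst hα
    have hη' : ∀ i, η i ∈ derLog ℂ J := fun i => hJ.mem_derLog_iff.mpr (by simpa using hη i)
    choose θ hθ using fun i => hlift (η i) (hη' i)
    rw [S.packVF_zero_eq_sum η θ]
    exact Submodule.sum_mem _ fun i _ =>
      Submodule.smul_mem_smul (S.e_tmul_mem_maxIdealExt i 1) (hθ i)

end SquareZeroBasis

/-! ### Linearly admissible standard deformations -/

namespace SquareZeroBasis

variable {A : Type} [CommRing A] [Algebra ℂ A] {π : A →ₐ[ℂ] ℂ} {ι : Type} [Fintype ι]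
  [DecidableEq ι] (S : SquareZeroBasis π ι)

theorem tmul_mem_span {u : O n} (hu : u ∈ Submodule.span ℂ (Set.range (x (n := n)))) (a : A) :
    a ⊗ₜ[ℂ] u ∈ Submodule.span A (Set.range fun l : Fin n => (1 : A) ⊗ₜ[ℂ] (x l : O n)) := by
  induction hu using Submodule.span_induction with
  | mem v hv =>
    obtain ⟨l, rfl⟩ := hv
    have : a ⊗ₜ[ℂ] (x l : O n) = a • (1 : A) ⊗ₜ[ℂ] x l := by
      rw [TensorProduct.smul_tmul', smul_eq_mul, mul_one]
    rw [this]
    exact Submodule.smul_mem _ _ (Submodule.subset_span ⟨l, rfl⟩)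
  | zero => rw [TensorProduct.tmul_zero]; exact Submodule.zero_mem _
  | add u v _ _ hu hv => rw [TensorProduct.tmul_add]; exact Submodule.add_mem _ hu hv
  | smul c u _ hu =>
    rw [TensorProduct.tmul_smul, ← algebraMap_smul A c]
    exact Submodule.smul_mem _ _ hu

/-- The lifts of a basis form a basis, by Nakayama's argument carried out explicitly. Relations
vanish on the fibre and then in each component. A field is corrected first on the fibre, and the
rest is `∑ εᵢ θᵢ` with `θᵢ` logarithmic. -/
theorem stdDeformation_isLinearlyAdmissible (hJ : IsReducedEquation f J) {g : ι → O n}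
    (b : Module.Basis (Fin n) (O n) (derLog ℂ J))
    (hb : ∀ k j, (b k : Derivation ℂ (O n) (O n)) (x j) ∈
      Submodule.span ℂ (Set.range (x (n := n))))
    (hg : ∀ i, hJ.Extends (g i))
    (η : Fin n → ι → Derivation ℂ (O n) (O n))
    (hη : ∀ k, S.packVF (b k) (η k) ∈ derLog A (S.stdIdeal f g))
    (hηx : ∀ k i j, η k i (x j) ∈ Submodule.span ℂ (Set.range (x (n := n)))) :
    (S.stdDeformation hJ g).IsLinearlyAdmissible := by
  refine ⟨S.stdDeformation_isAdmissible hJ hg, ?_⟩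
  let v : Fin n → derLog A (S.stdIdeal f g) := fun k => ⟨S.packVF (b k) (η k), hη k⟩
  have hv : ∀ k, ((v k : derLog A (S.stdIdeal f g)) : Derivation A (A ⊗[ℂ] O n) (A ⊗[ℂ] O n)) =
    S.packVF (b k) (η k) := fun _ => rfl
  have hzero : ∀ c : Fin n → O n, (∀ h, ∑ k, c k * (b k : Derivation ℂ (O n) (O n)) h = 0) →
      ∀ k, c k = 0 := by
    intro c hc
    refine Fintype.linearIndependent_iff.mp b.linearIndependent c (Subtype.ext ?_)
    ext h
    simpa [derivation_sum_apply] using hc h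
  have hli : LinearIndependent (A ⊗[ℂ] O n) v := by
    rw [Fintype.linearIndependent_iffₛ]
    intro F G hFG
    have hFG' : ∀ h : O n, ∑ k, F k * S.packVF (b k) (η k) (1 ⊗ₜ h) =
        ∑ k, G k * S.packVF (b k) (η k) (1 ⊗ₜ h) := fun h => by
      have := congrArg (fun Δ : derLog A (S.stdIdeal f g) =>
        (Δ : Derivation A (A ⊗[ℂ] O n) (A ⊗[ℂ] O n)) (1 ⊗ₜ h)) hFG
      simpa only [Submodule.coe_sum, Submodule.coe_smul, derivation_sum_apply,
        Derivation.smul_apply, smul_eq_mul, hv] using this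
    have h0 : ∀ k, toFibre π (F k) = toFibre π (G k) := fun k => sub_eq_zero.mp (hzero
      (fun k => toFibre π (F k) - toFibre π (G k)) (fun h => by
        have := congrArg (toFibre π) (hFG' h)
        simp only [map_sum, map_mul, toFibre_packVF, toFibre_one_tmul] at this
        simp only [sub_mul, Finset.sum_sub_distrib, this, sub_self]) k)
    have h1 : ∀ i k, S.comp i (F k) = S.comp i (G k) := fun i k => sub_eq_zero.mp (hzero
      (fun k => S.comp i (F k) - S.comp i (G k)) (fun h => by
        have := congrArg (S.comp i) (hFG' h)
        simp only [map_sum, comp_mul, toFibre_packVF, toFibre_one_tmul, h0,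
          Finset.sum_add_distrib, add_right_inj] at this
        simp only [sub_mul, Finset.sum_sub_distrib, this, sub_self]) k)
    exact fun k => S.ext (h0 k) fun i => h1 i k
  have hspan0 : ∀ θ : ι → Derivation ℂ (O n) (O n), (∀ i, θ i ∈ derLog ℂ J) →
      ∃ F : Fin n → A ⊗[ℂ] O n, S.packVF 0 θ = ∑ k, F k • S.packVF (b k) (η k) := by
    intro θ hθ
    refine ⟨fun k => ∑ i, S.e i ⊗ₜ b.repr ⟨θ i, hθ i⟩ k, relative_derivation_ext fun h =>
      S.ext ?_ fun i => ?_⟩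
    · simp [toFibre_packVF, derivation_sum_apply, toFibre_e_tmul]
    · have h2 := congrArg (fun δ : derLog ℂ J => (δ : Derivation ℂ (O n) (O n)) h)
        (b.sum_repr ⟨θ i, hθ i⟩)
      simp only [Submodule.coe_sum, Submodule.coe_smul, derivation_sum_apply,
        Derivation.smul_apply, smul_eq_mul] at h2
      simp only [comp_packVF, toFibre_packVF, derivation_sum_apply, Derivation.smul_apply,
        smul_eq_mul, map_sum, comp_mul, toFibre_one_tmul, toFibre_e_tmul, comp_e_tmul,
        comp_one_tmul, map_zero, zero_add, Finset.sum_const_zero, zero_mul,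
        Finset.sum_ite_eq, Finset.mem_univ, if_true, h2]
  have hspan : ⊤ ≤ Submodule.span (A ⊗[ℂ] O n) (Set.range v) := by
    rintro ⟨Δ, hΔ⟩ -
    obtain ⟨δ, θ, rfl⟩ := S.exists_packVF Δ
    obtain ⟨α, hα, -⟩ := (S.packVF_mem_derLog_iff hJ).mp hΔ
    have hδ : δ ∈ derLog ℂ J := hJ.mem_derLog_iff.mpr (by
      rw [hα]; exact J.mul_mem_left _ hJ.mem)
    obtain ⟨c, hc⟩ : ∃ c : Fin n → O n, ∀ h,
        ∑ k, c k * (b k : Derivation ℂ (O n) (O n)) h = δ h := by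
      refine ⟨fun k => b.repr ⟨δ, hδ⟩ k, fun h => ?_⟩
      have h2 := congrArg (fun δ : derLog ℂ J => (δ : Derivation ℂ (O n) (O n)) h)
        (b.sum_repr ⟨δ, hδ⟩)
      simpa only [Submodule.coe_sum, Submodule.coe_smul, derivation_sum_apply,
        Derivation.smul_apply, smul_eq_mul] using h2
    set Δ₀ : derLog A (S.stdIdeal f g) := ∑ k, ((1 : A) ⊗ₜ[ℂ] c k) • v k with hΔ₀
    have hmem₀ : Δ₀ ∈ Submodule.span (A ⊗[ℂ] O n) (Set.range v) :=
      Submodule.sum_mem _ fun k _ => Submodule.smul_mem _ _ (Submodule.subset_span ⟨k, rfl⟩)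
    obtain ⟨δ', θ', hδθ⟩ := S.exists_packVF ((⟨S.packVF δ θ, hΔ⟩ - Δ₀ : derLog A (S.stdIdeal f g)) :
      Derivation A (A ⊗[ℂ] O n) (A ⊗[ℂ] O n))
    have hd0 : δ' = 0 := by
      ext h
      have h3 := congrArg (toFibre π) (congrArg (fun Δ => Δ ((1 : A) ⊗ₜ[ℂ] h)) hδθ)
      simp only [toFibre_packVF, toFibre_one_tmul] at h3
      rw [← h3, hΔ₀, Submodule.coe_sub, Submodule.coe_sum]
      simp only [Derivation.sub_apply, derivation_sum_apply, Submodule.coe_smul,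
        Derivation.smul_apply, hv, smul_eq_mul, map_sub, map_sum, map_mul, toFibre_packVF,
        toFibre_one_tmul, hc, sub_self, Derivation.zero_apply]
    subst hd0
    have hΔ' := (⟨S.packVF δ θ, hΔ⟩ - Δ₀ : derLog A (S.stdIdeal f g)).2
    rw [hδθ] at hΔ'
    obtain ⟨α', hα', hθ'⟩ := (S.packVF_mem_derLog_iff hJ).mp hΔ'
    rw [Derivation.zero_apply, eq_comm, mul_eq_zero, or_iff_left hJ.ne_zero] at hα'
    subst hα'
    obtain ⟨F, hF⟩ := hspan0 θ' fun i => hJ.mem_derLog_iff.mpr (by simpa using hθ' i)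
    have hsub : (⟨S.packVF δ θ, hΔ⟩ - Δ₀ : derLog A (S.stdIdeal f g)) = ∑ k, F k • v k := by
      apply Subtype.ext
      rw [hδθ, hF, Submodule.coe_sum]
      rfl
    rw [← sub_add_cancel (⟨S.packVF δ θ, hΔ⟩ : derLog A (S.stdIdeal f g)) Δ₀, hsub]
    exact Submodule.add_mem _ (Submodule.sum_mem _ fun k _ =>
      Submodule.smul_mem _ _ (Submodule.subset_span ⟨k, rfl⟩)) hmem₀
  refine ⟨Module.Basis.mk hli hspan, fun k j => ?_⟩
  have hk : (Module.Basis.mk hli hspan) k = v k := Module.Basis.mk_apply hli hspan k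
  change (((Module.Basis.mk hli hspan) k : derLog A (S.stdIdeal f g)) :
    Derivation A (A ⊗[ℂ] O n) (A ⊗[ℂ] O n)) (1 ⊗ₜ x j) ∈ _
  rw [hk, hv, packVF_one_tmul, pack]
  exact Submodule.add_mem _ (tmul_mem_span (hb k j) 1)
    (Submodule.sum_mem _ fun i _ => tmul_mem_span (hηx k i j) _)

end SquareZeroBasis

/-! ### Dual numbers -/

/-- The basis `ε` of the maximal ideal of `ℂ[ε]`. -/
def epsBasis : SquareZeroBasis resEps Unit where
  e _ := eps
  co _ := TrivSqZeroExt.sndHom ℂ ℂ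
  eq_sum a := by
    refine TrivSqZeroExt.ext ?_ ?_
    · change a.fst = a.fst * 1 + (∑ _i : Unit, a.snd • (0 : ℂ))
      simp
    · change a.snd = a.fst • (0 : ℂ) + (∑ _i : Unit, a.snd • (1 : ℂ))
      simp
  co_one _ := rfl
  co_e _ _ := rfl
  res_e _ := rfl
  mul_e _ _ := DualNumber.eps_mul_eps

/-- The basis `ε₁, ε₂` of the maximal ideal of `ℂ[ε₁, ε₂] / (ε₁, ε₂)²`. -/
def eps2Basis : SquareZeroBasis resEps2 Bool where
  e i := TrivSqZeroExt.inr (cond i (1, 0) (0, 1))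
  co i := (cond i (LinearMap.fst ℂ ℂ ℂ) (LinearMap.snd ℂ ℂ ℂ)).comp
    (TrivSqZeroExt.sndHom ℂ (ℂ × ℂ))
  eq_sum a := by
    rw [Fintype.sum_bool]
    refine TrivSqZeroExt.ext ?_ ?_
    · change a.fst = a.fst * 1 + (a.snd.1 * 0 + a.snd.2 * 0)
      simp
    · change a.snd = a.fst • (0 : ℂ × ℂ) + (a.snd.1 • ((1, 0) : ℂ × ℂ) + a.snd.2 • ((0, 1) : ℂ × ℂ))
      ext <;> simp
  co_one i := by cases i <;> rfl
  co_e i j := by cases i <;> cases j <;> rfl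
  res_e _ := rfl
  mul_e _ _ := TrivSqZeroExt.inr_mul_inr _ _ _

theorem epsMap_e (a b : ℂ) (i : Bool) : epsMap a b (eps2Basis.e i) = cond i a b • eps := by
  change TrivSqZeroExt.map _ (TrivSqZeroExt.inr _) = _
  rw [TrivSqZeroExt.map_inr]
  refine TrivSqZeroExt.ext ?_ ?_
  · change (0 : ℂ) = _ * 0
    simp
  · cases i
    · change a * 0 + b * 1 = b * 1
      simp
    · change a * 1 + b * 0 = a * 1
      simp

theorem resEps_epsMap (a b : ℂ) (z : Eps2) : resEps (epsMap a b z) = resEps2 z :=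
  TrivSqZeroExt.fst_map (a • LinearMap.fst ℂ ℂ ℂ + b • LinearMap.snd ℂ ℂ ℂ) z

theorem toFibre_map_epsMap (a b : ℂ) (F : Eps2 ⊗[ℂ] O n) :
    toFibre resEps (Algebra.TensorProduct.map (epsMap a b) (AlgHom.id ℂ (O n)) F) =
      toFibre resEps2 F := by
  induction F with
  | zero => simp
  | add F G hF hG => simp only [map_add, hF, hG]
  | tmul z h =>
    rw [Algebra.TensorProduct.map_tmul, SquareZeroBasis.toFibre_tmul,
      SquareZeroBasis.toFibre_tmul, resEps_epsMap]
    rfl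

theorem map_epsMap_pack (a b : ℂ) (f : O n) (g : Bool → O n) :
    Algebra.TensorProduct.map (epsMap a b) (AlgHom.id ℂ (O n)) (eps2Basis.pack f g) =
      epsBasis.pack f fun _ => a • g true + b • g false := by
  simp only [SquareZeroBasis.pack, Fintype.sum_bool, map_add, Algebra.TensorProduct.map_tmul,
    epsMap_e, map_one, AlgHom.id_apply, Finset.univ_unique, Finset.sum_singleton,
    TensorProduct.tmul_add, TensorProduct.tmul_smul, TensorProduct.smul_tmul', cond_true,
    cond_false]
  rfl

theorem isBaseChange_stdDeformation (hJ : IsReducedEquation f J) (a b : ℂ) (g : Bool → O n) :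
    IsBaseChange (epsMap a b) (eps2Basis.stdDeformation hJ g)
      (epsBasis.stdDeformation hJ fun _ => a • g true + b • g false) := by
  constructor
  · change epsBasis.stdIdeal f _ = (eps2Basis.stdIdeal f g).map _
    rw [SquareZeroBasis.stdIdeal, SquareZeroBasis.stdIdeal, Ideal.map_span, Set.image_singleton,
      map_epsMap_pack]
  · intro F
    rw [SquareZeroBasis.stdDeformation_emb, SquareZeroBasis.stdDeformation_emb,
      toFibre_map_epsMap]

/-! ### Homomorphisms into the local ring of a hypersurface -/

theorem IsReducedEquation.le_maxId (hJ : IsReducedEquation f J) : J ≤ maxId n := fun h hh =>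
  mem_maxId (by
    by_contra h0
    exact hJ.ne_top (Ideal.eq_top_of_isUnit_mem _ hh (isUnit_of_germCoeff_zero_ne h0)))

theorem IsReducedEquation.not_isUnit_mk (hJ : IsReducedEquation f J) {h : O n}
    (hh : h ∈ maxId n) : ¬ IsUnit (Ideal.Quotient.mk J h) := by
  intro hu
  obtain ⟨v, hv⟩ := hu.exists_right_inv
  obtain ⟨v, rfl⟩ := Ideal.Quotient.mk_surjective v
  rw [← map_mul, ← map_one (Ideal.Quotient.mk J), Ideal.Quotient.mk_eq_mk_iff_sub_mem] at hv
  refine maxId_ne_top (n := n) ((Ideal.eq_top_iff_one _).mpr ?_)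
  have := (maxId n).sub_mem ((maxId n).mul_mem_right v hh) (hJ.le_maxId hv)
  rwa [sub_sub_cancel] at this

theorem sub_germCoeff_mem_maxId (h : O n) : h - algebraMap ℂ (O n) (germCoeff 0 h) ∈ maxId n :=
  mem_maxId (by
    rw [Algebra.algebraMap_eq_smul_one, map_sub, map_smul, germCoeff_one, if_pos rfl, smul_eq_mul,
      mul_one, sub_self])

/-- Every algebra homomorphism is local: if `φ (x i)` had constant term `c ≠ 0`, the unit `x i - c`
would go to a non-unit. -/
theorem IsReducedEquation.map_x_mem (hJ : IsReducedEquation f J) (φ : O n →ₐ[ℂ] O n ⧸ J)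
    (i : Fin n) : φ (x i) ∈ (maxId n).map (Ideal.Quotient.mk J) := by
  obtain ⟨u, hu⟩ := Ideal.Quotient.mk_surjective (φ (x i))
  rw [← hu]
  refine Ideal.mem_map_of_mem _ (mem_maxId ?_)
  by_contra hc
  have h1 : IsUnit (x i - algebraMap ℂ (O n) (germCoeff 0 u)) := isUnit_of_germCoeff_zero_ne (by
    have hx : germCoeff 0 (x i : O n) = 0 :=
      germCoeff_zero_eq_zero_of_mem (Ideal.subset_span ⟨i, rfl⟩)
    rw [map_sub, hx, Algebra.algebraMap_eq_smul_one, map_smul, germCoeff_one, if_pos rfl]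
    simpa using hc)
  have h2 := h1.map φ
  rw [map_sub, ← hu, AlgHom.commutes] at h2
  exact hJ.not_isUnit_mk (sub_germCoeff_mem_maxId u) (by rw [map_sub]; exact h2)

/-- Maps into `𝒪 / J` satisfying a twisted Leibniz rule are determined on the coordinates. -/
theorem IsReducedEquation.eq_zero_of_twisted_leibniz (hJ : IsReducedEquation f J)
    (φ ψ : O n →ₐ[ℂ] O n ⧸ J) (E : O n →ₗ[ℂ] O n ⧸ J)
    (hE : ∀ a b, E (a * b) = φ a * E b + E a * ψ b) (h1 : E 1 = 0) (hx : ∀ i, E (x i) = 0) :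
    E = 0 := by
  refine FreeDiv.eq_zero_of_twisted_leibniz ((maxId n).map (Ideal.Quotient.mk J))
    (fun q hq => ?_) φ ψ (hJ.map_x_mem φ) E hE h1 hx
  -- `𝒪 / J` is `𝔪`-adically separated because principal ideals are closed.
  obtain ⟨h, rfl⟩ := Ideal.Quotient.mk_surjective q
  rw [Ideal.Quotient.eq_zero_iff_mem, hJ.eq_span]
  refine mem_span_of_forall_mem_sup_pow fun M => ?_
  have hM := hq M
  rw [← Ideal.map_pow] at hM
  obtain ⟨t, ht, hth⟩ := (Ideal.mem_map_iff_of_surjective _ Ideal.Quotient.mk_surjective).mp hM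
  rw [eq_comm, Ideal.Quotient.mk_eq_mk_iff_sub_mem, hJ.eq_span] at hth
  exact Submodule.mem_sup.mpr ⟨h - t, hth, t, ht, sub_add_cancel _ _⟩

/-- The derivation of a quotient ring induced by a derivation preserving the ideal. -/
def quotDerivation {R B : Type*} [CommRing R] [CommRing B] [Algebra R B] {I : Ideal B}
    {Δ : Derivation R B B} (hΔ : Δ ∈ derLog R I) : Derivation R (B ⧸ I) (B ⧸ I) :=
  have key : ∀ F : B, Ideal.Quotient.mk I (Δ (Quotient.out (Ideal.Quotient.mk I F))) =
      Ideal.Quotient.mk I (Δ F) := fun F => by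
    rw [Ideal.Quotient.mk_eq_mk_iff_sub_mem, ← map_sub]
    exact hΔ _ ((Ideal.Quotient.mk_eq_mk_iff_sub_mem _ _).mp (Ideal.Quotient.mk_out _))
  Derivation.mk'
    { toFun := fun z => Ideal.Quotient.mk I (Δ (Quotient.out z))
      map_add' := fun y z => by
        obtain ⟨F, rfl⟩ := Ideal.Quotient.mk_surjective y
        obtain ⟨G, rfl⟩ := Ideal.Quotient.mk_surjective z
        rw [← map_add, key, key, key, map_add, map_add]
      map_smul' := fun c z => by
        obtain ⟨F, rfl⟩ := Ideal.Quotient.mk_surjective z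
        have hc : c • Ideal.Quotient.mk I F = Ideal.Quotient.mk I (c • F) := rfl
        rw [hc, key, key, Derivation.map_smul]
        rfl }
    fun y z => by
      obtain ⟨F, rfl⟩ := Ideal.Quotient.mk_surjective y
      obtain ⟨G, rfl⟩ := Ideal.Quotient.mk_surjective z
      change Ideal.Quotient.mk I (Δ (Quotient.out (Ideal.Quotient.mk I F * Ideal.Quotient.mk I G)))
        = Ideal.Quotient.mk I F * Ideal.Quotient.mk I (Δ (Quotient.out (Ideal.Quotient.mk I G))) +
          Ideal.Quotient.mk I G * Ideal.Quotient.mk I (Δ (Quotient.out (Ideal.Quotient.mk I F)))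
      rw [← map_mul, key, key, key, Derivation.leibniz, ← map_mul, ← map_mul, ← map_add]
      rfl

theorem quotDerivation_mk {R B : Type*} [CommRing R] [CommRing B] [Algebra R B] {I : Ideal B}
    {Δ : Derivation R B B} (hΔ : Δ ∈ derLog R I) (F : B) :
    quotDerivation hΔ (Ideal.Quotient.mk I F) = Ideal.Quotient.mk I (Δ F) := by
  change Ideal.Quotient.mk I (Δ (Quotient.out (Ideal.Quotient.mk I F))) = _
  rw [Ideal.Quotient.mk_eq_mk_iff_sub_mem, ← map_sub]
  exact hΔ _ ((Ideal.Quotient.mk_eq_mk_iff_sub_mem _ _).mp (Ideal.Quotient.mk_out _))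

/-! ### Parametrisations of deformations -/

section Parametrisation

variable {A : Type} [CommRing A] [Algebra ℂ A] {π : A →ₐ[ℂ] ℂ} {ι : Type} [Fintype ι]
  [DecidableEq ι]

/-- The local ring of the total space. -/
abbrev Deformation.Ring (X : Deformation π J) : Type := (A ⊗[ℂ] O n) ⧸ X.ideal

/-- A lift of the projection `𝒪 → 𝒪_D` to the local ring of the total space. -/
def Deformation.IsLift (X : Deformation π J) (s : O n →ₐ[ℂ] X.Ring) : Prop :=
  ∀ h, X.emb (s h) = Ideal.Quotient.mk J h

/-- The restriction to `D` of functions on the ambient space of the central fibre. -/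
def Deformation.fibreEmb (X : Deformation π J) : O n →ₐ[ℂ] O n ⧸ J :=
  X.emb.comp ((Ideal.Quotient.mkₐ ℂ X.ideal).comp Algebra.TensorProduct.includeRight)

theorem Deformation.fibreEmb_apply (X : Deformation π J) (h : O n) :
    X.fibreEmb h = X.emb (Ideal.Quotient.mk X.ideal (1 ⊗ₜ h)) := rfl

theorem Deformation.emb_eq_zero (X : Deformation π J) {G : A ⊗[ℂ] O n}
    (hG : G ∈ maxIdealExt n π) : X.emb (Ideal.Quotient.mk X.ideal G) = 0 := by
  have : Ideal.Quotient.mk X.ideal G ∈ RingHom.ker X.emb := by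
    rw [X.emb_ker]; exact Ideal.mem_map_of_mem _ hG
  exact this

theorem Deformation.exists_of_emb_eq_zero (X : Deformation π J) {z : X.Ring} (hz : X.emb z = 0) :
    ∃ G ∈ maxIdealExt n π, Ideal.Quotient.mk X.ideal G = z := by
  have : z ∈ RingHom.ker X.emb := hz
  rw [X.emb_ker, Ideal.mem_map_iff_of_surjective _ Ideal.Quotient.mk_surjective] at this
  exact this

variable (S : SquareZeroBasis π ι)
include S

theorem SquareZeroBasis.sub_one_tmul_mem (F : A ⊗[ℂ] O n) :
    F - 1 ⊗ₜ toFibre π F ∈ maxIdealExt n π := by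
  obtain ⟨h, u, rfl⟩ : ∃ h u, F = S.pack h u := ⟨_, _, S.pack_eta F⟩
  rw [S.toFibre_pack, SquareZeroBasis.pack, add_sub_cancel_left]
  exact Ideal.sum_mem _ fun i _ => S.e_tmul_mem_maxIdealExt i _

theorem SquareZeroBasis.emb_mk (X : Deformation π J) (F : A ⊗[ℂ] O n) :
    X.emb (Ideal.Quotient.mk X.ideal F) = X.fibreEmb (toFibre π F) := by
  rw [X.fibreEmb_apply, ← sub_eq_zero, ← map_sub, ← map_sub]
  exact X.emb_eq_zero (S.sub_one_tmul_mem F)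

theorem SquareZeroBasis.fibreEmb_surjective (X : Deformation π J) :
    Function.Surjective X.fibreEmb := fun z => by
  obtain ⟨y, rfl⟩ := X.emb_surjective z
  obtain ⟨F, rfl⟩ := Ideal.Quotient.mk_surjective y
  exact ⟨toFibre π F, (S.emb_mk X F).symm⟩

/-- The coordinates of `D` are lifted to functions `ρ i` on the ambient space of the central fibre.
They vanish at the origin, so they can be substituted. The composite agrees with the projection on
coordinates, hence everywhere. -/
theorem SquareZeroBasis.exists_isLift (hJ : IsReducedEquation f J) (X : Deformation π J) :
    ∃ s : O n →ₐ[ℂ] X.Ring, X.IsLift s := by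
  choose ρ hρ using fun i : Fin n => S.fibreEmb_surjective X (Ideal.Quotient.mk J (x i))
  have hρ0 : ∀ i, germCoeff 0 (ρ i) = 0 := fun i => by
    by_contra h0
    have := (isUnit_of_germCoeff_zero_ne h0).map X.fibreEmb
    rw [hρ] at this
    exact hJ.not_isUnit_mk (Ideal.subset_span ⟨i, rfl⟩) this
  obtain ⟨σ, hσ⟩ := exists_substitution ρ hρ0
  refine ⟨((Ideal.Quotient.mkₐ ℂ X.ideal).comp Algebra.TensorProduct.includeRight).comp σ, ?_⟩
  have h := hJ.eq_zero_of_twisted_leibniz (X.fibreEmb.comp σ) (Ideal.Quotient.mkₐ ℂ J)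
    ((X.fibreEmb.comp σ).toLinearMap - (Ideal.Quotient.mkₐ ℂ J).toLinearMap)
    (fun a b => by
      simp only [LinearMap.sub_apply, AlgHom.toLinearMap_apply, map_mul]; ring)
    (by simp) (fun i => by
      simp only [LinearMap.sub_apply, AlgHom.toLinearMap_apply, AlgHom.comp_apply, hσ, hρ]
      exact sub_self _)
  intro a
  exact sub_eq_zero.mp (LinearMap.congr_fun h a)

/-- The maximal ideal has square zero, so a multiple of `εᵢ` depends only on restrictions to `D`. -/
theorem SquareZeroBasis.e_smul_eq (X : Deformation π J) (i : ι) {y z : X.Ring}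
    (h : X.emb y = X.emb z) : S.e i • y = S.e i • z := by
  rw [← sub_eq_zero, ← smul_sub]
  obtain ⟨G, hG, hGz⟩ := X.exists_of_emb_eq_zero (z := y - z) (by rw [map_sub, h, sub_self])
  rw [← hGz]
  have : S.e i • Ideal.Quotient.mk X.ideal G = Ideal.Quotient.mk X.ideal (S.e i • G) := rfl
  rw [this]
  have h0 : S.e i • G = 0 := by
    have h2 : toFibre π G = 0 := maxIdealExt_le_ker π hG
    have hmul : S.e i • G = (S.e i ⊗ₜ[ℂ] (1 : O n)) * G := by
      rw [Algebra.smul_def, Algebra.TensorProduct.algebraMap_apply]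
      rfl
    rw [hmul]
    refine S.ext ?_ fun j => ?_
    · rw [map_mul, S.toFibre_e_tmul, zero_mul, map_zero]
    · rw [S.comp_mul, S.toFibre_e_tmul, h2, zero_mul, mul_zero, add_zero, map_zero]
  rw [h0, map_zero]

theorem SquareZeroBasis.emb_e_smul (X : Deformation π J) (i : ι) (z : X.Ring) :
    X.emb (S.e i • z) = 0 := by
  obtain ⟨F, rfl⟩ := Ideal.Quotient.mk_surjective z
  have : S.e i • Ideal.Quotient.mk X.ideal F = Ideal.Quotient.mk X.ideal (S.e i • F) := rfl
  rw [this, S.emb_mk]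
  have h0 : toFibre π (S.e i • F) = 0 := by
    rw [Algebra.smul_def, map_mul, Algebra.TensorProduct.algebraMap_apply]
    change toFibre π (S.e i ⊗ₜ 1) * _ = 0
    rw [S.toFibre_e_tmul, zero_mul]
  rw [h0, map_zero]

theorem SquareZeroBasis.exists_eq_sum_smul {X : Deformation π J} {s : O n →ₐ[ℂ] X.Ring}
    (hs : X.IsLift s) {z : X.Ring} (hz : X.emb z = 0) :
    ∃ u : ι → O n, z = ∑ i, S.e i • s (u i) := by
  obtain ⟨G, hG, rfl⟩ := X.exists_of_emb_eq_zero hz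
  have h0 : toFibre π G = 0 := maxIdealExt_le_ker π hG
  choose u hu using fun i => Ideal.Quotient.mk_surjective
    (X.emb (Ideal.Quotient.mk X.ideal (1 ⊗ₜ S.comp i G)))
  refine ⟨u, ?_⟩
  conv_lhs => rw [S.pack_eta G, h0, SquareZeroBasis.pack, TensorProduct.tmul_zero, zero_add,
    map_sum]
  refine Finset.sum_congr rfl fun i _ => ?_
  have : Ideal.Quotient.mk X.ideal (S.e i ⊗ₜ S.comp i G) =
      S.e i • Ideal.Quotient.mk X.ideal (1 ⊗ₜ S.comp i G) := by
    have h1 : S.e i ⊗ₜ[ℂ] S.comp i G = S.e i • (1 : A) ⊗ₜ[ℂ] S.comp i G := by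
      rw [TensorProduct.smul_tmul', smul_eq_mul, mul_one]
    rw [h1]; rfl
  rw [this]
  exact S.e_smul_eq X i (by rw [hs, hu])

end Parametrisation

/-! ### Equations of first order deformations -/

/-- `f + ε g` is an equation of the deformation `X`, in a suitable parametrisation. -/
def Deformation.HasEquation (X : Deformation resEps J) (f g : O n) : Prop :=
  ∃ s : O n →ₐ[ℂ] X.Ring, X.IsLift s ∧ s f + eps • s g = 0

theorem eps_smul_congr (X : Deformation resEps J) {y z : X.Ring} (h : X.emb y = X.emb z) :
    eps • y = eps • z := epsBasis.e_smul_eq X () h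

theorem emb_eps_smul (X : Deformation resEps J) (z : X.Ring) : X.emb (eps • z) = 0 :=
  epsBasis.emb_e_smul X () z

theorem eps_smul_eps_smul (X : Deformation resEps J) (z : X.Ring) :
    eps • eps • z = 0 := by
  rw [smul_smul, show eps * eps = 0 from DualNumber.eps_mul_eps, zero_smul]

theorem eq_eps_smul {X : Deformation resEps J} {s : O n →ₐ[ℂ] X.Ring} {g : O n}
    (h : s f + eps • s g = 0) : s f = eps • s (-g) := by
  rw [map_neg, smul_neg]
  exact eq_neg_of_add_eq_zero_left h

theorem exists_eps_smul {X : Deformation resEps J} {s : O n →ₐ[ℂ] X.Ring} (hs : X.IsLift s)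
    {z : X.Ring} (hz : X.emb z = 0) : ∃ u, z = eps • s u := by
  obtain ⟨u, hu⟩ := epsBasis.exists_eq_sum_smul hs hz
  exact ⟨u (), by rw [hu]; simp; rfl⟩

/-- Flatness over the dual numbers. -/
theorem emb_eq_zero_of_eps_smul (X : Deformation resEps J) {z : X.Ring} (hz : eps • z = 0) :
    X.emb z = 0 := by
  have := X.flat
  -- The equational criterion for the relation `ε z = 0` makes `z` a combination with coefficients
  -- annihilated by `ε`, and these are multiples of `ε`.
  obtain ⟨k, a, y, hzy, ha⟩ := Module.Flat.isTrivialRelation_of_sum_smul_eq_zero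
    (R := Eps) (M := X.Ring) (ι := Unit) (f := fun _ => eps) (x := fun _ => z) (by simpa using hz)
  have hzy' : z = ∑ j, a () j • y j := hzy ()
  rw [hzy', map_sum]
  refine Finset.sum_eq_zero fun j _ => ?_
  have h1 : eps * a () j = 0 := by simpa using ha j
  have h2 : a () j = (a () j).snd • eps := by
    have h3 : (a () j).fst = 0 := by
      have := congrArg TrivSqZeroExt.snd h1
      change (0 : ℂ) * (a () j).snd + (1 : ℂ) * (a () j).fst = 0 at this
      simpa using this
    refine TrivSqZeroExt.ext ?_ ?_
    · change (a () j).fst = (a () j).snd * 0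
      rw [h3, mul_zero]
    · change (a () j).snd = (a () j).snd * 1
      rw [mul_one]
  rw [h2, smul_assoc, map_smul, emb_eps_smul, smul_zero]

/-- An infinitesimal difference is given by a vector field. -/
theorem IsReducedEquation.exists_derivation (hJ : IsReducedEquation f J)
    {X : Deformation resEps J} {s t : O n →ₐ[ℂ] X.Ring} (hs : X.IsLift s) (ht : X.IsLift t)
    (E : O n →ₗ[ℂ] X.Ring) (hE : ∀ h, X.emb (E h) = 0)
    (hmul : ∀ a b, E (a * b) = s a * E b + E a * t b) :
    ∃ η : Derivation ℂ (O n) (O n), ∀ h, E h = eps • s (η h) := by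
  choose w hw using fun h => exists_eps_smul hs (hE h)
  have huniq : ∀ u v, eps • s u = eps • s v → Ideal.Quotient.mk J u = Ideal.Quotient.mk J v := by
    intro u v huv
    rw [← hs, ← hs, ← sub_eq_zero, ← map_sub]
    exact emb_eq_zero_of_eps_smul X (by rw [smul_sub, huv, sub_self])
  have hcongr : ∀ u v, Ideal.Quotient.mk J u = Ideal.Quotient.mk J v → eps • s u = eps • s v :=
    fun u v huv => eps_smul_congr X (by rw [hs, hs, huv])
  have hcomm : ∀ (c : ℂ) (z : X.Ring), eps • c • z = c • eps • z := fun c z => smul_comm _ _ _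
  -- By flatness `E` can be divided by `ε`, uniquely modulo `J`. The quotient is a derivation `𝒪 → 𝒪
  -- / J`, and lifting its values on coordinates gives the vector field.
  let D : O n →ₗ[ℂ] O n ⧸ J :=
    { toFun := fun h => Ideal.Quotient.mk J (w h)
      map_add' := fun a b => by
        rw [← map_add]
        exact huniq _ _ (by rw [← hw, map_add, map_add, smul_add, ← hw, ← hw])
      map_smul' := fun c a => by
        have : c • Ideal.Quotient.mk J (w a) = Ideal.Quotient.mk J (c • w a) := rfl
        rw [RingHom.id_apply, this]
        exact huniq _ _ (by rw [← hw, map_smul, map_smul, hcomm, ← hw]) }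
  have hDmul : ∀ a b, D (a * b) = Ideal.Quotient.mk J a * D b + D a * Ideal.Quotient.mk J b := by
    intro a b
    change Ideal.Quotient.mk J (w (a * b)) = Ideal.Quotient.mk J a * Ideal.Quotient.mk J (w b) +
      Ideal.Quotient.mk J (w a) * Ideal.Quotient.mk J b
    rw [← map_mul, ← map_mul, ← map_add]
    refine huniq _ _ ?_
    have h1 : eps • (s (w a) * t b) = eps • s (w a * b) :=
      eps_smul_congr X (by rw [map_mul, hs, ht, ← map_mul, hs])
    rw [← hw, hmul, hw a, hw b, map_add, smul_add, smul_mul_assoc, h1, mul_smul_comm, map_mul, map_mul]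
  choose c hc using fun i : Fin n => Ideal.Quotient.mk_surjective (D (x i))
  have hD1 : D 1 = 0 := by
    have := hDmul 1 1
    simp only [mul_one, map_one, one_mul] at this
    exact left_eq_add.mp this
  have key := hJ.eq_zero_of_twisted_leibniz (Ideal.Quotient.mkₐ ℂ J) (Ideal.Quotient.mkₐ ℂ J)
    (D - (Ideal.Quotient.mkₐ ℂ J).toLinearMap.comp (vectorField c : O n →ₗ[ℂ] O n))
    (fun a b => by
      change D (a * b) - Ideal.Quotient.mk J (vectorField c (a * b)) =
        Ideal.Quotient.mk J a * (D b - Ideal.Quotient.mk J (vectorField c b)) +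
        (D a - Ideal.Quotient.mk J (vectorField c a)) * Ideal.Quotient.mk J b
      rw [hDmul, Derivation.leibniz, map_add, smul_eq_mul, smul_eq_mul, map_mul, map_mul]
      ring)
    (by
      change D 1 - Ideal.Quotient.mk J (vectorField c 1) = 0
      rw [hD1, Derivation.map_one_eq_zero, map_zero, sub_zero])
    (fun i => by
      change D (x i) - Ideal.Quotient.mk J (vectorField c (x i)) = 0
      rw [vectorField_x, hc, sub_self])
  refine ⟨vectorField c, fun h => ?_⟩
  rw [hw h]
  exact hcongr _ _ (sub_eq_zero.mp (LinearMap.congr_fun key h))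

theorem IsReducedEquation.exists_hasEquation (hJ : IsReducedEquation f J)
    (X : Deformation resEps J) : ∃ g, X.HasEquation f g := by
  obtain ⟨s, hs⟩ := epsBasis.exists_isLift hJ X
  obtain ⟨u, hu⟩ := exists_eps_smul hs (z := s f) (by
    rw [hs, Ideal.Quotient.eq_zero_iff_mem]; exact hJ.mem)
  exact ⟨-u, s, hs, by rw [hu, map_neg, smul_neg, add_neg_cancel]⟩

theorem IsReducedEquation.mem_of_eps_smul (_hJ : IsReducedEquation f J) {X : Deformation resEps J}
    {s : O n →ₐ[ℂ] X.Ring} (hs : X.IsLift s) {u : O n} (hu : eps • s u = 0) : u ∈ J := by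
  rw [← Ideal.Quotient.eq_zero_iff_mem, ← hs]
  exact emb_eq_zero_of_eps_smul X hu

theorem IsReducedEquation.eps_smul_of_mem (_hJ : IsReducedEquation f J) {X : Deformation resEps J}
    {s : O n →ₐ[ℂ] X.Ring} (hs : X.IsLift s) {u : O n} (hu : u ∈ J) : eps • s u = 0 := by
  rw [eps_smul_congr X (z := 0), smul_zero]
  rw [hs, map_zero, Ideal.Quotient.eq_zero_iff_mem]
  exact hu

/-- Two parametrisations `s`, `t` agree on `D`, so they differ by `ε` times a vector field `η`.
Comparing `s f` with `t f` gives the change of equation. -/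
theorem IsReducedEquation.hasEquation_sub (hJ : IsReducedEquation f J) {X : Deformation resEps J}
    {g g' : O n} (h : X.HasEquation f g) (h' : X.HasEquation f g') :
    ∃ η : Derivation ℂ (O n) (O n), g' - g - η f ∈ J := by
  obtain ⟨s, hs, hsg⟩ := h
  obtain ⟨t, ht, htg⟩ := h'
  obtain ⟨η, hη⟩ := hJ.exists_derivation hs ht (s.toLinearMap - t.toLinearMap)
    (fun h => by
      rw [LinearMap.sub_apply, AlgHom.toLinearMap_apply, AlgHom.toLinearMap_apply, map_sub, hs, ht,
        sub_self])
    (fun a b => by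
      simp only [LinearMap.sub_apply, AlgHom.toLinearMap_apply, map_mul]; ring)
  refine ⟨η, hJ.mem_of_eps_smul hs ?_⟩
  have h1 : s f - t f = eps • s (η f) := hη f
  have h2 : eps • t g' = eps • s g' := eps_smul_congr X (by rw [hs, ht])
  rw [map_sub, map_sub, smul_sub, smul_sub, ← h1, ← h2, eq_neg_of_add_eq_zero_left hsg,
    eq_neg_of_add_eq_zero_left htg]
  abel

/-- The new parametrisation is `s - ε s ∘ η`, which is multiplicative since `ε² = 0`. -/
theorem IsReducedEquation.HasEquation.congr (hJ : IsReducedEquation f J)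
    {X : Deformation resEps J} {g g' : O n} (h : X.HasEquation f g)
    (η : Derivation ℂ (O n) (O n)) (hη : g' - g - η f ∈ J) : X.HasEquation f g' := by
  obtain ⟨s, hs, hsg⟩ := h
  let t : O n →ₐ[ℂ] X.Ring := AlgHom.ofLinearMap
    { toFun := fun h => s h - eps • s (η h)
      map_add' := fun a b => by simp only [map_add, smul_add]; abel
      map_smul' := fun c a => by
        rw [map_smul, Derivation.map_smul, map_smul, smul_comm eps c, RingHom.id_apply, smul_sub] }
    (by
      change s 1 - eps • s (η 1) = 1
      rw [Derivation.map_one_eq_zero, map_zero, smul_zero, sub_zero, map_one])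
    (fun a b => by
      change s (a * b) - eps • s (η (a * b)) = (s a - eps • s (η a)) * (s b - eps • s (η b))
      rw [sub_mul, mul_sub, mul_sub, smul_mul_smul_comm,
        show eps * eps = 0 from DualNumber.eps_mul_eps, zero_smul, sub_zero, Derivation.leibniz,
        map_add, smul_eq_mul, smul_eq_mul, smul_add, map_mul, map_mul, map_mul, mul_smul_comm,
        smul_mul_assoc, mul_comm (s b)]
      abel)
  have ht : ∀ h, t h = s h - eps • s (η h) := fun _ => rfl
  refine ⟨t, fun h => by rw [ht, map_sub, emb_eps_smul, sub_zero, hs], ?_⟩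
  rw [ht, ht, smul_sub, eps_smul_eps_smul, sub_zero, eq_neg_of_add_eq_zero_left hsg]
  have := hJ.eps_smul_of_mem hs hη
  rw [map_sub, map_sub, smul_sub, smul_sub] at this
  rw [← this]
  abel

theorem IsReducedEquation.hasEquation_std (hJ : IsReducedEquation f J) (g : O n) :
    (epsBasis.stdDeformation hJ fun _ => g).HasEquation f g := by
  refine ⟨(Ideal.Quotient.mkₐ ℂ _).comp Algebra.TensorProduct.includeRight, fun h => ?_, ?_⟩
  · change (epsBasis.stdDeformation hJ fun _ => g).emb (Ideal.Quotient.mk _ (1 ⊗ₜ h)) = _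
    rw [SquareZeroBasis.stdDeformation_emb, SquareZeroBasis.toFibre_one_tmul]
  · have h1 : eps • (1 : Eps) ⊗ₜ[ℂ] g = eps ⊗ₜ g := by
      rw [TensorProduct.smul_tmul', smul_eq_mul, mul_one]
    change Ideal.Quotient.mk (epsBasis.stdIdeal f fun _ => g)
      (1 ⊗ₜ f + eps • (1 : Eps) ⊗ₜ g) = 0
    rw [h1, Ideal.Quotient.eq_zero_iff_mem]
    have := epsBasis.pack_mem_stdIdeal f fun _ => g
    rwa [SquareZeroBasis.pack, Finset.univ_unique, Finset.sum_singleton] at this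

theorem Deformation.HasEquation.of_iso {X Y : Deformation resEps J} {g : O n}
    (h : X.HasEquation f g) (hXY : X.Iso Y) : Y.HasEquation f g := by
  obtain ⟨s, hs, hsg⟩ := h
  obtain ⟨τ, hτ⟩ := hXY
  have hc : ∀ h, ((τ.toAlgHom.restrictScalars ℂ).comp s) h = τ (s h) := fun _ => rfl
  refine ⟨(τ.toAlgHom.restrictScalars ℂ).comp s, fun h => ?_, ?_⟩
  · rw [hc, hτ, hs]
  · rw [hc, hc, ← map_smul, ← map_add, hsg, map_zero]

/-- The parametrisation extends to a surjection `ℂ[ε] ⊗ 𝒪 → 𝒪_X`. Its kernel is no larger than `(f +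
ε g)` because `X` is flat. -/
theorem IsReducedEquation.std_iso (hJ : IsReducedEquation f J) {X : Deformation resEps J} {g : O n}
    (h : X.HasEquation f g) : (epsBasis.stdDeformation hJ fun _ => g).Iso X := by
  obtain ⟨s, hs, hsg⟩ := h
  let Ψ : Eps ⊗[ℂ] O n →ₐ[Eps] X.Ring :=
    Algebra.TensorProduct.lift (Algebra.ofId Eps X.Ring) s fun _ _ => Commute.all _ _
  have hΨ : ∀ (a : O n) (b : Unit → O n), Ψ (epsBasis.pack a b) = s a + eps • s (b ()) := by
    intro a b
    rw [SquareZeroBasis.pack, Finset.univ_unique, Finset.sum_singleton, map_add,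
      Algebra.TensorProduct.lift_tmul, Algebra.TensorProduct.lift_tmul, map_one, one_mul]
    exact congrArg (s a + ·) (Algebra.smul_def _ _).symm
  have hsurj : Function.Surjective Ψ := fun z => by
    obtain ⟨a, ha⟩ := Ideal.Quotient.mk_surjective (X.emb z)
    obtain ⟨u, hu⟩ := exists_eps_smul hs (z := z - s a) (by rw [map_sub, hs, ha, sub_self])
    exact ⟨epsBasis.pack a fun _ => u, by rw [hΨ, ← hu, add_sub_cancel]⟩
  have hker : epsBasis.stdIdeal f (fun _ => g) = RingHom.ker Ψ := by
    ext F
    obtain ⟨a, b, rfl⟩ : ∃ a b, F = epsBasis.pack a b := ⟨_, _, epsBasis.pack_eta F⟩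
    rw [RingHom.mem_ker, hΨ, epsBasis.mem_stdIdeal hJ, SquareZeroBasis.toFibre_pack]
    simp only [SquareZeroBasis.comp_pack]
    have key : ∀ c, s (f * c) + eps • s (b ()) = eps • s (b () - c * g) := fun c => by
      rw [map_mul, eq_eps_smul hsg, smul_mul_assoc, ← map_mul, ← smul_add, ← map_add]
      congr 2
      ring
    constructor
    · rintro ⟨c, rfl, hb⟩
      rw [key]
      exact hJ.eps_smul_of_mem hs (hb ())
    · intro h
      have h0 : a ∈ J := by
        rw [← Ideal.Quotient.eq_zero_iff_mem, ← hs, eq_neg_of_add_eq_zero_left h, map_neg,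
          emb_eps_smul, neg_zero]
      obtain ⟨c, rfl⟩ := hJ.mem_iff.mp h0
      rw [key] at h
      exact ⟨c, rfl, fun _ => hJ.mem_of_eps_smul hs h⟩
  refine ⟨(Ideal.quotientEquivAlgOfEq Eps hker).trans
    (Ideal.quotientKerAlgEquivOfSurjective hsurj), fun z => ?_⟩
  obtain ⟨F, rfl⟩ := Ideal.Quotient.mk_surjective z
  change X.emb (Ψ F) = Ideal.Quotient.mk J (toFibre resEps F)
  conv_lhs => rw [epsBasis.pack_eta F, hΨ, map_add, emb_eps_smul, add_zero, hs]

theorem IsReducedEquation.iso_of_hasEquation (hJ : IsReducedEquation f J)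
    {X Y : Deformation resEps J} {g : O n} (hX : X.HasEquation f g) (hY : Y.HasEquation f g) :
    X.Iso Y :=
  Deformation.iso_equivalence.trans (Deformation.iso_equivalence.symm (hJ.std_iso hX))
    (hJ.std_iso hY)

/-- The equation of an admissible deformation. -/
theorem IsReducedEquation.extends_of_isAdmissible (hJ : IsReducedEquation f J)
    {X : Deformation resEps J} (hX : X.IsAdmissible) {g : O n} (hg : X.HasEquation f g) :
    hJ.Extends g := by
  intro δ α hα
  obtain ⟨s, hs, hsg⟩ := hg
  set δq := quotDerivation δ.2 with hδq
  -- Admissibility concerns the central fibre in its own embedding, not `V(J)`. So `δ` is first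
  -- carried over, as a derivation of `𝒪 / J`, to a vector field tangent to that fibre.
  choose c hc using fun i : Fin n => epsBasis.fibreEmb_surjective X (δq (X.fibreEmb (x i)))
  have key := hJ.eq_zero_of_twisted_leibniz X.fibreEmb X.fibreEmb
    (X.fibreEmb.toLinearMap.comp (vectorField c : O n →ₗ[ℂ] O n) -
      (δq : O n ⧸ J →ₗ[ℂ] O n ⧸ J).comp X.fibreEmb.toLinearMap)
    (fun a b => by
      change X.fibreEmb (vectorField c (a * b)) - δq (X.fibreEmb (a * b)) =
        X.fibreEmb a * (X.fibreEmb (vectorField c b) - δq (X.fibreEmb b)) +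
        (X.fibreEmb (vectorField c a) - δq (X.fibreEmb a)) * X.fibreEmb b
      rw [map_mul X.fibreEmb a b, Derivation.leibniz, Derivation.leibniz, map_add]
      simp only [smul_eq_mul, map_mul]
      ring)
    (by
      change X.fibreEmb (vectorField c 1) - δq (X.fibreEmb 1) = 0
      rw [map_one X.fibreEmb, Derivation.map_one_eq_zero, Derivation.map_one_eq_zero, map_zero, sub_zero])
    (fun i => by
      change X.fibreEmb (vectorField c (x i)) - δq (X.fibreEmb (x i)) = 0
      rw [vectorField_x, hc, sub_self])
  have hδ' : ∀ h, X.fibreEmb (vectorField c h) = δq (X.fibreEmb h) := fun h =>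
    sub_eq_zero.mp (LinearMap.congr_fun key h)
  have hfib : ∀ h, h ∈ X.ideal.map (toFibre resEps) ↔ X.fibreEmb h = 0 := by
    intro h
    rw [Ideal.mem_map_iff_of_surjective (toFibre resEps) fun h =>
      ⟨1 ⊗ₜ h, SquareZeroBasis.toFibre_one_tmul h⟩]
    constructor
    · rintro ⟨F, hF, rfl⟩
      rw [← epsBasis.emb_mk, Ideal.Quotient.eq_zero_iff_mem.mpr hF, map_zero]
    · intro h0
      obtain ⟨G, hG, hGh⟩ := X.exists_of_emb_eq_zero h0
      refine ⟨1 ⊗ₜ h - G, (Ideal.Quotient.mk_eq_mk_iff_sub_mem _ _).mp hGh.symm, ?_⟩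
      rw [map_sub, SquareZeroBasis.toFibre_one_tmul,
        (show toFibre resEps G = 0 from maxIdealExt_le_ker resEps hG), sub_zero]
  obtain ⟨Δ, hΔ, hΔδ⟩ := hX.1 (vectorField c) (fun h hh => by
    rw [hfib] at hh ⊢
    rw [hδ', hh, map_zero])
  set D := quotDerivation hΔ with hD
  have hemb : ∀ z, X.emb (D z) = δq (X.emb z) := by
    intro z
    obtain ⟨F, rfl⟩ := Ideal.Quotient.mk_surjective z
    rw [hD, quotDerivation_mk, epsBasis.emb_mk, hΔδ F, hδ', epsBasis.emb_mk]
  -- The lifted field, seen on the ring of `X` and compared with `δ` through `s`, differs from it by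
  -- `ε` times a vector field.
  obtain ⟨η, hη⟩ := hJ.exists_derivation hs hs
    ((D.restrictScalars ℂ : X.Ring →ₗ[ℂ] X.Ring).comp s.toLinearMap -
      s.toLinearMap.comp ((δ : Derivation ℂ (O n) (O n)) : O n →ₗ[ℂ] O n))
    (fun h => by
      change X.emb (D (s h) - s ((δ : Derivation ℂ (O n) (O n)) h)) = 0
      rw [map_sub, hemb, hs, hs, hδq, quotDerivation_mk, sub_self])
    (fun a b => by
      change D (s (a * b)) - s ((δ : Derivation ℂ (O n) (O n)) (a * b)) =
        s a * (D (s b) - s ((δ : Derivation ℂ (O n) (O n)) b)) +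
        (D (s a) - s ((δ : Derivation ℂ (O n) (O n)) a)) * s b
      rw [map_mul, Derivation.leibniz, Derivation.leibniz, map_add]
      simp only [smul_eq_mul, map_mul]
      ring)
  have hη' : ∀ h, D (s h) = s ((δ : Derivation ℂ (O n) (O n)) h) + eps • s (η h) := fun h =>
    sub_eq_iff_eq_add'.mp (hη h)
  refine ⟨η, hJ.mem_of_eps_smul hs ?_⟩
  -- Applying `D` to `s f + ε s g = 0` yields `ε s(η(f) - (α g - δ(g))) = 0`.
  have h1 := congrArg D hsg
  rw [map_add, Derivation.map_smul, map_zero, hη', hη', hα, smul_add, eps_smul_eps_smul, add_zero,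
    map_mul, eq_eps_smul hsg, mul_smul_comm, ← map_mul, ← smul_add, ← smul_add, ← map_add,
    ← map_add] at h1
  rw [← h1]
  congr 2
  ring

/-! ### Linear combinations of first order deformations -/

/-- The equations of the restrictions of a deformation over `ℂ[ε₁, ε₂] / (ε₁, ε₂)²`. -/
theorem IsReducedEquation.exists_hasEquation_baseChange (hJ : IsReducedEquation f J)
    (W : Deformation resEps2 J) : ∃ g : Bool → O n, ∀ (a b : ℂ) (X : Deformation resEps J),
      IsBaseChange (epsMap a b) W X → X.HasEquation f (a • g true + b • g false) := by
  obtain ⟨s, hs⟩ := eps2Basis.exists_isLift hJ W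
  obtain ⟨u, hu⟩ := eps2Basis.exists_eq_sum_smul hs (z := s f) (by
    rw [hs, Ideal.Quotient.eq_zero_iff_mem]; exact hJ.mem)
  -- A parametrisation of `W` pushes forward to one of every restriction, so the same `u` serves all
  -- `a`, `b`.
  refine ⟨fun i => -u i, fun a b X hX => ?_⟩
  set θ : Eps2 ⊗[ℂ] O n →ₐ[ℂ] Eps ⊗[ℂ] O n :=
    Algebra.TensorProduct.map (epsMap a b) (AlgHom.id ℂ (O n)) with hθ
  let β : W.Ring →ₐ[ℂ] X.Ring := Ideal.Quotient.liftₐ W.ideal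
    ((Ideal.Quotient.mkₐ ℂ X.ideal).comp θ) fun F hF => by
      change Ideal.Quotient.mk X.ideal (θ F) = 0
      rw [Ideal.Quotient.eq_zero_iff_mem, hX.1]
      exact Ideal.mem_map_of_mem _ hF
  have hβ : ∀ F, β (Ideal.Quotient.mk W.ideal F) = Ideal.Quotient.mk X.ideal (θ F) := fun _ => rfl
  have hβemb : ∀ z, X.emb (β z) = W.emb z := fun z => by
    obtain ⟨F, rfl⟩ := Ideal.Quotient.mk_surjective z
    rw [hβ]
    exact hX.2 F
  have hβsmul : ∀ (c : Eps2) z, β (c • z) = epsMap a b c • β z := fun c z => by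
    obtain ⟨F, rfl⟩ := Ideal.Quotient.mk_surjective z
    have h1 : c • Ideal.Quotient.mk W.ideal F = Ideal.Quotient.mk W.ideal (c • F) := rfl
    have h2 : ∀ (d : Eps) G, d • Ideal.Quotient.mk X.ideal G =
      Ideal.Quotient.mk X.ideal (d • G) := fun _ _ => rfl
    rw [h1, hβ, hβ, h2, Algebra.smul_def, Algebra.smul_def, map_mul,
      Algebra.TensorProduct.algebraMap_apply, Algebra.TensorProduct.algebraMap_apply, hθ,
      Algebra.TensorProduct.map_tmul, map_one]
    rfl
  refine ⟨β.comp s, fun h => by rw [AlgHom.comp_apply, hβemb, hs], ?_⟩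
  have h3 : ∀ (c : ℂ) (z : X.Ring), (c • eps) • z = eps • c • z := fun c z => by
    rw [smul_assoc, smul_comm]
  rw [AlgHom.comp_apply, AlgHom.comp_apply, hu, map_sum, Fintype.sum_bool, hβsmul, hβsmul,
    epsMap_e, epsMap_e, cond_true, cond_false, h3, h3, ← smul_add, ← smul_add]
  have h4 : a • β (s (u true)) + b • β (s (u false)) +
      β (s (a • -u true + b • -u false)) = 0 := by
    rw [← map_smul, ← map_smul, ← map_smul, ← map_smul, ← map_add, ← map_add, ← map_add, ← map_add]
    rw [show a • u true + b • u false + (a • -u true + b • -u false) = 0 by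
      rw [smul_neg, smul_neg]; abel, map_zero, map_zero]
  rw [h4, smul_zero]

/-! ### Cohomology classes and deformations -/

/-- The class of a cocycle. -/
def cocycleClass (J : Ideal (O n)) : Z1 J →ₗ[ℂ] H1 J := Submodule.mkQ _

theorem cocycleClass_eq_iff {ψ φ : Z1 J} :
    cocycleClass J ψ = cocycleClass J φ ↔ (ψ : C1 J) - φ ∈ LinearMap.range (d0 J) := by
  rw [cocycleClass, Submodule.mkQ_apply, Submodule.mkQ_apply, Submodule.Quotient.eq]
  rfl

theorem FD.mk_eq_iff {X Y : Deformation resEps J} {hX : X.IsAdmissible} {hY : Y.IsAdmissible} :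
    FD.mk X hX = FD.mk Y hY ↔ X.Iso Y :=
  ⟨fun h => Quotient.exact h, fun h => Quotient.sound (s := admissibleSetoid resEps J) h⟩

/-- The class `t` consists of the deformations `f + ε g = 0`, where `g` is a potential of a cocycle
in the class `c`. -/
def IsReducedEquation.Corresponds (hJ : IsReducedEquation f J) (c : H1 J) (t : FT1 J) : Prop :=
  ∃ (ψ : Z1 J) (g : O n) (X : Deformation resEps J) (hX : X.IsAdmissible),
    hJ.IsPotential (ψ : C1 J) g ∧ X.HasEquation f g ∧ cocycleClass J ψ = c ∧ FD.mk X hX = t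

theorem IsReducedEquation.IsPotential.std_isAdmissible {hJ : IsReducedEquation f J} {ψ : C1 J}
    {g : O n} (h : hJ.IsPotential ψ g) : (epsBasis.stdDeformation hJ fun _ => g).IsAdmissible :=
  epsBasis.stdDeformation_isAdmissible hJ fun _ => h.extends

theorem IsReducedEquation.corresponds_std (hJ : IsReducedEquation f J) {ψ : Z1 J} {g : O n}
    (h : hJ.IsPotential (ψ : C1 J) g) :
    hJ.Corresponds (cocycleClass J ψ)
      (FD.mk (epsBasis.stdDeformation hJ fun _ => g) h.std_isAdmissible) :=
  ⟨ψ, g, _, _, h, hJ.hasEquation_std g, rfl, rfl⟩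

/-- Both equalities say that `g - g'` lies in the Tyurina ideal. This makes the correspondence
well-defined and injective in both directions. -/
theorem IsReducedEquation.corresponds_iff (hJ : IsReducedEquation f J) {c c' : H1 J} {t t' : FT1 J}
    (h : hJ.Corresponds c t) (h' : hJ.Corresponds c' t') : c = c' ↔ t = t' := by
  obtain ⟨ψ, g, X, hX, hψ, hg, rfl, rfl⟩ := h
  obtain ⟨ψ', g', X', hX', hψ', hg', rfl, rfl⟩ := h'
  have hd : hJ.IsPotential ((ψ : C1 J) - ψ') (g - g') := by
    have := hψ.lin hψ' 1 (-1)
    simpa only [one_smul, neg_smul, ← sub_eq_add_neg] using this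
  rw [cocycleClass_eq_iff, FD.mk_eq_iff, hd.mem_range_d0_iff]
  constructor
  · rintro ⟨η, hη⟩
    exact hJ.iso_of_hasEquation hg (IsReducedEquation.HasEquation.congr hJ hg' η hη)
  · intro hiso
    exact hJ.hasEquation_sub hg' (hg.of_iso hiso)

/-- `H¹` is the space of first order admissible deformations. -/
theorem IsReducedEquation.exists_equiv (hJ : IsReducedEquation f J)
    (b : Module.Basis (Fin n) (O n) (derLog ℂ J)) :
    ∃ Φ : H1 J ≃ FT1 J, ∀ c, hJ.Corresponds c (Φ c) := by
  have h1 : ∀ c : H1 J, ∃ t, hJ.Corresponds c t := fun c => by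
    obtain ⟨ψ, rfl⟩ := Submodule.mkQ_surjective _ c
    obtain ⟨g, hg⟩ := hJ.exists_isPotential b ψ
    exact ⟨_, hJ.corresponds_std hg⟩
  have h2 : ∀ t : FT1 J, ∃ c, hJ.Corresponds c t := fun t => by
    obtain ⟨⟨X, hX⟩, rfl⟩ := Quotient.exists_rep t
    obtain ⟨g, hg⟩ := hJ.exists_hasEquation X
    obtain ⟨ψ, hψ⟩ := (hJ.extends_of_isAdmissible hX hg).exists_cocycle
    exact ⟨_, ψ, g, X, hX, hψ, hg, rfl, rfl⟩
  choose F hF using h1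
  choose G hG using h2
  exact ⟨⟨F, G, fun c => (hJ.corresponds_iff (hG _) (hF _)).mpr rfl,
    fun t => (hJ.corresponds_iff (hF _) (hG _)).mp rfl⟩, hF⟩

theorem IsReducedEquation.corresponds_iff_eq (hJ : IsReducedEquation f J) {Φ : H1 J ≃ FT1 J}
    (hΦ : ∀ c, hJ.Corresponds c (Φ c)) {c : H1 J} {t : FT1 J} (h : hJ.Corresponds c t) :
    c = Φ.symm t :=
  (Φ.eq_symm_apply).mpr ((hJ.corresponds_iff (hΦ c) h).mp rfl)

/-- Restricting along `(ε₁, ε₂) ↦ (α ε, β ε)` combines the equations linearly, and potentials are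
linear in the cocycle. Conversely, two potentials `g`, `g'` are realised by `f + ε₁ g + ε₂ g'`. -/
theorem FT1.IsLinComb.iff_of_equiv (hJ : IsReducedEquation f J) {Φ : H1 J ≃ FT1 J}
    (b : Module.Basis (Fin n) (O n) (derLog ℂ J))
    (hΦ : ∀ c, hJ.Corresponds c (Φ c)) (α β : ℂ) (s t r : FT1 J) :
    FT1.IsLinComb α β s t r ↔ Φ.symm r = α • Φ.symm s + β • Φ.symm t := by
  constructor
  · rintro ⟨W, -, X, Y, Z, hX, hY, hZ, hWX, hWY, hWZ, rfl, rfl, rfl⟩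
    obtain ⟨g, hg⟩ := hJ.exists_hasEquation_baseChange W
    have gX := hg 1 0 X hWX
    have gY := hg 0 1 Y hWY
    simp only [one_smul, zero_smul, zero_add, add_zero] at gX gY
    obtain ⟨ψ, hψ⟩ := (hJ.extends_of_isAdmissible hX gX).exists_cocycle
    obtain ⟨φ, hφ⟩ := (hJ.extends_of_isAdmissible hY gY).exists_cocycle
    rw [← hJ.corresponds_iff_eq hΦ ⟨ψ, _, X, hX, hψ, gX, rfl, rfl⟩,
      ← hJ.corresponds_iff_eq hΦ ⟨φ, _, Y, hY, hφ, gY, rfl, rfl⟩, ← map_smul, ← map_smul, ← map_add]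
    exact (hJ.corresponds_iff_eq hΦ ⟨α • ψ + β • φ, _, Z, hZ, hψ.lin hφ α β, hg α β Z hWZ,
      rfl, rfl⟩).symm
  · intro h
    obtain ⟨ψ, hψc⟩ := Submodule.mkQ_surjective _ (Φ.symm s)
    obtain ⟨φ, hφc⟩ := Submodule.mkQ_surjective _ (Φ.symm t)
    obtain ⟨g, hg⟩ := hJ.exists_isPotential b ψ
    obtain ⟨g', hg'⟩ := hJ.exists_isPotential b φ
    let u : Bool → O n := fun i => cond i g g'
    have hlin := hg.lin hg' α β
    have hX := isBaseChange_stdDeformation hJ 1 0 u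
    have hY := isBaseChange_stdDeformation hJ 0 1 u
    simp only [one_smul, zero_smul, zero_add, add_zero] at hX hY
    refine ⟨eps2Basis.stdDeformation hJ u,
      eps2Basis.stdDeformation_isAdmissible hJ (fun i => ?_), _, _, _, hg.std_isAdmissible,
      hg'.std_isAdmissible, hlin.std_isAdmissible, hX, hY,
      isBaseChange_stdDeformation hJ α β u, ?_, ?_, ?_⟩
    · cases i
      · exact hg'.extends
      · exact hg.extends
    · rw [← Φ.symm.injective.eq_iff, ← hJ.corresponds_iff_eq hΦ (hJ.corresponds_std hg)]
      exact hψc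
    · rw [← Φ.symm.injective.eq_iff, ← hJ.corresponds_iff_eq hΦ (hJ.corresponds_std hg')]
      exact hφc
    · have h5 : hJ.IsPotential ((α • ψ + β • φ : Z1 J) : C1 J) (α • g + β • g') := hlin
      rw [← Φ.symm.injective.eq_iff]
      refine (hJ.corresponds_iff_eq hΦ (hJ.corresponds_std h5)).symm.trans ?_
      rw [map_add, map_smul, map_smul, h, ← hψc, ← hφc]
      rfl

/-- The deformation `f + ε g = 0` belongs to the cocycles with potential `g`. -/
theorem IsReducedEquation.IsPotential.belongsTo {hJ : IsReducedEquation f J} {ψ : C1 J} {g : O n}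
    (h : hJ.IsPotential ψ g) : BelongsTo (epsBasis.stdDeformation hJ fun _ => g) ψ := by
  refine ⟨fun _ => rfl, fun δ => ?_⟩
  obtain ⟨η, hη⟩ := vfClass_surjective J (ψ δ)
  obtain ⟨α, hα⟩ := hJ.exists_factor δ.2
  refine ⟨η, hη, epsBasis.packVF δ fun _ => η, ?_, fun u => ?_⟩
  · refine (epsBasis.packVF_mem_derLog_iff hJ).mpr ⟨α, hα, fun _ => ?_⟩
    rw [← Ideal.Quotient.mk_eq_mk_iff_sub_mem, ← h δ α hα, ← hη, hJ.eval_vfClass]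
  · rw [SquareZeroBasis.packVF_one_tmul, SquareZeroBasis.pack, Finset.univ_unique,
      Finset.sum_singleton]
    rfl

/-! ### Weighted homogeneous germs -/

/-- The germs which are weighted homogeneous of weight `l`. -/
def homogeneousGerms (w : Fin n → ℕ) (l : ℤ) : Submodule ℂ (O n) where
  carrier := {h | ∀ d, germCoeff d h ≠ 0 → ((Finsupp.weight w d : ℕ) : ℤ) = l}
  zero_mem' d hd := absurd (map_zero _) hd
  add_mem' := fun {g h} hg hh d hd => by
    by_cases h0 : germCoeff d g = 0
    · exact hh d fun h1 => hd (by rw [map_add, h0, h1, add_zero])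
    · exact hg d h0
  smul_mem' c h hh d hd := hh d fun h0 => hd (by rw [map_smul, h0, smul_zero])

theorem mul_mem_homogeneousGerms {w : Fin n → ℕ} {k l : ℤ} {g h : O n}
    (hg : g ∈ homogeneousGerms w k) (hh : h ∈ homogeneousGerms w l) :
    g * h ∈ homogeneousGerms w (k + l) := by
  intro d hd
  rw [germCoeff_mul] at hd
  obtain ⟨⟨u, v⟩, huv, hne⟩ := Finset.exists_ne_zero_of_sum_ne_zero hd
  obtain ⟨h1, h2⟩ := ne_zero_and_ne_zero_of_mul hne
  rw [← Finset.HasAntidiagonal.mem_antidiagonal.mp huv, map_add, Nat.cast_add, hg u h1, hh v h2]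

theorem x_mem_homogeneousGerms (w : Fin n → ℕ) (i : Fin n) :
    (x i : O n) ∈ homogeneousGerms w (w i) := by
  intro d hd
  rw [germCoeff_x] at hd
  have hd' : d = Finsupp.single i 1 := by
    by_contra h
    exact hd (if_neg h)
  rw [hd', Finsupp.weight_single, one_smul]

theorem prod_mem_homogeneousGerms {w : Fin n → ℕ} {ι : Type*} (s : Finset ι) {g : ι → O n}
    {l : ℤ} (hg : ∀ i ∈ s, g i ∈ homogeneousGerms w l) :
    ∏ i ∈ s, g i ∈ homogeneousGerms w (s.card * l) := by
  classical
  induction s using Finset.induction_on with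
  | empty =>
    intro d hd
    rw [Finset.prod_empty, germCoeff_one] at hd
    have hd' : d = 0 := by
      by_contra h
      exact hd (if_neg h)
    simp [hd']
  | insert i s hi ih =>
    rw [Finset.prod_insert hi, Finset.card_insert_of_notMem hi, Nat.cast_add, Nat.cast_one,
      add_mul, one_mul, add_comm]
    exact mul_mem_homogeneousGerms (hg i (Finset.mem_insert_self _ _))
      (ih fun j hj => hg j (Finset.mem_insert_of_mem hj))

theorem partialD_mem_homogeneousGerms {w : Fin n → ℕ} {l : ℤ} {h : O n}
    (hh : h ∈ homogeneousGerms w l) (i : Fin n) :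
    partialD i h ∈ homogeneousGerms w (l - w i) := by
  intro d hd
  rw [germCoeff_partialD] at hd
  have := hh _ (left_ne_zero_of_mul hd)
  rw [map_add, Finsupp.weight_single, one_smul, Nat.cast_add] at this
  exact eq_sub_of_add_eq this

/-- Multiplication of the weight components of a germ by bounded factors. -/
def weightMul (w : Fin n → ℕ) (μ : ℤ → ℂ) (hμ : ∀ m, ‖μ m‖ ≤ 1) : O n →ₗ[ℂ] O n :=
  coeffMul (fun d => μ (Finsupp.weight w d : ℕ)) fun _ => hμ _

theorem germCoeff_weightMul (w : Fin n → ℕ) (μ : ℤ → ℂ) (hμ : ∀ m, ‖μ m‖ ≤ 1) (h : O n)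
    (d : Fin n →₀ ℕ) :
    germCoeff d (weightMul w μ hμ h) = μ (Finsupp.weight w d : ℕ) * germCoeff d h := rfl

/-- A homogeneous factor shifts weights by `l`. Multipliers therefore preserve the Tyurina ideal of
a homogeneous germ. -/
theorem weightMul_mul (w : Fin n → ℕ) (μ : ℤ → ℂ) (hμ : ∀ m, ‖μ m‖ ≤ 1) (c : O n) {h : O n} {l : ℤ}
    (hh : h ∈ homogeneousGerms w l) :
    weightMul w μ hμ (c * h) = weightMul w (fun m => μ (m + l)) (fun _ => hμ _) c * h := by
  refine germ_ext fun d => ?_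
  rw [germCoeff_weightMul, germCoeff_mul, germCoeff_mul, Finset.mul_sum]
  refine Finset.sum_congr rfl fun p hp => ?_
  rw [germCoeff_weightMul]
  by_cases h0 : germCoeff p.2 h = 0
  · simp [h0]
  · rw [← hh _ h0, ← Finset.HasAntidiagonal.mem_antidiagonal.mp hp, map_add, Nat.cast_add]
    ring

/-- The component of weight `l` of a germ. -/
def weightComponent (w : Fin n → ℕ) (l : ℤ) : O n →ₗ[ℂ] O n :=
  weightMul w (fun m => if m = l then 1 else 0) fun m => by split_ifs <;> simp

theorem germCoeff_weightComponent (w : Fin n → ℕ) (l : ℤ) (h : O n) (d : Fin n →₀ ℕ) :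
    germCoeff d (weightComponent w l h) =
      if ((Finsupp.weight w d : ℕ) : ℤ) = l then germCoeff d h else 0 := by
  rw [weightComponent, germCoeff_weightMul, ite_mul, one_mul, zero_mul]

theorem weightComponent_mem (w : Fin n → ℕ) (l : ℤ) (h : O n) :
    weightComponent w l h ∈ homogeneousGerms w l := by
  intro d hd
  rw [germCoeff_weightComponent] at hd
  by_contra h0
  exact hd (if_neg h0)

theorem weightComponent_of_mem {w : Fin n → ℕ} {l : ℤ} {h : O n}
    (hh : h ∈ homogeneousGerms w l) : weightComponent w l h = h := by
  refine germ_ext fun d => ?_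
  rw [germCoeff_weightComponent]
  split_ifs with h1
  · rfl
  · by_contra h0
    exact h1 (hh d (Ne.symm h0))

theorem weightComponent_mul (w : Fin n → ℕ) {m k l : ℤ} (hm : m = k + l) (c : O n) {h : O n}
    (hh : h ∈ homogeneousGerms w l) :
    weightComponent w m (c * h) = weightComponent w k c * h := by
  subst hm
  rw [weightComponent, weightMul_mul w _ _ c hh, weightComponent]
  simp only [add_left_inj]

theorem isHomogeneousVF_iff {w : Fin n → ℕ} {p : ℤ} {δ : Derivation ℂ (O n) (O n)} :
    IsHomogeneousVF w p δ ↔ ∀ i, δ (x i) ∈ homogeneousGerms w (p + w i) := Iff.rfl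

theorem IsHomogeneousVF.apply_mem {w : Fin n → ℕ} {p l : ℤ} {δ : Derivation ℂ (O n) (O n)}
    (hδ : IsHomogeneousVF w p δ) {h : O n} (hh : h ∈ homogeneousGerms w l) :
    δ h ∈ homogeneousGerms w (p + l) := by
  rw [derivation_apply_eq_sum]
  refine Submodule.sum_mem _ fun i _ => ?_
  have := mul_mem_homogeneousGerms (isHomogeneousVF_iff.mp hδ i)
    (partialD_mem_homogeneousGerms hh i)
  rwa [add_add_sub_cancel] at this

/-! ### The Euler field -/

theorem germCoeff_x_mul (i : Fin n) (h : O n) (d : Fin n →₀ ℕ) :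
    germCoeff d (x i * h) =
      if Finsupp.single i 1 ≤ d then germCoeff (d - Finsupp.single i 1) h else 0 := by
  rw [germCoeff_apply, map_mul, toSeries_x, MvPowerSeries.X, MvPowerSeries.coeff_monomial_mul,
    one_mul]
  rfl

/-- The Euler vector field `∑ wᵢ xᵢ ∂/∂xᵢ`. -/
def eulerVF (w : Fin n → ℕ) : Derivation ℂ (O n) (O n) := vectorField fun i => (w i : ℂ) • x i

theorem germCoeff_eulerVF (w : Fin n → ℕ) (h : O n) (d : Fin n →₀ ℕ) :
    germCoeff d (eulerVF w h) = (Finsupp.weight w d : ℕ) * germCoeff d h := by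
  have hterm : ∀ i, germCoeff d (((w i : ℂ) • x i) * partialD i h) =
      ((d i * w i : ℕ) : ℂ) * germCoeff d h := by
    intro i
    rw [smul_mul_assoc, map_smul, germCoeff_x_mul, smul_eq_mul]
    split_ifs with h1
    · rw [germCoeff_partialD, tsub_add_cancel_of_le h1]
      have h2 : (d - Finsupp.single i 1 : Fin n →₀ ℕ) i + 1 = d i := by
        have := DFunLike.congr_fun (tsub_add_cancel_of_le h1) i
        simpa using this
      have h3 : (((d - Finsupp.single i 1 : Fin n →₀ ℕ) i : ℕ) : ℂ) + 1 = d i := by exact_mod_cast h2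
      rw [h3]
      push_cast; ring
    · have h2 : d i = 0 := by
        by_contra h3
        exact h1 (Finsupp.single_le_iff.mpr (Nat.one_le_iff_ne_zero.mpr h3))
      simp [h2]
  rw [eulerVF, vectorField_apply, map_sum, Finset.sum_congr rfl fun i _ => hterm i,
    ← Finset.sum_mul, ← Nat.cast_sum, Finsupp.weight_apply, Finsupp.sum_fintype _ _ (by simp)]
  simp only [smul_eq_mul]

theorem eulerVF_apply_of_mem {w : Fin n → ℕ} {k : ℤ} (hf : f ∈ homogeneousGerms w k) :
    eulerVF w f = (k : ℂ) • f := by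
  refine germ_ext fun d => ?_
  rw [germCoeff_eulerVF, map_smul, smul_eq_mul]
  by_cases h0 : germCoeff d f = 0
  · simp [h0]
  · rw [← hf d h0, Int.cast_natCast]

/-- Modulo the Tyurina ideal, an admissible equation is homogeneous of the weight of `f`. -/
theorem IsReducedEquation.Extends.exists_homogeneous {hJ : IsReducedEquation f J}
    {w : Fin n → ℕ} {k : ℤ} (hf : f ∈ homogeneousGerms w k) {g : O n} (hg : hJ.Extends g) :
    ∃ η : Derivation ℂ (O n) (O n), g - weightComponent w k g - η f ∈ J := by
  have hχ : eulerVF w f = algebraMap ℂ (O n) k * f := by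
    rw [eulerVF_apply_of_mem hf, Algebra.smul_def]
  obtain ⟨η, hη⟩ := hg ⟨eulerVF w, hJ.mem_derLog_iff.mpr (by
    rw [hχ]; exact J.mul_mem_left _ hJ.mem)⟩ _ hχ
  obtain ⟨β, hβ⟩ := hJ.mem_iff.mp hη
  have hβ' : eulerVF w g - (k : ℂ) • g = β * f - η f := by
    rw [mul_comm β, ← hβ, Algebra.smul_def]
    ring
  -- This inverts `χ - k` off weight `k`. Distinct integers are at distance at least one, so the
  -- factors are bounded and convergence is preserved.
  let μ : ℤ → ℂ := fun m => if m = k then 0 else ((m : ℂ) - k)⁻¹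
  have hμ : ∀ m, ‖μ m‖ ≤ 1 := fun m => by
    by_cases h : m = k
    · simp [μ, h]
    · simp only [μ, if_neg h, norm_inv]
      refine inv_le_one_of_one_le₀ ?_
      rw [← Int.cast_sub, Complex.norm_intCast]
      have : 1 ≤ |m - k| := Int.one_le_abs (sub_ne_zero.mpr h)
      exact_mod_cast this
  have hleft : weightMul w μ hμ (eulerVF w g - (k : ℂ) • g) = g - weightComponent w k g := by
    refine germ_ext fun d => ?_
    rw [germCoeff_weightMul, map_sub, map_sub, germCoeff_eulerVF, map_smul, smul_eq_mul,
      germCoeff_weightComponent, ← sub_mul, ← mul_assoc]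
    by_cases h : ((Finsupp.weight w d : ℕ) : ℤ) = k
    · simp [μ, h]
    · have h1 : (((Finsupp.weight w d : ℕ) : ℤ) : ℂ) - k ≠ 0 := by
        rw [← Int.cast_sub]
        exact_mod_cast sub_ne_zero.mpr h
      simp only [μ, if_neg h]
      rw [← Int.cast_natCast (R := ℂ), inv_mul_cancel₀ h1, one_mul, sub_zero]
  have hηf : η f = ∑ i, η (x i) * partialD i f := derivation_apply_eq_sum η f
  -- Apply the multiplier to `χ(g) - k g = β f - ∑ η(xᵢ) ∂ᵢf`; the shift is the weight `k - wᵢ` of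
  -- `∂ᵢf`.
  refine ⟨-vectorField fun i => weightMul w (fun m => μ (m + (k - w i))) (fun _ => hμ _)
    (η (x i)), ?_⟩
  rw [← hleft, hβ', map_sub, weightMul_mul w μ hμ β hf, hηf, map_sum, Derivation.neg_apply,
    vectorField_apply, Finset.sum_congr rfl fun i _ =>
      weightMul_mul w μ hμ (η (x i)) (partialD_mem_homogeneousGerms hf i), sub_neg_eq_add,
    sub_add_cancel]
  exact J.mul_mem_left _ hJ.mem

/-- Homogeneous logarithmic fields have homogeneous lifts. -/
theorem IsReducedEquation.Extends.exists_homogeneous_lift {hJ : IsReducedEquation f J}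
    {w : Fin n → ℕ} {k p : ℤ} (hf : f ∈ homogeneousGerms w k) {g : O n} (hg : hJ.Extends g)
    (hgk : g ∈ homogeneousGerms w k) {δ : derLog ℂ J}
    (hδ : IsHomogeneousVF w p (δ : Derivation ℂ (O n) (O n))) :
    ∃ (η : Derivation ℂ (O n) (O n)) (α : O n), IsHomogeneousVF w p η ∧
      (δ : Derivation ℂ (O n) (O n)) f = α * f ∧
      η f - (α * g - (δ : Derivation ℂ (O n) (O n)) g) ∈ J := by
  obtain ⟨α, hα⟩ := hJ.exists_factor δ.2
  have hα' : (δ : Derivation ℂ (O n) (O n)) f = weightComponent w p α * f := by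
    rw [← weightComponent_mul w rfl α hf, ← hα, weightComponent_of_mem (hδ.apply_mem hf)]
  obtain ⟨η, hη⟩ := hg δ _ hα'
  obtain ⟨β, hβ⟩ := hJ.mem_iff.mp hη
  refine ⟨vectorField fun i => weightComponent w (p + w i) (η (x i)), _,
    isHomogeneousVF_iff.mpr fun i => ?_, hα', hJ.mem_iff.mpr ⟨weightComponent w p β, ?_⟩⟩
  · rw [vectorField_x]
    exact weightComponent_mem w _ _
  · have h1 := congrArg (weightComponent w (p + k)) hβ
    rw [mul_comm f β, weightComponent_mul w rfl β hf, map_sub, derivation_apply_eq_sum, map_sum,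
      Finset.sum_congr rfl fun i _ => weightComponent_mul w (show p + k = (p + w i) + (k - w i) by
        ring) (η (x i)) (partialD_mem_homogeneousGerms hf i),
      weightComponent_of_mem (Submodule.sub_mem _ (mul_mem_homogeneousGerms
        (weightComponent_mem w p α) hgk) (hδ.apply_mem hgk))] at h1
    rw [vectorField_apply, h1, mul_comm]

/-- The first cohomology of a weighted homogeneous free divisor is concentrated in weight zero. -/
theorem IsReducedEquation.weightZeroH1_eq_top (hJ : IsReducedEquation f J)
    (b : Module.Basis (Fin n) (O n) (derLog ℂ J)) {w : Fin n → ℕ} {k : ℤ}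
    (hf : f ∈ homogeneousGerms w k) : weightZeroH1 w J = ⊤ := by
  refine eq_top_iff.mpr fun c _ => ?_
  obtain ⟨ψ, rfl⟩ := Submodule.mkQ_surjective _ c
  obtain ⟨g, hg⟩ := hJ.exists_isPotential b ψ
  obtain ⟨η, hη⟩ := hg.extends.exists_homogeneous hf
  -- Subtracting this coboundary makes the potential homogeneous of weight `k`. The resulting
  -- cocycle then preserves weights.
  have hZ : d0 J (vfClass J η) ∈ Z1 J := LinearMap.mem_ker.mpr (d1_d0 J _)
  let φ : Z1 J := ψ - ⟨_, hZ⟩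
  have hφ : hJ.IsPotential (φ : C1 J) (weightComponent w k g) := by
    have h1 := (hg.lin (hJ.isPotential_d0 η) 1 (-1)).lin (hJ.isPotential_zero hη) 1 (-1)
    simp only [one_smul, neg_smul, neg_zero, add_zero] at h1
    convert h1 using 1
    · exact sub_eq_add_neg _ _
    · abel
  refine ⟨φ, fun p δ hδ => ?_, ?_⟩
  · obtain ⟨θ, α, hθ, hα, hm⟩ := hφ.extends.exists_homogeneous_lift hf
      (weightComponent_mem w k g) hδ
    refine ⟨θ, hθ, hJ.eval_injective ?_⟩
    rw [hφ δ α hα, hJ.eval_vfClass, eq_comm, Ideal.Quotient.mk_eq_mk_iff_sub_mem]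
    exact hm
  · refine cocycleClass_eq_iff.mpr ⟨-vfClass J η, ?_⟩
    rw [map_neg]
    change _ = (ψ : C1 J) - d0 J (vfClass J η) - ψ
    abel

/-! ### Linear free divisors -/

theorem mem_span_x_iff {h : O n} :
    h ∈ Submodule.span ℂ (Set.range (x (n := n))) ↔ h ∈ homogeneousGerms (fun _ => 1) 1 := by
  have hw : ∀ d : Fin n →₀ ℕ, Finsupp.weight (fun _ : Fin n => 1) d = d.degree := fun d => by
    rw [Finsupp.weight_apply, Finsupp.sum_fintype _ _ (by simp), Finsupp.degree_eq_sum]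
    simp
  constructor
  · intro hh
    refine (Submodule.span_le (p := homogeneousGerms (fun _ => 1) 1)).mpr ?_ hh
    rintro _ ⟨i, rfl⟩
    exact x_mem_homogeneousGerms (fun _ => 1) i
  · intro hh
    have : h = ∑ i, germCoeff (Finsupp.single i 1) h • x i := by
      refine germ_ext fun d => ?_
      rw [map_sum]
      simp only [map_smul, germCoeff_x, smul_eq_mul, mul_ite, mul_one, mul_zero]
      by_cases hd : ∃ i, d = Finsupp.single i 1
      · obtain ⟨i, rfl⟩ := hd
        rw [Finset.sum_eq_single i]
        · rw [if_pos rfl]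
        · intro j _ hji
          refine if_neg fun h1 => hji ?_
          exact ((Finsupp.single_left_injective one_ne_zero) h1).symm
        · simp
      · rw [Finset.sum_eq_zero fun i _ => if_neg fun h1 => hd ⟨i, h1⟩]
        by_contra h0
        have h1 := hh d h0
        rw [hw] at h1
        exact hd ((Finsupp.sum_eq_one_iff d).mp (show d.degree = 1 by exact_mod_cast h1))
    rw [this]
    exact Submodule.sum_mem _ fun i _ => Submodule.smul_mem _ _ (Submodule.subset_span ⟨i, rfl⟩)

theorem isHomogeneousVF_zero_iff {δ : Derivation ℂ (O n) (O n)} :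
    IsHomogeneousVF (fun _ => 1) 0 δ ↔
      ∀ i, δ (x i) ∈ Submodule.span ℂ (Set.range (x (n := n))) := by
  rw [isHomogeneousVF_iff]
  refine forall_congr' fun i => ?_
  rw [mem_span_x_iff]
  simp

theorem det_mem_homogeneousGerms {w : Fin n → ℕ} {l : ℤ} {M : Matrix (Fin n) (Fin n) (O n)}
    (hM : ∀ i j, M i j ∈ homogeneousGerms w l) : M.det ∈ homogeneousGerms w (n * l) := by
  rw [Matrix.det_apply]
  refine Submodule.sum_mem _ fun σ _ => ?_
  rw [Units.smul_def]
  refine zsmul_mem ?_ _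
  have := prod_mem_homogeneousGerms (w := w) (l := l) (Finset.univ : Finset (Fin n))
    (g := fun i => M (σ i) i) fun i _ => hM _ _
  simpa using this

/-- Homogeneous admissible equations define linearly admissible deformations. -/
theorem IsReducedEquation.std_isLinearlyAdmissible (hJ : IsReducedEquation f J)
    {A : Type} [CommRing A] [Algebra ℂ A] {π : A →ₐ[ℂ] ℂ} {ι : Type} [Fintype ι] [DecidableEq ι]
    (S : SquareZeroBasis π ι) (b : Module.Basis (Fin n) (O n) (derLog ℂ J))
    (hb : ∀ i j, (b i : Derivation ℂ (O n) (O n)) (x j) ∈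
      Submodule.span ℂ (Set.range (x (n := n)))) {k : ℤ}
    (hf : f ∈ homogeneousGerms (fun _ => 1) k) {g : ι → O n} (hg : ∀ i, hJ.Extends (g i))
    (hgk : ∀ i, g i ∈ homogeneousGerms (fun _ => 1) k) :
    (S.stdDeformation hJ g).IsLinearlyAdmissible := by
  choose η α hη hα hm using fun l i => (hg i).exists_homogeneous_lift (δ := b l) hf (hgk i)
    (isHomogeneousVF_zero_iff.mpr (hb l))
  refine S.stdDeformation_isLinearlyAdmissible hJ b hb hg η (fun l => ?_)
    fun l i => isHomogeneousVF_zero_iff.mp (hη l i)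
  obtain ⟨β, hβ⟩ := hJ.exists_factor (b l).2
  refine (S.packVF_mem_derLog_iff hJ).mpr ⟨β, hβ, fun i => ?_⟩
  rw [show β = α l i from mul_right_cancel₀ hJ.ne_zero (hβ.symm.trans (hα l i))]
  exact hm l i

theorem LFD.mk_eq_iff {X Y : Deformation resEps J} {hX : X.IsLinearlyAdmissible}
    {hY : Y.IsLinearlyAdmissible} : LFD.mk X hX = LFD.mk Y hY ↔ X.Iso Y :=
  ⟨fun h => Quotient.exact h, fun h => Quotient.sound (s := linearlyAdmissibleSetoid resEps J) h⟩

theorem LFD.toFD_injective : Function.Injective (LFD.toFD : LFT1 J → FT1 J) := by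
  intro s t h
  obtain ⟨⟨X, hX⟩, rfl⟩ := Quotient.exists_rep s
  obtain ⟨⟨Y, hY⟩, rfl⟩ := Quotient.exists_rep t
  exact LFD.mk_eq_iff.mpr (FD.mk_eq_iff.mp h)

/-- An equation may be changed within the Tyurina ideal, in particular to its component of weight
`k`. -/
theorem IsReducedEquation.exists_homogeneous_equation (hJ : IsReducedEquation f J)
    {w : Fin n → ℕ} {k : ℤ} (hf : f ∈ homogeneousGerms w k) (t : FT1 J) :
    ∃ (g : O n) (hg : hJ.Extends g), g ∈ homogeneousGerms w k ∧
      FD.mk (epsBasis.stdDeformation hJ fun _ => g)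
        (epsBasis.stdDeformation_isAdmissible hJ fun _ => hg) = t := by
  obtain ⟨⟨X, hX⟩, rfl⟩ := Quotient.exists_rep t
  obtain ⟨g, hg⟩ := hJ.exists_hasEquation X
  obtain ⟨η, hη⟩ := (hJ.extends_of_isAdmissible hX hg).exists_homogeneous hf
  have h1 : X.HasEquation f (weightComponent w k g) :=
    IsReducedEquation.HasEquation.congr hJ hg (-η) (by
      rw [Derivation.neg_apply]
      convert J.neg_mem hη using 1
      ring)
  exact ⟨_, hJ.extends_of_isAdmissible hX h1, weightComponent_mem w k g,
    FD.mk_eq_iff.mpr (hJ.std_iso h1)⟩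

theorem LFT1.IsLinComb.toFD {a b : ℂ} {s t r : LFT1 J} (h : LFT1.IsLinComb a b s t r) :
    FT1.IsLinComb a b (LFD.toFD s) (LFD.toFD t) (LFD.toFD r) := by
  obtain ⟨W, hW, X, Y, Z, hX, hY, hZ, hWX, hWY, hWZ, rfl, rfl, rfl⟩ := h
  exact ⟨W, hW.1, X, Y, Z, hX.1, hY.1, hZ.1, hWX, hWY, hWZ, rfl, rfl, rfl⟩

/-- Each class has a homogeneous equation, which defines a linearly admissible deformation. The same
holds over `ℂ[ε₁, ε₂]` for two such equations at once. -/
theorem IsReducedEquation.linear_bijective_and_isLinComb (hJ : IsReducedEquation f J)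
    (b : Module.Basis (Fin n) (O n) (derLog ℂ J))
    (hb : ∀ i j, (b i : Derivation ℂ (O n) (O n)) (x j) ∈
      Submodule.span ℂ (Set.range (x (n := n)))) {k : ℤ}
    (hf : f ∈ homogeneousGerms (fun _ => 1) k) :
    Function.Bijective (LFD.toFD : LFT1 J → FT1 J) ∧
      ∀ (α β : ℂ) (s t r : LFT1 J), LFT1.IsLinComb α β s t r ↔
        FT1.IsLinComb α β (LFD.toFD s) (LFD.toFD t) (LFD.toFD r) := by
  refine ⟨⟨LFD.toFD_injective, fun t => ?_⟩, fun α β s t r => ⟨LFT1.IsLinComb.toFD, fun h => ?_⟩⟩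
  · obtain ⟨g, hg, hgk, rfl⟩ := hJ.exists_homogeneous_equation hf t
    exact ⟨LFD.mk _ (hJ.std_isLinearlyAdmissible epsBasis b hb hf (fun _ => hg) fun _ => hgk), rfl⟩
  · obtain ⟨g, hg, hgk, hgs⟩ := hJ.exists_homogeneous_equation hf (LFD.toFD s)
    obtain ⟨g', hg', hgk', hgt⟩ := hJ.exists_homogeneous_equation hf (LFD.toFD t)
    let u : Bool → O n := fun i => cond i g g'
    have hu : ∀ i, hJ.Extends (u i) := fun i => by cases i; exacts [hg', hg]
    have huk : ∀ i, u i ∈ homogeneousGerms (fun _ => 1) k := fun i => by cases i; exacts [hgk', hgk]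
    obtain ⟨ψ, hψ⟩ := hg.exists_cocycle
    obtain ⟨φ, hφ⟩ := hg'.exists_cocycle
    have hlin : hJ.Extends (α • g + β • g') := (hψ.lin hφ α β).extends
    have hX := isBaseChange_stdDeformation hJ 1 0 u
    have hY := isBaseChange_stdDeformation hJ 0 1 u
    simp only [one_smul, zero_smul, zero_add, add_zero] at hX hY
    have hlin' : LFT1.IsLinComb α β s t (LFD.mk _ (hJ.std_isLinearlyAdmissible epsBasis b hb hf
        (fun _ => hlin) fun _ => Submodule.add_mem _ (Submodule.smul_mem _ α hgk)
          (Submodule.smul_mem _ β hgk'))) :=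
      ⟨eps2Basis.stdDeformation hJ u, hJ.std_isLinearlyAdmissible eps2Basis b hb hf hu huk, _, _, _,
        hJ.std_isLinearlyAdmissible epsBasis b hb hf (fun _ => hg) fun _ => hgk,
        hJ.std_isLinearlyAdmissible epsBasis b hb hf (fun _ => hg') fun _ => hgk', _, hX, hY,
        isBaseChange_stdDeformation hJ α β u, LFD.toFD_injective hgs, LFD.toFD_injective hgt, rfl⟩
    -- The combination constructed in `LFT1` and the given `r` have the same image in `FT1`, where
    -- linear combinations are unique.
    obtain ⟨Φ, hΦ⟩ := hJ.exists_equiv b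
    have h1 := (FT1.IsLinComb.iff_of_equiv hJ b hΦ α β _ _ _).mp h
    have h2 := (FT1.IsLinComb.iff_of_equiv hJ b hΦ α β _ _ _).mp hlin'.toFD
    rwa [LFD.toFD_injective (Φ.symm.injective (h2.trans h1.symm))] at hlin'

/-! ### The tangent space of the functor of admissible deformations -/

theorem IsFreeDivisorGerm.exists_isReducedEquation (hD : IsFreeDivisorGerm J) :
    ∃ f, IsReducedEquation f J := by
  obtain ⟨f, hf, hf0, hJ⟩ := hD.hypersurface
  refine ⟨f, hf, hJ, fun h => ?_, hD.reduced⟩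
  obtain ⟨c, hc⟩ := Ideal.mem_span_singleton.mp (hJ ▸ h ▸ trivial : (1 : O n) ∈ Ideal.span {f})
  have h1 := congrArg (fun h => MvPowerSeries.constantCoeff (toSeries n h)) hc
  simp [hf0] at h1

theorem IsReducedEquation.of_span_eq (hJ : IsReducedEquation f J) {g : O n}
    (hg : J = Ideal.span {g}) : IsReducedEquation g J := by
  refine ⟨fun h => hJ.ne_zero ?_, hg, hJ.ne_top, hJ.isRadical⟩
  have := hJ.mem
  rw [hg, h] at this
  simpa using this

end FreeDiv

end

/-! ### The two isomorphisms -/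

open FreeDiv in
theorem mainTheorem11 (n : ℕ) (J : Ideal (O n)) (hD : IsFreeDivisorGerm J) :
    (∀ (w : Fin n → ℕ) (k : ℕ) (f : MvPolynomial (Fin n) ℂ), (∀ i, 0 < w i) →
      f.IsWeightedHomogeneous w k → J = Ideal.span {polyGerm f} →
      ∃ Φ : weightZeroH1 w J ≃ FT1 J,
        (∀ (a b : ℂ) (s t r : FT1 J),
          FT1.IsLinComb a b s t r ↔ Φ.symm r = a • Φ.symm s + b • Φ.symm t) ∧
        ∀ ψ : weightZeroCocycles w J, ∃ (X : Deformation resEps J) (hX : X.IsAdmissible),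
          BelongsTo X (ψ : Z1 J) ∧ Φ (weightZeroClass w J ψ) = FD.mk X hX) ∧
    (IsLinear J →
      Function.Bijective (LFD.toFD : LFT1 J → FT1 J) ∧
      ∀ (a b : ℂ) (s t r : LFT1 J),
        LFT1.IsLinComb a b s t r ↔
          FT1.IsLinComb a b (LFD.toFD s) (LFD.toFD t) (LFD.toFD r)) := by
  obtain ⟨f₀, hJ₀⟩ := hD.exists_isReducedEquation
  constructor
  · intro w k f _ hf hspan
    have hJ := hJ₀.of_span_eq hspan
    have := hD.free
    obtain ⟨b⟩ := hJ.nonempty_basis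
    have hfk : polyGerm f ∈ homogeneousGerms w (k : ℤ) := fun d hd => by
      have h1 : f.coeff d ≠ 0 := by
        rwa [germCoeff_apply, show toSeries n (polyGerm f) = (f : MvPowerSeries (Fin n) ℂ) from rfl,
          MvPolynomial.coeff_coe] at hd
      exact_mod_cast hf h1
    -- The weight-zero part is all of `H¹`, so the isomorphism for `H¹` can be used unchanged.
    have htop := hJ.weightZeroH1_eq_top b hfk
    obtain ⟨Φ, hΦ⟩ := hJ.exists_equiv b
    refine ⟨(LinearEquiv.ofTop _ htop).toEquiv.trans Φ, fun a c s t r => ?_, fun ψ => ?_⟩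
    · rw [FT1.IsLinComb.iff_of_equiv hJ b hΦ]
      exact ⟨fun h => Subtype.ext h, fun h => congrArg Subtype.val h⟩
    · obtain ⟨g, hg⟩ := hJ.exists_isPotential b (ψ : Z1 J)
      refine ⟨_, hg.std_isAdmissible, hg.belongsTo, ?_⟩
      exact (hJ.corresponds_iff (hΦ _) (hJ.corresponds_std hg)).mp rfl
  · rintro ⟨b, hb⟩
    obtain ⟨u, hu⟩ := hJ₀.exists_unit_det b
    -- The given equation need not be homogeneous, so it is replaced by Saito's determinant of the
    -- linear basis, which is homogeneous of degree `n`.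
    have hJ := hJ₀.of_span_eq (g := (coeffMatrix fun i => (b i : Derivation ℂ (O n) (O n))).det) (by
      rw [hu, hJ₀.eq_span, Ideal.span_singleton_mul_left_unit u.isUnit])
    exact hJ.linear_bijective_and_isLinComb b hb
      (det_mem_homogeneousGerms fun i j => mem_span_x_iff.mp (hb i j))
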